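/- Call an integer matrix $A$ $\Delta$-modular if all its sub-determinants of order $\operatorname{rank}(A)$ are at most $\Delta$ in absolute value. Let $n,\Delta\ge 1$ be integers. The inputs are two full-dimensional simplices $\mathcal S=\{x\in\mathbb R^n: Ax\le b\}$ and $\mathcal T=\{x\in\mathbb R^n: A'x\le b'\}$, given by the integer systems $(A,b)$ and $(A',b')$ with $A,A'\in\mathbb Z^{(n+1)\times n}$ and $b,b'\in\mathbb Z^{n+1}$, where $A$ and $A'$ are $\Delta$-modular. Then there is an algorithm (one program for all $n$, $\Delta$ and all inputs) which decides whether $\mathcal S$ and $\mathcal T$ are unimodularly equivalent, that is, whether there are $U\in\mathbb Z^{n\times n}$ with $\det U=\pm1$ and $x_0\in\mathbb Z^n$ such that the map $x\mapsto Ux+x_0$ sends $\mathcal S$ onto $\mathcal T$. The algorithm uses at most $$ n^{\log_2\Delta}\cdot\Delta!\cdot\operatorname{poly}(n,\Delta) $$ operations (integer additions, subtractions, multiplications, divisions with remainder, comparisons, memory accesses and branchings of a random access machine), and all integers that occur have bit length polynomial in the encoding length of $(A,b)$ and $(A',b')$. For every fixed $\Delta$, the bound on the number of operations is polynomial in $n$.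 -/

import Mathlib

/-! ### Simplices given by integer systems -/

/-- A system `A x ≤ b` of `n + 1` linear inequalities in `n` variables with integer data. -/
structure IneqSystem (n : ℕ) where
  A : Matrix (Fin (n + 1)) (Fin n) ℤ
  b : Fin (n + 1) → ℤ

/-- The maximal absolute value of a `k × k` sub-determinant of an integer matrix.  Selections of
rows or columns with repetitions contribute `0`, and the order of a selection only affects the
sign, so this is the maximum over the `k`-element sets of rows and of columns. -/
def maxMinor {m n : ℕ} (k : ℕ) (A : Matrix (Fin m) (Fin n) ℤ) : ℕ :=
  Finset.univ.sup fun s : (Fin k → Fin m) × (Fin k → Fin n) =>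
    (A.submatrix s.1 s.2).det.natAbs

/-- `A` is `Δ`-modular: its sub-determinants of order `rank A` are at most `Δ` in absolute
value. -/
def IsDeltaModular {m n : ℕ} (Δ : ℕ) (A : Matrix (Fin m) (Fin n) ℤ) : Prop :=
  maxMinor (A.map (Int.cast : ℤ → ℝ)).rank A ≤ Δ

/-- The solution set of `A x ≤ b` in `ℝⁿ`. -/
def IneqSystem.toSet {n : ℕ} (S : IneqSystem n) : Set (Fin n → ℝ) :=
  {x | (S.A.map (Int.cast : ℤ → ℝ)).mulVec x ≤ fun i => (S.b i : ℝ)}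

/-- A (full-dimensional) simplex in `ℝⁿ`: the convex hull of `n + 1` affinely independent
points. -/
def IsSimplex {n : ℕ} (P : Set (Fin n → ℝ)) : Prop :=
  ∃ v : Fin (n + 1) → (Fin n → ℝ), AffineIndependent ℝ v ∧ P = convexHull ℝ (Set.range v)

/-- `P` and `Q` are unimodularly equivalent: some map `x ↦ U x + x₀` with `U` an integer matrix of
determinant `±1` and `x₀` an integer vector maps `P` onto `Q`. -/
def UnimodularEquiv {n : ℕ} (P Q : Set (Fin n → ℝ)) : Prop :=
  ∃ (U : Matrix (Fin n) (Fin n) ℤ) (x₀ : Fin n → ℤ), IsUnit U.det ∧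
    (fun x : Fin n → ℝ => (U.map (Int.cast : ℤ → ℝ)).mulVec x + fun i => (x₀ i : ℝ)) '' P = Q

/-- The length of the binary representation of an integer, with a sign bit. -/
def bitLength (z : ℤ) : ℕ := Nat.size z.natAbs + 1

/-- The encoding length of a system: the total bit length of its coefficients. -/
def IneqSystem.encodingLength {n : ℕ} (S : IneqSystem n) : ℕ :=
  (∑ i, ∑ j, bitLength (S.A i j)) + ∑ i, bitLength (S.b i)

/-! ### A random access machine over the integers

Programs are finite structured programs over finitely many integer arrays with indirect
addressing.  Every arithmetic operation, comparison, memory access and branching counts as one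
operation; a second parameter bounds the bit lengths of all the integers that occur. -/

namespace RAM

/-- The memory: cell `i` of the array `a` holds the integer `σ a i`. -/
abbrev Store := ℕ → ℤ → ℤ

/-- The binary operations of the machine. -/
inductive Op
  | add | sub | mul | div | mod | lt | eq

/-- `div` and `mod` are integer division with non-negative remainder (with the conventions
`x / 0 = 0` and `x % 0 = x`), and comparisons return `1` or `0`. -/
def Op.eval : Op → ℤ → ℤ → ℤ
  | .add, x, y => x + y
  | .sub, x, y => x - y
  | .mul, x, y => x * y
  | .div, x, y => x / y
  | .mod, x, y => x % y
  | .lt, x, y => if x < y then 1 else 0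
  | .eq, x, y => if x = y then 1 else 0

/-- Expressions: integer constants, the content of a cell of an array with a computed index, and
binary operations. -/
inductive Expr
  | const (c : ℤ)
  | read (a : ℕ) (i : Expr)
  | op (o : Op) (x y : Expr)

/-- The value of an expression. -/
def Expr.eval (σ : Store) : Expr → ℤ
  | .const c => c
  | .read a i => σ a (i.eval σ)
  | .op o x y => o.eval (x.eval σ) (y.eval σ)

/-- The number of operations needed to evaluate an expression. -/
def Expr.cost : Expr → ℕ
  | .const _ => 1
  | .read _ i => i.cost + 1
  | .op _ x y => x.cost + y.cost + 1

/-- All the integers that occur in the evaluation of an expression, indices and intermediate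
results included, have at most `B` bits. -/
def Expr.Fits (B : ℕ) (σ : Store) : Expr → Prop
  | .const c => bitLength c ≤ B
  | .read a i => i.Fits B σ ∧ bitLength (σ a (i.eval σ)) ≤ B
  | .op o x y => x.Fits B σ ∧ y.Fits B σ ∧ bitLength (o.eval (x.eval σ) (y.eval σ)) ≤ B

/-- Programs.  `write a i v` stores the value of `v` in the cell of the array `a` whose index is
the value of `i`; a condition holds if its value is not `0`. -/
inductive Program
  | skip
  | write (a : ℕ) (i v : Expr)
  | seq (p q : Program)
  | ite (c : Expr) (p q : Program)
  | loop (c : Expr) (p : Program)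

/-- The memory after storing `v` in the cell `i` of the array `a`. -/
def Store.set (σ : Store) (a : ℕ) (i v : ℤ) : Store :=
  fun a' i' => if a' = a ∧ i' = i then v else σ a' i'

/-- `Exec B p σ t σ'`: started with memory `σ`, the program `p` halts with memory `σ'` after `t`
operations, and all the integers that occur have at most `B` bits. -/
inductive Exec (B : ℕ) : Program → Store → ℕ → Store → Prop
  | skip (σ : Store) : Exec B .skip σ 1 σ
  | write (a : ℕ) (i v : Expr) (σ : Store) (hi : i.Fits B σ) (hv : v.Fits B σ) :
      Exec B (.write a i v) σ (i.cost + v.cost + 1) (σ.set a (i.eval σ) (v.eval σ))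
  | seq {p q : Program} {σ₁ σ₂ σ₃ : Store} {t u : ℕ}
      (hp : Exec B p σ₁ t σ₂) (hq : Exec B q σ₂ u σ₃) : Exec B (.seq p q) σ₁ (t + u) σ₃
  | ite_true {c : Expr} {p q : Program} {σ₁ σ₂ : Store} {t : ℕ} (hB : c.Fits B σ₁)
      (hc : c.eval σ₁ ≠ 0) (hp : Exec B p σ₁ t σ₂) : Exec B (.ite c p q) σ₁ (c.cost + 1 + t) σ₂
  | ite_false {c : Expr} {p q : Program} {σ₁ σ₂ : Store} {t : ℕ} (hB : c.Fits B σ₁)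
      (hc : c.eval σ₁ = 0) (hq : Exec B q σ₁ t σ₂) : Exec B (.ite c p q) σ₁ (c.cost + 1 + t) σ₂
  | loop_done {c : Expr} {p : Program} {σ : Store} (hB : c.Fits B σ)
      (hc : c.eval σ = 0) : Exec B (.loop c p) σ (c.cost + 1) σ
  | loop_step {c : Expr} {p : Program} {σ₁ σ₂ σ₃ : Store} {t u : ℕ} (hB : c.Fits B σ₁)
      (hc : c.eval σ₁ ≠ 0) (hp : Exec B p σ₁ t σ₂) (hl : Exec B (.loop c p) σ₂ u σ₃) :
      Exec B (.loop c p) σ₁ (c.cost + 1 + t + u) σ₃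

/-- An array that holds the entries of a vector in its cells `0, …, N - 1` and `0` elsewhere. -/
def vecArray {N : ℕ} (v : Fin N → ℤ) : ℤ → ℤ :=
  fun k => if h : 0 ≤ k ∧ k.toNat < N then v ⟨k.toNat, h.2⟩ else 0

/-- An array that holds an `m × n` matrix in row-major order: the entry `(i, j)` is in the cell
`j + n * i`. -/
def matArray {m n : ℕ} (A : Matrix (Fin m) (Fin n) ℤ) : ℤ → ℤ :=
  vecArray fun k : Fin (m * n) => A (finProdFinEquiv.symm k).1 (finProdFinEquiv.symm k).2

/-- The memory at the start of a run on two systems: the dimension `n` in the cell `0` of the array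
`0`, the two systems in the arrays `1, 2` and `3, 4`, and `0` everywhere else. -/
def input {n : ℕ} (S T : IneqSystem n) : Store
  | 0 => vecArray fun _ : Fin 1 => (n : ℤ)
  | 1 => matArray S.A
  | 2 => vecArray S.b
  | 3 => matArray T.A
  | 4 => vecArray T.b
  | _ => fun _ => 0

/-- The output of a run: the final content of the cell `0` of the array `0`. -/
def output (σ : Store) : ℤ := σ 0 0

end RAM

/-- The bound `n ^ (log₂ Δ) · Δ! · (C (n + Δ) ^ d)` on the number of operations. -/
noncomputable def opBound (C d n Δ : ℕ) : ℝ :=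
  (n : ℝ) ^ Real.logb 2 (Δ : ℝ) * (Nat.factorial Δ : ℝ) * ((C : ℝ) * ((n : ℝ) + (Δ : ℝ)) ^ d)

/-! ### Total correctness with bounds on the number of operations and on the bit lengths -/

namespace RAM

/-! Divide each row of both systems by its gcd, so that the inequalities read `g i * A i x ≤ b i`
with primitive rows. Each inequality of a simplex is a positive multiple of one barycentric
coordinate. Hence a unimodular equivalence amounts to a bijection of the rows, a unimodular `U` and
an integral `x₀` such that corresponding primitive rows agree up to `U` and the quotients `b / g`
differ by the value of the row at `x₀` (`UnimodularEquiv.rowEquiv`,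
`ScaledSystem.RowEquiv.unimodularEquiv`). The task is to avoid trying all `(n + 1)!` bijections.

Let `M` consist of the rows of `S` other than the last, `δ = |det M| ≤ Δ` and `N = δ M⁻¹`. Modulo
`δ`, the columns of `N` generate a copy of the cokernel of `M`, a group of order `δ`. A greedy
choice picks columns that are not combinations of earlier picks. Each pick at least doubles the
generated group, so there are `s ≤ log₂ δ` generators (`Independent.two_pow_le`). Every column is a
combination of them, recorded by a code below `δ ^ s`, which is found by trying all codes.

If the last row of `S` goes to the row `p` of `T`, and the other rows are permuted by `σ`, then `U`
carries column `i` of `N` to column `σ i` of the matrix `N'` that belongs to the rows of `T` other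
than `p`. So a guess of `p` and of the images of the generators, one of `(n + 1) n ^ s`, determines
through the codes column `σ i` of `N'` modulo `δ` for every `i`. Put two rows of `T` in one class if
their columns of `N'` agree modulo `δ`, their coordinates in the expansion of the row `p` agree, and
their quotients `b / g` agree modulo the integers. The heart of the proof is that every bijection
with the same classes as `σ` also comes from an affine unimodular map
(`ScaledSystem.RowEquiv.exists_verified`). Hence within the classes rows may be matched by rank,
without a search. The matching found is checked by divisibilities and equations that imply an
equivalence (`Verified.rowEquiv`), so a wrong guess never causes a false positive answer.

The guesses account for the factor `n ^ log₂ Δ`, the codes for `δ ^ log₂ δ ≤ Δ³ Δ!` (`pow_log_le`);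
all else is polynomial in `n` and `Δ`. Inverses come from the Faddeev–LeVerrier algorithm, whose
divisions are exact and whose integers stay short (`faddeevLeVerrier_eq`,
`abs_faddeevLeVerrier_le`). The gcds of the rows divide nonzero maximal minors, so they can be found
by trial.

For the machine, expressions with bounded sums and searches are compiled to programs. If all ranges
are at most `R` and all stored integers at most `2 ^ w`, a compiled expression takes at most `R ^ c`
operations on integers of `w * c + 2` bits, where `c` does not depend on the input
(`HExpr.exists_spec`). -/

/-- The extreme value `2 ^ a` has `a + 1` binary digits, and the sign takes one more bit. This is
the `+ 2` in all later bit bounds `w * c + 2`. -/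
theorem bitLength_le {z : ℤ} {a B : ℕ} (h : |z| ≤ 2 ^ a) (hB : a + 2 ≤ B) : bitLength z ≤ B := by
  have h1 : z.natAbs < 2 ^ (a + 1) := by
    have : z.natAbs ≤ 2 ^ a := by zify; exact h
    rw [pow_succ]
    have := Nat.one_le_two_pow (n := a)
    omega
  have := Nat.size_le.2 h1
  unfold bitLength
  omega

theorem bitLength_natCast_le {k c w : ℕ} (hw : 1 ≤ w) (h : k ≤ c) :
    bitLength (k : ℤ) ≤ w * c + 2 := by
  refine bitLength_le (a := k) ?_ ?_
  · rw [Nat.abs_cast]; exact_mod_cast Nat.lt_two_pow_self.le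
  · nlinarith

theorem bitLength_mono_bound {c c' w : ℕ} (h : c ≤ c') : w * c + 2 ≤ w * c' + 2 := by
  have := Nat.mul_le_mul_left w h
  omega

theorem Expr.Fits.mono {B B' : ℕ} (h : B ≤ B') {σ : Store} :
    ∀ {e : Expr}, e.Fits B σ → e.Fits B' σ
  | .const _, he => le_trans he h
  | .read _ _, he => ⟨he.1.mono h, he.2.trans h⟩
  | .op _ _ _, he => ⟨he.1.mono h, he.2.1.mono h, he.2.2.trans h⟩

theorem Exec.mono {B B' : ℕ} (h : B ≤ B') {p : Program} {σ σ' : Store} {t : ℕ}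
    (hp : Exec B p σ t σ') : Exec B' p σ t σ' := by
  induction hp with
  | skip σ => exact .skip σ
  | write a i v σ hi hv => exact .write a i v σ (hi.mono h) (hv.mono h)
  | seq _ _ ih1 ih2 => exact .seq ih1 ih2
  | ite_true hB hc _ ih => exact .ite_true (hB.mono h) hc ih
  | ite_false hB hc _ ih => exact .ite_false (hB.mono h) hc ih
  | loop_done hB hc => exact .loop_done (hB.mono h) hc
  | loop_step hB hc _ _ ih1 ih2 => exact .loop_step (hB.mono h) hc ih1 ih2

/-- `p` started in `σ` halts within `T` operations on integers of at most `B` bits, in a memory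
with the property `Q`. -/
def Runs (B T : ℕ) (p : Program) (σ : Store) (Q : Store → Prop) : Prop :=
  ∃ (t : ℕ) (σ' : Store), t ≤ T ∧ Exec B p σ t σ' ∧ Q σ'

variable {B B' T T' : ℕ} {p q : Program} {σ : Store} {Q Q' : Store → Prop}

theorem Runs.mono (h : Runs B T p σ Q) (hB : B ≤ B') (hT : T ≤ T') (hQ : ∀ σ', Q σ' → Q' σ') :
    Runs B' T' p σ Q' := by
  obtain ⟨t, σ', ht, he, hq⟩ := h
  exact ⟨t, σ', ht.trans hT, he.mono hB, hQ _ hq⟩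

theorem Runs.imp (h : Runs B T p σ Q) (hT : T ≤ T') (hQ : ∀ σ', Q σ' → Q' σ') :
    Runs B T' p σ Q' :=
  h.mono le_rfl hT hQ

theorem Runs.skip (hT : 1 ≤ T) (hQ : Q σ) : Runs B T .skip σ Q :=
  ⟨1, σ, hT, .skip σ, hQ⟩

theorem Runs.write {a : ℕ} {i v : Expr} (hi : i.Fits B σ) (hv : v.Fits B σ)
    (hT : i.cost + v.cost + 1 ≤ T) (hQ : Q (σ.set a (i.eval σ) (v.eval σ))) :
    Runs B T (.write a i v) σ Q :=
  ⟨_, _, hT, .write a i v σ hi hv, hQ⟩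

theorem Runs.seq {T₁ T₂ : ℕ} {Q₁ : Store → Prop} (hp : Runs B T₁ p σ Q₁)
    (hq : ∀ σ', Q₁ σ' → Runs B T₂ q σ' Q) (hT : T₁ + T₂ ≤ T) : Runs B T (.seq p q) σ Q := by
  obtain ⟨t, σ', ht, he, hq1⟩ := hp
  obtain ⟨t', σ'', ht', he', hq2⟩ := hq σ' hq1
  exact ⟨t + t', σ'', by omega, .seq he he', hq2⟩

theorem Runs.ite {c : Expr} (hc : c.Fits B σ) (hp : c.eval σ ≠ 0 → Runs B T p σ Q)
    (hq : c.eval σ = 0 → Runs B T q σ Q) (hT : c.cost + 1 + T ≤ T') :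
    Runs B T' (.ite c p q) σ Q := by
  by_cases h : c.eval σ = 0
  · obtain ⟨t, σ', ht, he, hQ⟩ := hq h
    exact ⟨_, σ', by omega, .ite_false hc h he, hQ⟩
  · obtain ⟨t, σ', ht, he, hQ⟩ := hp h
    exact ⟨_, σ', by omega, .ite_true hc h he, hQ⟩

/-- The loop that runs `p` while the counter `v` is below `N`, and increments the counter. -/
def forL (v : ℕ) (N : Expr) (p : Program) : Program :=
  .loop (.op .lt (.read v (.const 0)) N)
    (.seq p (.write v (.const 0) (.op .add (.read v (.const 0)) (.const 1))))

/-- Invariant rule: `I k` describes the memory when the counter is tested with the value `k`. The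
loop itself increments the counter, so the body must establish `I (k + 1)` for the memory after that
increment. The range of `hB` reaches `K + 1` only to cover the constant `1` when `K = 0`. -/
theorem Runs.forL {v : ℕ} {N : Expr} {K : ℕ} (I : ℕ → Store → Prop) (h0 : I 0 σ)
    (hI : ∀ k σ, k ≤ K → I k σ → σ v 0 = k ∧ N.eval σ = K ∧ N.Fits B σ)
    (hB : ∀ k : ℕ, k ≤ K + 1 → bitLength (k : ℤ) ≤ B)
    (hp : ∀ k σ, k < K → I k σ →
      Runs B T p σ fun σ' => σ' v 0 = k ∧ I (k + 1) (σ'.set v 0 ((k : ℤ) + 1)))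
    (hT : K * (T + N.cost + 10) + N.cost + 10 ≤ T') :
    Runs B T' (forL v N p) σ (I K) := by
  -- Induction on the number `j` of rounds still to come, since `Exec` unfolds a loop at its first
  -- round.
  suffices H : ∀ j k σ, k + j = K → I k σ →
      Runs B (j * (T + N.cost + 10) + N.cost + 10) (RAM.forL v N p) σ (I K) from
    (H K 0 σ (by omega) h0).imp hT fun _ h => h
  have h1 : bitLength (1 : ℤ) ≤ B := by simpa using hB 1 (by omega)
  have h0' : bitLength (0 : ℤ) ≤ B := by simpa using hB 0 (by omega)
  intro j
  induction j with
  | zero =>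
    intro k σ hk hIk
    obtain rfl : k = K := by omega
    obtain ⟨hv, hN, hF⟩ := hI k σ le_rfl hIk
    have hc : Expr.eval σ (.op .lt (.read v (.const 0)) N) = 0 := by
      simp [Expr.eval, Op.eval, hv, hN]
    refine ⟨_, σ, ?_, .loop_done ⟨⟨h0', ?_⟩, hF, ?_⟩ hc, hIk⟩
    · simp only [Expr.cost]; omega
    · simpa [Expr.eval, hv] using hB k (by omega)
    · simpa [Expr.eval, Op.eval, hv, hN] using h0'
  | succ j ih =>
    intro k σ hk hIk
    obtain ⟨hv, hN, hF⟩ := hI k σ (by omega) hIk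
    have hlt : (k : ℤ) < K := by omega
    have hc : Expr.eval σ (.op .lt (.read v (.const 0)) N) = 1 := by
      simp [Expr.eval, Op.eval, hv, hN, hlt]
    obtain ⟨t, σ', ht, he, hv', hI'⟩ := hp k σ (by omega) hIk
    obtain ⟨u, σ'', hu, he', hQ⟩ := ih (k + 1) _ (by omega) hI'
    have hw : Exec B (.write v (.const 0) (.op .add (.read v (.const 0)) (.const 1))) σ' 6
        (σ'.set v 0 ((k : ℤ) + 1)) := by
      have := Exec.write (B := B) v (.const 0) (.op .add (.read v (.const 0)) (.const 1)) σ' h0'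
        ⟨⟨h0', ?_⟩, h1, ?_⟩
      · simpa [Expr.eval, Op.eval, hv', Expr.cost] using this
      · simpa [Expr.eval, hv'] using hB k (by omega)
      · simpa [Expr.eval, Op.eval, hv'] using hB (k + 1) (by omega)
    refine ⟨_, σ'', ?_, .loop_step ⟨⟨h0', ?_⟩, hF, ?_⟩ (by rw [hc]; exact one_ne_zero)
      (.seq he hw) he', hQ⟩
    · simp only [Expr.cost]
      rw [Nat.succ_mul]
      omega
    · simpa [Expr.eval, hv] using hB k (by omega)
    · change bitLength (Expr.eval σ (.op .lt (.read v (.const 0)) N)) ≤ B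
      rw [hc]; exact h1

theorem Store.set_apply (σ : Store) (a : ℕ) (i v : ℤ) (a' : ℕ) (i' : ℤ) :
    σ.set a i v a' i' = if a' = a ∧ i' = i then v else σ a' i' := rfl

@[simp] theorem Store.set_self (σ : Store) (a : ℕ) (i v : ℤ) : σ.set a i v a i = v := by
  simp [Store.set_apply]

theorem Store.set_of_ne (σ : Store) {a a' : ℕ} (h : a' ≠ a) (i v : ℤ) :
    σ.set a i v a' = σ a' := by
  funext i'; simp [Store.set_apply, h]

/-! ### Expressions with bounded sums and searches -/

/-- The least `k' < k` with `f k' ≠ 0`, or `N` if there is none. -/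
def scan (N : ℕ) (f : ℕ → ℤ) : ℕ → ℕ
  | 0 => N
  | k + 1 => if scan N f k = N ∧ f k ≠ 0 then k else scan N f k

/-- The value `N` marks that nothing has been found. It cannot be mistaken for a hit, because only
indices below `k ≤ N` have been inspected, and a hit is never overwritten. -/
theorem scan_spec {N : ℕ} {f : ℕ → ℤ} {k : ℕ} (hk : k ≤ N) :
    (scan N f k = N ∧ ∀ j < k, f j = 0) ∨
      (scan N f k < k ∧ f (scan N f k) ≠ 0 ∧ ∀ j < scan N f k, f j = 0) := by
  induction k with
  | zero => left; simp [scan]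
  | succ k ih =>
    rcases ih (by omega) with ⟨h1, h2⟩ | ⟨h1, h2, h3⟩
    · by_cases hf : f k = 0
      · left
        simp only [scan, h1, hf]
        refine ⟨by simp, fun j hj => ?_⟩
        rcases Nat.lt_succ_iff_lt_or_eq.1 hj with h | rfl
        · exact h2 j h
        · exact hf
      · right
        simp only [scan, h1, ne_eq, hf, not_false_eq_true, and_self, if_true]
        exact ⟨by omega, trivial, h2⟩
    · right
      have : scan N f (k + 1) = scan N f k := by
        simp only [scan]; rw [if_neg (by omega)]
      rw [this]
      exact ⟨by omega, h2, h3⟩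

theorem scan_le {N : ℕ} {f : ℕ → ℤ} {k : ℕ} (hk : k ≤ N) : scan N f k ≤ N := by
  rcases scan_spec (f := f) hk with h | h <;> omega

theorem scan_eq_iff {N : ℕ} {f : ℕ → ℤ} : scan N f N = N ↔ ∀ j < N, f j = 0 := by
  rcases scan_spec (f := f) (le_refl N) with ⟨h1, h2⟩ | ⟨h1, h2, _⟩
  · exact ⟨fun _ => h2, fun _ => h1⟩
  · exact ⟨fun h => absurd h (by omega), fun h => absurd (h _ h1) h2⟩

/-- Expressions with bounded sums `sum v N b`, the sum of `b` over `v < N`, and bounded searches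
`find v N b`, the least `v < N` with `b ≠ 0`, or `N`. -/
inductive HExpr
  | const (c : ℤ)
  | var (v : ℕ)
  | read (a : ℕ) (i : HExpr)
  | op (o : Op) (x y : HExpr)
  | sum (v : ℕ) (N b : HExpr)
  | find (v : ℕ) (N b : HExpr)

namespace HExpr

/-- The value of an expression. -/
def eval : HExpr → Store → ℤ
  | const c, _ => c
  | var v, σ => σ v 0
  | read a i, σ => σ a (i.eval σ)
  | op o x y, σ => o.eval (x.eval σ) (y.eval σ)
  | sum v N b, σ => ∑ k ∈ Finset.range (N.eval σ).toNat, b.eval (σ.set v 0 k)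
  | find v N b, σ =>
    scan (N.eval σ).toNat (fun k => b.eval (σ.set v 0 k)) (N.eval σ).toNat

/-- Arrays below `60`, except the array `5` of temporary values, may be read; the indices of sums
and searches are at least `60`. -/
def ok : List ℕ → HExpr → Bool
  | _, const _ => true
  | L, var v => (v < 60 && v != 5) || L.contains v
  | L, read a i => a < 60 && a != 5 && i.ok L
  | L, op _ x y => x.ok L && y.ok L
  | L, sum v N b => 60 ≤ v && !L.contains v && N.ok L && b.ok (v :: L)
  | L, find v N b => 60 ≤ v && !L.contains v && N.ok L && b.ok (v :: L)

/-- The array `a` is not read. -/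
def avoids (a : ℕ) : HExpr → Bool
  | const _ => true
  | var v => v != a
  | read a' i => a' != a && i.avoids a
  | op _ x y => x.avoids a && y.avoids a
  | sum _ N b => N.avoids a && b.avoids a
  | find _ N b => N.avoids a && b.avoids a

/-- The ranges of all sums and searches are at most `R`. -/
def Rng (R : ℕ) : HExpr → Store → Prop
  | const _, _ => True
  | var _, _ => True
  | read _ i, σ => i.Rng R σ
  | op _ x y, σ => x.Rng R σ ∧ y.Rng R σ
  | sum v N b, σ => N.Rng R σ ∧ (0 ≤ N.eval σ ∧ N.eval σ ≤ R) ∧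
      ∀ k : ℕ, (k : ℤ) < N.eval σ → b.Rng R (σ.set v 0 k)
  | find v N b, σ => N.Rng R σ ∧ (0 ≤ N.eval σ ∧ N.eval σ ≤ R) ∧
      ∀ k : ℕ, (k : ℤ) < N.eval σ → b.Rng R (σ.set v 0 k)

/-- The memories agree on what expressions may read, except possibly on the array `a`. -/
def Agree (a : ℕ) (L : List ℕ) (σ σ' : Store) : Prop :=
  (∀ b < 60, b ≠ 5 → b ≠ a → σ b = σ' b) ∧ ∀ v ∈ L, σ v 0 = σ' v 0

theorem Agree.set {a : ℕ} {L : List ℕ} {σ σ' : Store} (h : Agree a L σ σ') {v : ℕ}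
    (hv : 60 ≤ v) (x : ℤ) : Agree a (v :: L) (σ.set v 0 x) (σ'.set v 0 x) := by
  refine ⟨fun b hb h5 ha => ?_, fun u hu => ?_⟩
  · rw [Store.set_of_ne _ (by omega), Store.set_of_ne _ (by omega), h.1 b hb h5 ha]
  · by_cases huv : u = v
    · subst huv; simp
    · rw [Store.set_of_ne _ huv, Store.set_of_ne _ huv]
      rcases List.mem_cons.1 hu with h' | h'
      · exact absurd h' huv
      · exact h.2 u h'

/-- An expression sees only the arrays below `60` other than `5` and the indices bound around it.
With `a = 5` this shields it from temporary values; with another `a` it allows the array `a` to be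
overwritten while the expression is evaluated again and again. -/
theorem eval_congr {a : ℕ} {e : HExpr} {L : List ℕ} {σ σ' : Store} (hok : e.ok L = true)
    (ha : e.avoids a = true) (h : Agree a L σ σ') : e.eval σ = e.eval σ' := by
  induction e generalizing L σ σ' with
  | const c => rfl
  | var v =>
    simp only [ok, Bool.or_eq_true, Bool.and_eq_true, decide_eq_true_eq, bne_iff_ne,
      List.contains_iff_mem, avoids] at hok ha
    rcases hok with hok | hok
    · simp only [eval, h.1 v hok.1 hok.2 ha]
    · exact h.2 v hok
  | read b i ih =>
    simp only [ok, Bool.and_eq_true, decide_eq_true_eq, bne_iff_ne, avoids] at hok ha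
    simp only [eval, ih hok.2 ha.2 h, h.1 b hok.1.1 hok.1.2 ha.1]
  | op o x y ihx ihy =>
    simp only [ok, Bool.and_eq_true, avoids] at hok ha
    simp only [eval, ihx hok.1 ha.1 h, ihy hok.2 ha.2 h]
  | sum v N b ihN ihb =>
    simp only [ok, Bool.and_eq_true, decide_eq_true_eq, avoids] at hok ha
    simp only [eval, ihN hok.1.2 ha.1 h]
    exact Finset.sum_congr rfl fun k _ => ihb hok.2 ha.2 (h.set hok.1.1.1 _)
  | find v N b ihN ihb =>
    simp only [ok, Bool.and_eq_true, decide_eq_true_eq, avoids] at hok ha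
    simp only [eval, ihN hok.1.2 ha.1 h]
    congr 2
    funext k
    exact ihb hok.2 ha.2 (h.set hok.1.1.1 _)

theorem rng_congr {a : ℕ} {R : ℕ} {e : HExpr} {L : List ℕ} {σ σ' : Store} (hok : e.ok L = true)
    (ha : e.avoids a = true) (h : Agree a L σ σ') (hR : e.Rng R σ) : e.Rng R σ' := by
  induction e generalizing L σ σ' with
  | const c => trivial
  | var v => trivial
  | read b i ih =>
    simp only [ok, Bool.and_eq_true, avoids] at hok ha
    exact ih hok.2 ha.2 h hR
  | op o x y ihx ihy =>
    simp only [ok, Bool.and_eq_true, avoids] at hok ha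
    exact ⟨ihx hok.1 ha.1 h hR.1, ihy hok.2 ha.2 h hR.2⟩
  | sum v N b ihN ihb | find v N b ihN ihb =>
    simp only [ok, Bool.and_eq_true, decide_eq_true_eq, avoids] at hok ha
    simp only [Rng, ← eval_congr hok.1.2 ha.1 h]
    exact ⟨ihN hok.1.2 ha.1 h hR.1, hR.2.1,
      fun k hk => ihb hok.2 ha.2 (h.set hok.1.1.1 _) (hR.2.2 k hk)⟩

theorem avoids_five {e : HExpr} {L : List ℕ} (hok : e.ok L = true) (hL : 5 ∉ L) :
    e.avoids 5 = true := by
  induction e generalizing L with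
  | const c => rfl
  | var v =>
    simp only [ok, Bool.or_eq_true, Bool.and_eq_true, decide_eq_true_eq, bne_iff_ne,
      List.contains_iff_mem, avoids] at hok ⊢
    rcases hok with hok | hok
    · exact hok.2
    · exact fun h => hL (h ▸ hok)
  | read b i ih =>
    simp only [ok, Bool.and_eq_true, decide_eq_true_eq, bne_iff_ne, avoids] at hok ⊢
    exact ⟨hok.1.2, ih hok.2 hL⟩
  | op o x y ihx ihy =>
    simp only [ok, Bool.and_eq_true, avoids] at hok ⊢
    exact ⟨ihx hok.1 hL, ihy hok.2 hL⟩
  | sum v N b ihN ihb | find v N b ihN ihb =>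
    simp only [ok, Bool.and_eq_true, decide_eq_true_eq, avoids] at hok ⊢
    exact ⟨ihN hok.1.2 hL, ihb hok.2 (by simp only [List.mem_cons, not_or]; exact ⟨by omega, hL⟩)⟩

/-- The content of the cell `d` of the array of temporary values. -/
def tmp (d : ℕ) : Expr := .read 5 (.const d)

/-- A program that stores the value of an expression in the cell `d` of the array `5`, and uses
the cells from `d` on for temporary values. -/
def compile : HExpr → ℕ → Program
  | const c, d => .write 5 (.const d) (.const c)
  | var v, d => .write 5 (.const d) (.read v (.const 0))
  | read a i, d => .seq (i.compile d) (.write 5 (.const d) (.read a (tmp d)))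
  | op o x y, d => .seq (x.compile d) (.seq (y.compile (d + 1))
      (.write 5 (.const d) (.op o (tmp d) (tmp (d + 1)))))
  | sum v N b, d => .seq (N.compile d) (.seq (.write 5 (.const (d + 1 : ℕ)) (.const 0))
      (.seq (.write v (.const 0) (.const 0))
        (.seq (forL v (tmp d) (.seq (b.compile (d + 2))
            (.write 5 (.const (d + 1 : ℕ)) (.op .add (tmp (d + 1)) (tmp (d + 2))))))
          (.write 5 (.const d) (tmp (d + 1))))))
  | find v N b, d => .seq (N.compile d) (.seq (.write 5 (.const (d + 1 : ℕ)) (tmp d))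
      (.seq (.write v (.const 0) (.const 0))
        (.seq (forL v (tmp d) (.seq (b.compile (d + 2))
            (.ite (.op .mul (.op .eq (tmp (d + 1)) (tmp d)) (tmp (d + 2)))
              (.write 5 (.const (d + 1 : ℕ)) (.read v (.const 0))) .skip)))
          (.write 5 (.const d) (tmp (d + 1))))))

/-! ### Correctness, time and bit length of compiled expressions. -/

/-- The integers that expressions may read are at most `2 ^ w` in absolute value. -/
def Bd (L : List ℕ) (w : ℕ) (σ : Store) : Prop :=
  (∀ b < 60, b ≠ 5 → ∀ i, |σ b i| ≤ 2 ^ w) ∧ ∀ v ∈ L, |σ v 0| ≤ 2 ^ w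

/-- What the evaluation of an expression leaves unchanged. -/
def Keep (L : List ℕ) (d : ℕ) (σ σ' : Store) : Prop :=
  (∀ b < 60, b ≠ 5 → σ' b = σ b) ∧ (∀ v ∈ L, σ' v 0 = σ v 0) ∧ ∀ i : ℤ, i < d → σ' 5 i = σ 5 i

theorem Bd.one_le {w R : ℕ} (hR : 2 ≤ R) (hw : R ≤ 2 ^ w) : 1 ≤ w := by
  rcases Nat.eq_zero_or_pos w with rfl | h
  · simp at hw; omega
  · exact h

/-- Multiplication is the worst case. Since exponents merely add under each operation, a fixed
expression multiplies the bit length `w` by a constant. -/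
theorem abs_opEval_le {o : Op} {x y : ℤ} {a b : ℕ} (hx : |x| ≤ 2 ^ a) (hy : |y| ≤ 2 ^ b) :
    |o.eval x y| ≤ 2 ^ (a + b + 1) := by
  have ha : (1 : ℤ) ≤ 2 ^ a := one_le_pow₀ (by norm_num)
  have hb : (1 : ℤ) ≤ 2 ^ b := one_le_pow₀ (by norm_num)
  have hab : (2 : ℤ) ^ a + 2 ^ b ≤ 2 ^ (a + b + 1) := by
    rw [pow_succ, pow_add]; nlinarith
  have h1 : (2 : ℤ) ^ a ≤ 2 ^ (a + b + 1) := by linarith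
  have h2 : (2 : ℤ) ^ b ≤ 2 ^ (a + b + 1) := by linarith
  cases o with
  | add => exact (abs_add_le x y).trans (by linarith)
  | sub => exact (abs_sub x y).trans (by linarith)
  | mul =>
    simp only [Op.eval]
    rw [abs_mul, pow_succ, pow_add]
    have := mul_le_mul hx hy (abs_nonneg _) (by linarith)
    nlinarith
  | div => exact (Int.abs_ediv_le_abs x y).trans (hx.trans h1)
  | mod =>
    simp only [Op.eval]
    by_cases h : y = 0
    · subst h; simpa using hx.trans h1
    · rw [abs_of_nonneg (Int.emod_nonneg x h)]
      exact (Int.emod_lt_abs x h).le.trans (hy.trans h2)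
  | lt => simp only [Op.eval]; split_ifs <;> simp; exact one_le_pow₀ (by norm_num)
  | eq => simp only [Op.eval]; split_ifs <;> simp; exact one_le_pow₀ (by norm_num)

theorem fits_tmp {w c d : ℕ} {σ : Store} (hw : 1 ≤ w) (hd : d ≤ c) (h : |σ 5 d| ≤ 2 ^ (w * c)) :
    (tmp d).Fits (w * c + 2) σ :=
  ⟨bitLength_natCast_le hw hd, bitLength_le h le_rfl⟩

theorem abs_le_pow_mono {x : ℤ} {w c c' : ℕ} (h : |x| ≤ 2 ^ (w * c)) (hc : c ≤ c') :
    |x| ≤ 2 ^ (w * c') :=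
  h.trans (pow_le_pow_right₀ (by norm_num) (Nat.mul_le_mul_left w hc))

/-- The specification of a compiled expression. -/
def Spec (e : HExpr) (L : List ℕ) (d c : ℕ) : Prop :=
  ∀ (w R : ℕ) (σ : Store), 2 ≤ R → R ≤ 2 ^ w → Bd L w σ → e.Rng R σ →
    Runs (w * c + 2) (R ^ c) (e.compile d) σ (fun σ' => σ' 5 d = e.eval σ ∧ Keep L d σ σ') ∧
      |e.eval σ| ≤ 2 ^ (w * c)

theorem Spec.mono {e : HExpr} {L : List ℕ} {d c c' : ℕ} (h : Spec e L d c) (hc : c ≤ c') :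
    Spec e L d c' := fun w R σ hR hw hb hr =>
  ⟨(h w R σ hR hw hb hr).1.mono (bitLength_mono_bound hc) (Nat.pow_le_pow_right (by omega) hc)
    fun _ h => h, abs_le_pow_mono (h w R σ hR hw hb hr).2 hc⟩

theorem Keep.agree {L : List ℕ} {d : ℕ} {σ σ' : Store} (h : Keep L d σ σ') : Agree 5 L σ σ' :=
  ⟨fun b hb h5 _ => (h.1 b hb h5).symm, fun v hv => (h.2.1 v hv).symm⟩

theorem Keep.bd {L : List ℕ} {w d : ℕ} {σ σ' : Store} (h : Keep L d σ σ') (hb : Bd L w σ) :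
    Bd L w σ' :=
  ⟨fun b h60 h5 i => by rw [h.1 b h60 h5]; exact hb.1 b h60 h5 i,
    fun v hv => by rw [h.2.1 v hv]; exact hb.2 v hv⟩

theorem Keep.trans {L : List ℕ} {d d' : ℕ} {σ σ' σ'' : Store} (h : Keep L d σ σ') (hd : d ≤ d')
    (h' : Keep L d' σ' σ'') : Keep L d σ σ'' :=
  ⟨fun b h60 h5 => (h'.1 b h60 h5).trans (h.1 b h60 h5),
    fun v hv => (h'.2.1 v hv).trans (h.2.1 v hv),
    fun i hi => (h'.2.2 i (by omega)).trans (h.2.2 i hi)⟩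

theorem Keep.refl (L : List ℕ) (d : ℕ) (σ : Store) : Keep L d σ σ :=
  ⟨fun _ _ _ => rfl, fun _ _ => rfl, fun _ _ => rfl⟩

theorem Keep.set_tmp {L : List ℕ} {d : ℕ} {σ σ' : Store} (hL : ∀ v ∈ L, 60 ≤ v)
    (h : Keep L d σ σ') {j : ℤ} (hj : d ≤ j) (x : ℤ) : Keep L d σ (σ'.set 5 j x) := by
  refine ⟨fun b h60 h5 => ?_, fun v hv => ?_, fun i hi => ?_⟩
  · rw [Store.set_of_ne _ h5, h.1 b h60 h5]
  · have := hL v hv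
    rw [Store.set_of_ne _ (by omega), h.2.1 v hv]
  · rw [Store.set_apply, if_neg (by omega), h.2.2 i hi]

theorem Keep.set_var {L : List ℕ} {d : ℕ} {σ σ' : Store} (h : Keep L d σ σ') {v : ℕ}
    (hv : 60 ≤ v) (hL : v ∉ L) (x : ℤ) : Keep L d σ (σ'.set v 0 x) := by
  refine ⟨fun b h60 h5 => ?_, fun u hu => ?_, fun i hi => ?_⟩
  · rw [Store.set_of_ne _ (by omega), h.1 b h60 h5]
  · rw [Store.set_of_ne _ (by rintro rfl; exact hL hu), h.2.1 u hu]
  · rw [Store.set_of_ne _ (by omega), h.2.2 i hi]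

/-- For `x, y ≥ 1` one has `x + y + 60 ≤ 62 x y`, and `R ^ 6 ≥ 64` absorbs the factor. So the times
of consecutive pieces combine into a single power of `R`. -/
theorem pow_add_pow_add_le {R a b k : ℕ} (hR : 2 ≤ R) (hk : k ≤ 60) :
    R ^ a + R ^ b + k ≤ R ^ (a + b + 6) := by
  have ha : 1 ≤ R ^ a := Nat.one_le_pow _ _ (by omega)
  have hb : 1 ≤ R ^ b := Nat.one_le_pow _ _ (by omega)
  have h4 : 2 ^ 6 ≤ R ^ 6 := Nat.pow_le_pow_left hR 6
  rw [pow_add, pow_add]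
  have h1 : R ^ a + R ^ b ≤ 2 * (R ^ a * R ^ b) := by nlinarith
  have h2 : 1 ≤ R ^ a * R ^ b := Nat.mul_pos ha hb
  nlinarith [Nat.mul_le_mul_left (R ^ a * R ^ b) h4]

theorem spec_const (x : ℤ) (L : List ℕ) (hL : ∀ v ∈ L, 60 ≤ v) (d : ℕ) :
    ∃ c, Spec (const x) L d c := by
  -- `x.natAbs` pays for the constant, `d` for the address of the cell, and `3` for the three
  -- operations, as `3 ≤ 2 ^ 3`.
  refine ⟨x.natAbs + d + 3, fun w R σ hR hw hb _ => ?_⟩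
  have hw1 := Bd.one_le hR hw
  have hx : |x| ≤ 2 ^ (w * (x.natAbs + d + 3)) := by
    have h1 : x.natAbs ≤ 2 ^ (w * (x.natAbs + d + 3)) :=
      Nat.lt_two_pow_self.le.trans (Nat.pow_le_pow_right (by omega)
        (by have := Nat.mul_le_mul_right (x.natAbs + d + 3) hw1; omega))
    zify at h1; exact h1
  refine ⟨Runs.write (bitLength_natCast_le hw1 (by omega)) (bitLength_le hx le_rfl) ?_
    ⟨Store.set_self _ _ _ _, (Keep.refl L d σ).set_tmp hL le_rfl _⟩, hx⟩
  calc 1 + 1 + 1 ≤ 2 ^ 3 := by norm_num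
    _ ≤ R ^ 3 := Nat.pow_le_pow_left hR 3
    _ ≤ _ := Nat.pow_le_pow_right (by omega) (by omega)

theorem spec_var {v : ℕ} {L : List ℕ} (hok : (var v).ok L = true) (hL : ∀ v ∈ L, 60 ≤ v) (d : ℕ) :
    ∃ c, Spec (var v) L d c := by
  refine ⟨d + 3, fun w R σ hR hw hb _ => ?_⟩
  have hw1 := Bd.one_le hR hw
  have hx : |σ v 0| ≤ 2 ^ (w * (d + 3)) := by
    have : |σ v 0| ≤ 2 ^ (w * 1) := by
      rw [mul_one]
      simp only [ok, Bool.or_eq_true, Bool.and_eq_true, decide_eq_true_eq, bne_iff_ne,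
        List.contains_iff_mem] at hok
      rcases hok with hok | hok
      · exact hb.1 v hok.1 hok.2 0
      · exact hb.2 v hok
    exact abs_le_pow_mono this (by omega)
  refine ⟨Runs.write (bitLength_natCast_le hw1 (by omega))
    ⟨bitLength_natCast_le (k := 0) hw1 (by omega), bitLength_le hx le_rfl⟩ ?_
    ⟨Store.set_self _ _ _ _, (Keep.refl L d σ).set_tmp hL le_rfl _⟩, hx⟩
  calc 1 + (1 + 1) + 1 ≤ 2 ^ 3 := by norm_num
    _ ≤ R ^ 3 := Nat.pow_le_pow_left hR 3
    _ ≤ _ := Nat.pow_le_pow_right (by omega) (by omega)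

theorem spec_read {a : ℕ} {i : HExpr} {L : List ℕ} (hok : (read a i).ok L = true)
    (hL : ∀ v ∈ L, 60 ≤ v) (d : ℕ) (ih : ∃ c, Spec i L d c) : ∃ c, Spec (read a i) L d c := by
  obtain ⟨c, hc⟩ := ih
  simp only [ok, Bool.and_eq_true, decide_eq_true_eq, bne_iff_ne] at hok
  refine ⟨c + d + 6, fun w R σ hR hw hb hr => ?_⟩
  have hw1 := Bd.one_le hR hw
  obtain ⟨h1, h2⟩ := hc w R σ hR hw hb hr
  have hx : |σ a (i.eval σ)| ≤ 2 ^ (w * (c + d + 6)) := by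
    have h := hb.1 a hok.1.1 hok.1.2 (i.eval σ)
    rw [← mul_one w] at h
    exact abs_le_pow_mono h (by omega)
  refine ⟨(h1.mono (bitLength_mono_bound (by omega)) le_rfl fun _ h => h).seq (T₂ := 5)
    (fun σ' hσ' => Runs.write (bitLength_natCast_le hw1 (by omega))
      ⟨fits_tmp hw1 (by omega) (by rw [hσ'.1]; exact abs_le_pow_mono h2 (by omega)), ?_⟩ ?_
      ⟨?_, hσ'.2.set_tmp hL le_rfl _⟩) ?_, hx⟩
  · refine bitLength_le ?_ le_rfl
    simp only [tmp, Expr.eval, hσ'.1, hσ'.2.1 a hok.1.1 hok.1.2]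
    exact hx
  · simp [Expr.cost, tmp]
  · simp only [tmp, Expr.eval, hσ'.1, hσ'.2.1 a hok.1.1 hok.1.2]
    exact Store.set_self _ _ _ _
  · refine le_trans ?_ ((pow_add_pow_add_le (a := c) (b := d) hR (k := 5) (by norm_num)).trans
      le_rfl)
    omega

theorem spec_op {o : Op} {x y : HExpr} {L : List ℕ} (hok : (op o x y).ok L = true)
    (hL : ∀ v ∈ L, 60 ≤ v) (d : ℕ) (ihx : ∃ c, Spec x L d c) (ihy : ∃ c, Spec y L (d + 1) c) :
    ∃ c, Spec (op o x y) L d c := by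
  obtain ⟨c₁, hc₁⟩ := ihx
  obtain ⟨c₂, hc₂⟩ := ihy
  simp only [ok, Bool.and_eq_true] at hok
  have h5 : 5 ∉ L := fun h => by have := hL 5 h; omega
  refine ⟨c₁ + c₂ + d + 7, fun w R σ hR hw hb hr => ?_⟩
  have hw1 := Bd.one_le hR hw
  obtain ⟨h1, h2⟩ := hc₁ w R σ hR hw hb hr.1
  have h3 := (hc₂ w R σ hR hw hb hr.2).2
  have hx : |o.eval (x.eval σ) (y.eval σ)| ≤ 2 ^ (w * (c₁ + c₂ + d + 7)) :=
    (abs_opEval_le h2 h3).trans (pow_le_pow_right₀ (by norm_num) (by nlinarith))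
  refine ⟨(h1.mono (bitLength_mono_bound (by omega)) le_rfl fun _ h => h).seq (T₂ := R ^ c₂ + 7)
    (fun σ' hσ' => ?_) ?_, hx⟩
  · have hr' := rng_congr hok.2 (avoids_five hok.2 h5) hσ'.2.agree hr.2
    have he' := eval_congr hok.2 (avoids_five hok.2 h5) hσ'.2.agree
    obtain ⟨h4, h5⟩ := hc₂ w R σ' hR hw (hσ'.2.bd hb) hr'
    refine (h4.mono (bitLength_mono_bound (by omega)) le_rfl fun _ h => h).seq (T₂ := 7)
      (fun σ'' hσ'' => ?_) le_rfl
    -- The temporary cells form a stack: the second operand uses only cells from `d + 1` on, so the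
    -- first operand survives in the cell `d`.
    have e1 : σ'' 5 d = x.eval σ := by rw [hσ''.2.2.2 d (by push_cast; omega), hσ'.1]
    have e2 : σ'' 5 ((d + 1 : ℕ) : ℤ) = y.eval σ := by rw [hσ''.1, he']
    refine Runs.write (bitLength_natCast_le hw1 (by omega))
      ⟨fits_tmp hw1 (by omega) (by rw [e1]; exact abs_le_pow_mono h2 (by omega)),
        fits_tmp hw1 (by omega) (by rw [e2]; exact abs_le_pow_mono h3 (by omega)), ?_⟩ ?_
      ⟨?_, Keep.set_tmp hL (hσ'.2.trans (by omega) hσ''.2) le_rfl _⟩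
    · refine bitLength_le ?_ le_rfl
      simp only [tmp, Expr.eval, e1, e2]
      exact hx
    · simp [Expr.cost, tmp]
    · simp only [tmp, Expr.eval, e1, e2]
      exact Store.set_self _ _ _ _
  · refine le_trans ?_ ((pow_add_pow_add_le (a := c₁) (b := c₂) hR (k := 7) (by norm_num)).trans
      (Nat.pow_le_pow_right (by omega) (by omega)))
    omega

/-- Sums and searches compile to the same loop and differ only in the initial value `e₀` of the
accumulator and in its update `p`. The cell `d` holds the range, `d + 1` the accumulator, with
content `g σ k` after `k` rounds, and the body works from `d + 2` on. -/
theorem spec_loop {v : ℕ} {N b : HExpr} {L : List ℕ} {e₀ : Expr} {p : Program} {e : HExpr}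
    (hv : 60 ≤ v) (hvL : v ∉ L) (hb : b.ok (v :: L) = true)
    (hL : ∀ v ∈ L, 60 ≤ v) (d : ℕ) (he₀ : e₀.cost ≤ 2)
    (hR : ∀ R σ, e.Rng R σ → N.Rng R σ ∧ (0 ≤ N.eval σ ∧ N.eval σ ≤ R) ∧
      ∀ k : ℕ, (k : ℤ) < N.eval σ → b.Rng R (σ.set v 0 k))
    (hcomp : e.compile d = .seq (N.compile d) (.seq (.write 5 (.const (d + 1 : ℕ)) e₀)
      (.seq (.write v (.const 0) (.const 0))
        (.seq (forL v (tmp d) (.seq (b.compile (d + 2)) p)) (.write 5 (.const d) (tmp (d + 1)))))))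
    (g : Store → ℕ → ℤ)
    (hg₀ : ∀ σ σ' : Store, 0 ≤ N.eval σ → σ' 5 d = N.eval σ → e₀.eval σ' = g σ 0)
    (hg : ∀ σ, 0 ≤ N.eval σ → e.eval σ = g σ (N.eval σ).toNat)
    (ihN : ∃ c, Spec N L d c) (ihb : ∃ c, Spec b (v :: L) (d + 2) c)
    (hgB : ∀ (c₁ c₂ w R : ℕ) (σ : Store), 2 ≤ R → R ≤ 2 ^ w → 0 ≤ N.eval σ → N.eval σ ≤ R →
      |N.eval σ| ≤ 2 ^ (w * c₁) →
      (∀ k : ℕ, (k : ℤ) < N.eval σ → |b.eval (σ.set v 0 k)| ≤ 2 ^ (w * c₂)) →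
      (∀ k : ℕ, (k : ℤ) ≤ N.eval σ → |g σ k| ≤ 2 ^ (w * (c₁ + c₂ + d + 12))) ∧
      (∀ σ' : Store, σ' 5 d = N.eval σ → e₀.Fits (w * (c₁ + c₂ + d + 16) + 2) σ') ∧
      (∀ (k : ℕ) (σ' : Store), (k : ℤ) < N.eval σ → σ' 5 d = N.eval σ →
        σ' 5 (d + 1 : ℕ) = g σ k → σ' 5 (d + 2 : ℕ) = b.eval (σ.set v 0 k) → σ' v 0 = k →
        Runs (w * (c₁ + c₂ + d + 16) + 2) 20 p σ' fun τ => τ = σ'.set 5 (d + 1 : ℕ) (g σ (k + 1)))) :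
    ∃ c, Spec e L d c := by
  obtain ⟨c₁, hc₁⟩ := ihN
  obtain ⟨c₂, hc₂⟩ := ihb
  have h5 : 5 ∉ L := fun h => by have := hL 5 h; omega
  have h5' : 5 ∉ v :: L := by simp only [List.mem_cons, not_or]; exact ⟨by omega, h5⟩
  refine ⟨c₁ + c₂ + d + 16, fun w R σ hR2 hw hbd hr => ?_⟩
  obtain ⟨hr1, ⟨hN0, hNR⟩, hrb⟩ := hR R σ hr
  have hw1 := Bd.one_le hR2 hw
  obtain ⟨h1, h2⟩ := hc₁ w R σ hR2 hw hbd hr1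
  have hagree : ∀ (k : ℕ) (τ : Store), τ v 0 = k → Keep L d σ τ →
      Agree 5 (v :: L) (σ.set v 0 k) τ := by
    intro k τ hk hτ
    refine ⟨fun a h60 ha5 _ => ?_, fun u hu => ?_⟩
    · rw [Store.set_of_ne _ (by omega), hτ.1 a h60 ha5]
    · by_cases huv : u = v
      · subst huv; rw [hk, Store.set_self]
      · rw [Store.set_of_ne _ huv, hτ.2.1 u ((List.mem_cons.1 hu).resolve_left huv)]
  have hRw : (R : ℤ) ≤ 2 ^ w := by exact_mod_cast hw
  have hbdv : ∀ (k : ℕ) (τ : Store), (k : ℤ) < N.eval σ → τ v 0 = k → Keep L d σ τ →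
      Bd (v :: L) w τ := by
    intro k τ hkN hk hτ
    refine ⟨(hτ.bd hbd).1, fun u hu => ?_⟩
    rcases List.mem_cons.1 hu with rfl | h'
    · rw [hk, Nat.abs_cast]; linarith
    · exact (hτ.bd hbd).2 u h'
  have hval : ∀ k : ℕ, (k : ℤ) < N.eval σ → |b.eval (σ.set v 0 k)| ≤ 2 ^ (w * c₂) := by
    intro k hk
    exact (hc₂ w R _ hR2 hw (hbdv k _ hk (Store.set_self _ _ _ _)
      ((Keep.refl L d σ).set_var hv hvL _)) (hrb k hk)).2
  obtain ⟨hg1, hg2, hg3⟩ := hgB c₁ c₂ w R σ hR2 hw hN0 hNR h2 hval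
  have hK : ((N.eval σ).toNat : ℤ) = N.eval σ := Int.toNat_of_nonneg hN0
  set K := (N.eval σ).toNat with hKdef
  have hex : |e.eval σ| ≤ 2 ^ (w * (c₁ + c₂ + d + 16)) := by
    rw [hg σ hN0]
    exact abs_le_pow_mono (hg1 K hK.le) (by omega)
  refine ⟨?_, hex⟩
  rw [hcomp]
  have hz : bitLength (0 : ℤ) ≤ w * (c₁ + c₂ + d + 16) + 2 := bitLength_natCast_le (k := 0) hw1 (by omega)
  refine (h1.mono (bitLength_mono_bound (by omega)) le_rfl fun _ h => h).seq
    (T₂ := R ^ (c₂ + 7) + 30) (fun σ₁ hσ₁ => ?_) ?_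
  swap
  · refine le_trans ?_ ((pow_add_pow_add_le (a := c₁) (b := c₂ + 7) hR2 (k := 30)
      (by norm_num)).trans (Nat.pow_le_pow_right (by omega) (by omega)))
    omega
  refine (Runs.write (T := 4) (bitLength_natCast_le hw1 (by omega)) (hg2 σ₁ hσ₁.1)
    (by simp only [Expr.cost]; omega) (Q := fun τ => τ 5 d = K ∧ τ 5 (d + 1 : ℕ) = g σ 0 ∧
      Keep L d σ τ) ?_).seq (T₂ := R ^ (c₂ + 7) + 26) (fun σ₂ hσ₂ => ?_) (by omega)
  · refine ⟨?_, ?_, hσ₁.2.set_tmp hL (by simp only [Expr.eval]; omega) _⟩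
    · simp only [Expr.eval]
      rw [Store.set_apply, if_neg (by push_cast; omega), hσ₁.1, hK]
    · simp only [Expr.eval]
      rw [Store.set_self, hg₀ σ σ₁ hN0 hσ₁.1]
  refine (Runs.write (i := .const 0) (v := .const 0) (T := 3) hz hz
    (by simp only [Expr.cost]; omega) (Q := fun τ => τ v 0 = (0 : ℕ) ∧ τ 5 d = K ∧
      τ 5 (d + 1 : ℕ) = g σ 0 ∧ Keep L d σ τ) ?_).seq (T₂ := R ^ (c₂ + 7) + 20)
      (fun σ₃ hσ₃ => ?_) (by omega)
  · refine ⟨Store.set_self _ _ _ _, ?_, ?_, hσ₂.2.2.set_var hv hvL _⟩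
    · rw [Store.set_of_ne _ (by omega), hσ₂.1]
    · rw [Store.set_of_ne _ (by omega), hσ₂.2.1]
  refine (Runs.forL (K := K) (T := R ^ c₂ + 20) (T' := R ^ (c₂ + 7) + 14) (fun k τ =>
    τ v 0 = k ∧ τ 5 d = K ∧ τ 5 (d + 1 : ℕ) = g σ k ∧ Keep L d σ τ) hσ₃ ?_ ?_ ?_ ?_).seq (T₂ := 6)
      (fun σ₄ hσ₄ => ?_) (by omega)
  · rintro k τ - ⟨e1, e2, -, -⟩
    refine ⟨e1, e2, fits_tmp hw1 (by omega) ?_⟩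
    rw [e2, hK]; exact abs_le_pow_mono h2 (by omega)
  · intro k hk
    have h1 : (k : ℤ) ≤ 2 ^ w + 1 := by omega
    refine bitLength_le (a := w + 1) ?_ (by nlinarith)
    rw [Nat.abs_cast, pow_succ]
    have : (1 : ℤ) ≤ 2 ^ w := one_le_pow₀ (by norm_num)
    linarith
  · rintro k τ hk ⟨e1, e2, e3, e4⟩
    have hk' : (k : ℤ) < N.eval σ := by omega
    have hag := hagree k τ e1 e4
    obtain ⟨hs1, -⟩ := hc₂ w R τ hR2 hw (hbdv k τ hk' e1 e4)
      (rng_congr hb (avoids_five hb h5') hag (hrb k hk'))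
    refine (hs1.mono (bitLength_mono_bound (by omega)) le_rfl fun _ h => h).seq (T₂ := 20)
      (fun τ₁ hτ₁ => ?_) le_rfl
    have f2 : τ₁ 5 d = K := by rw [hτ₁.2.2.2 d (by push_cast; omega), e2]
    have f3 : τ₁ 5 (d + 1 : ℕ) = g σ k := by rw [hτ₁.2.2.2 _ (by push_cast; omega), e3]
    have f4 : τ₁ 5 (d + 2 : ℕ) = b.eval (σ.set v 0 k) := by
      rw [hτ₁.1, eval_congr hb (avoids_five hb h5') hag]
    have f5 : τ₁ v 0 = k := by rw [hτ₁.2.2.1 v List.mem_cons_self, e1]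
    refine (hg3 k τ₁ hk' (by rw [f2, hK]) f3 f4 f5).imp le_rfl ?_
    rintro _ rfl
    have hkeep : Keep L d σ τ₁ := e4.trans (d' := d + 2) (by omega)
      ⟨hτ₁.2.1, fun u hu => hτ₁.2.2.1 u (List.mem_cons_of_mem _ hu), hτ₁.2.2.2⟩
    refine ⟨by rw [Store.set_of_ne _ (by omega), f5], by rw [Store.set_self]; push_cast; rfl, ?_, ?_,
      (hkeep.set_tmp hL (by push_cast; omega) _).set_var hv hvL _⟩
    · rw [Store.set_of_ne _ (by omega), Store.set_apply, if_neg (by push_cast; omega), f2]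
    · rw [Store.set_of_ne _ (by omega), Store.set_self]
  · simp only [tmp, Expr.cost]
    have hKR : K ≤ R := by omega
    have h1 : 1 ≤ R ^ c₂ := Nat.one_le_pow _ _ (by omega)
    have h5 : 2 ^ 6 ≤ R ^ 6 := Nat.pow_le_pow_left hR2 6
    -- The loop costs one factor `R` for its range, and six more for the constant overhead of a
    -- round.
    have h6 : K * (R ^ c₂ + 20 + (1 + 1) + 10) ≤ R * (R ^ c₂ * R ^ 6) :=
      Nat.mul_le_mul hKR (by nlinarith)
    have h7 : R ^ (c₂ + 7) = R * (R ^ c₂ * R ^ 6) := by ring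
    omega
  · have e5 : σ₄ 5 (d + 1 : ℕ) = e.eval σ := by rw [hσ₄.2.2.1, hg σ hN0]
    refine Runs.write (bitLength_natCast_le hw1 (by omega))
      (fits_tmp hw1 (by omega) (by rw [e5]; exact hex)) (by simp [Expr.cost, tmp])
      ⟨?_, hσ₄.2.2.2.set_tmp hL le_rfl _⟩
    simp only [tmp, Expr.eval, e5]
    exact Store.set_self _ _ _ _

theorem spec_sum {v : ℕ} {N b : HExpr} {L : List ℕ} (hok : (sum v N b).ok L = true)
    (hL : ∀ v ∈ L, 60 ≤ v) (d : ℕ) (ihN : ∃ c, Spec N L d c)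
    (ihb : ∃ c, Spec b (v :: L) (d + 2) c) : ∃ c, Spec (sum v N b) L d c := by
  simp only [ok, Bool.and_eq_true, decide_eq_true_eq, Bool.not_eq_true', ← Bool.not_eq_true,
    List.contains_iff_mem] at hok
  refine spec_loop hok.1.1.1 hok.1.1.2 hok.2 hL d (by simp [Expr.cost]) (fun _ _ h => h) rfl
    (fun σ k => ∑ j ∈ Finset.range k, b.eval (σ.set v 0 j)) (fun _ _ _ _ => rfl) (fun _ _ => rfl)
    ihN ihb ?_
  intro c₁ c₂ w R σ hR hw hN0 hNR h1 h2
  have hw1 := Bd.one_le hR hw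
  have hRw : (R : ℤ) ≤ 2 ^ w := by exact_mod_cast hw
  have hs : ∀ k : ℕ, (k : ℤ) ≤ N.eval σ →
      |∑ j ∈ Finset.range k, b.eval (σ.set v 0 j)| ≤ 2 ^ (w * (c₁ + c₂ + d + 12)) := by
    intro k hk
    refine (Finset.abs_sum_le_sum_abs _ _).trans ((Finset.sum_le_card_nsmul _ _ _ fun j hj =>
      h2 j (by have := Finset.mem_range.1 hj; omega)).trans ?_)
    rw [Finset.card_range, nsmul_eq_mul]
    calc (k : ℤ) * 2 ^ (w * c₂) ≤ 2 ^ w * 2 ^ (w * c₂) :=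
          mul_le_mul_of_nonneg_right (by linarith) (by positivity)
      _ = 2 ^ (w * (c₂ + 1)) := by rw [← pow_add]; congr 1; ring
      _ ≤ _ := pow_le_pow_right₀ (by norm_num) (Nat.mul_le_mul_left w (by omega))
  refine ⟨hs, fun _ _ => bitLength_natCast_le (k := 0) hw1 (by omega), ?_⟩
  intro k σ' hk e1 e2 e3 e4
  refine Runs.write (bitLength_natCast_le hw1 (by omega))
    ⟨fits_tmp hw1 (by omega) ?_, fits_tmp hw1 (by omega) ?_, bitLength_le (a := w * (c₁ + c₂ + d + 16)) ?_ le_rfl⟩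
    (by simp [Expr.cost, tmp]) ?_
  · rw [e2]; exact abs_le_pow_mono (hs k hk.le) (by omega)
  · rw [e3]; exact abs_le_pow_mono (h2 k hk) (by omega)
  · simp only [tmp, Expr.eval, Op.eval, e2, e3]
    rw [← Finset.sum_range_succ (fun j : ℕ => b.eval (σ.set v 0 j))]
    exact abs_le_pow_mono (hs (k + 1) (by push_cast; omega)) (by omega)
  · simp only [tmp, Expr.eval, Op.eval, e2, e3, Finset.sum_range_succ]

theorem spec_find {v : ℕ} {N b : HExpr} {L : List ℕ} (hok : (find v N b).ok L = true)
    (hL : ∀ v ∈ L, 60 ≤ v) (d : ℕ) (ihN : ∃ c, Spec N L d c)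
    (ihb : ∃ c, Spec b (v :: L) (d + 2) c) : ∃ c, Spec (find v N b) L d c := by
  simp only [ok, Bool.and_eq_true, decide_eq_true_eq, Bool.not_eq_true', ← Bool.not_eq_true,
    List.contains_iff_mem] at hok
  refine spec_loop hok.1.1.1 hok.1.1.2 hok.2 hL d (by simp [Expr.cost, tmp])
    (fun _ _ h => h) rfl
    (fun σ k => scan (N.eval σ).toNat (fun k => b.eval (σ.set v 0 k)) k) ?_ (fun _ _ => rfl)
    ihN ihb ?_
  · intro σ σ' h0 h
    simp [tmp, Expr.eval, h, scan, h0]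
  intro c₁ c₂ w R σ hR hw hN0 hNR h1 h2
  have hw1 := Bd.one_le hR hw
  have hRw : (R : ℤ) ≤ 2 ^ w := by exact_mod_cast hw
  have hs : ∀ k : ℕ, (k : ℤ) ≤ N.eval σ →
      |((scan (N.eval σ).toNat (fun k => b.eval (σ.set v 0 k)) k : ℕ) : ℤ)| ≤
        2 ^ (w * (c₁ + c₂ + d + 12)) := by
    intro k hk
    refine le_trans ?_ (abs_le_pow_mono h1 (c' := c₁ + c₂ + d + 12) (by omega))
    rw [Nat.abs_cast, abs_of_nonneg hN0]
    have := scan_le (N := (N.eval σ).toNat) (f := fun k => b.eval (σ.set v 0 k)) (k := k) (by omega)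
    omega
  refine ⟨hs, fun _ h => fits_tmp hw1 (by omega)
    (by rw [h]; exact abs_le_pow_mono h1 (by omega)), ?_⟩
  intro k σ' hk e1 e2 e3 e4
  have f1 : (tmp d).Fits (w * (c₁ + c₂ + d + 16) + 2) σ' := fits_tmp hw1 (by omega)
    (by rw [e1]; exact abs_le_pow_mono h1 (by omega))
  have f2 : (tmp (d + 1)).Fits (w * (c₁ + c₂ + d + 16) + 2) σ' := fits_tmp hw1 (by omega)
    (by rw [e2]; exact abs_le_pow_mono (hs k hk.le) (by omega))
  have f3 : (tmp (d + 2)).Fits (w * (c₁ + c₂ + d + 16) + 2) σ' := fits_tmp hw1 (by omega)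
    (by rw [e3]; exact abs_le_pow_mono (h2 k hk) (by omega))
  -- The product is nonzero exactly if the accumulator still equals the range, so nothing was found
  -- before, and the body is nonzero now.
  have hcond : Expr.eval σ' (.op .mul (.op .eq (tmp (d + 1)) (tmp d)) (tmp (d + 2))) =
      if scan (N.eval σ).toNat (fun k => b.eval (σ.set v 0 k)) k = (N.eval σ).toNat then
        b.eval (σ.set v 0 k) else 0 := by
    simp only [Expr.eval, Op.eval, tmp, e1, e2, e3]
    split_ifs <;> omega
  refine Runs.ite (T := 6) ⟨⟨f2, f1, ?_⟩, f3, ?_⟩ (fun hne => ?_) (fun hz => ?_)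
    (by simp [Expr.cost, tmp])
  · refine bitLength_le (a := 0) ?_ (by omega)
    simp only [Op.eval]; split_ifs <;> simp
  · refine bitLength_le (a := w * c₂) ?_ (by nlinarith)
    change |Expr.eval σ' (.op .mul (.op .eq (tmp (d + 1)) (tmp d)) (tmp (d + 2)))| ≤ _
    rw [hcond]
    split_ifs
    · exact h2 k hk
    · simp
  · rw [hcond, ite_ne_right_iff] at hne
    refine Runs.write (bitLength_natCast_le hw1 (by omega))
      ⟨bitLength_natCast_le (k := 0) hw1 (by omega), ?_⟩ (by simp [Expr.cost]) ?_
    · refine bitLength_le (a := w * (c₁ + c₂ + d + 16)) ?_ le_rfl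
      simp only [Expr.eval, e4, Nat.abs_cast]
      refine le_trans ?_ (abs_le_pow_mono h1 (c' := c₁ + c₂ + d + 16) (by omega))
      rw [abs_of_nonneg hN0]; omega
    · simp only [Expr.eval, e4]
      simp only [scan]
      rw [if_pos hne]
  · rw [hcond] at hz
    have : scan (N.eval σ).toNat (fun k => b.eval (σ.set v 0 k)) (k + 1) =
        scan (N.eval σ).toNat (fun k => b.eval (σ.set v 0 k)) k := by
      simp only [scan]
      rw [if_neg]
      rintro ⟨h3, h4⟩
      rw [if_pos h3] at hz
      exact h4 hz
    refine Runs.skip (by norm_num) ?_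
    rw [this, ← e2]
    funext a i
    rw [Store.set_apply]
    split_ifs with h
    · rw [h.1, h.2]
    · rfl

/-- Structural induction. The constant `c` is chosen before the memory, `w` and `R`, so one constant
serves all inputs. -/
theorem exists_spec {e : HExpr} {L : List ℕ} (hok : e.ok L = true) (hL : ∀ v ∈ L, 60 ≤ v) (d : ℕ) :
    ∃ c, Spec e L d c := by
  induction e generalizing L d with
  | const x => exact spec_const x L hL d
  | var v => exact spec_var hok hL d
  | read a i ih =>
    refine spec_read hok hL d (ih ?_ hL d)
    simp only [ok, Bool.and_eq_true] at hok
    exact hok.2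
  | op o x y ihx ihy =>
    have h := hok
    simp only [ok, Bool.and_eq_true] at h
    exact spec_op hok hL d (ihx h.1 hL d) (ihy h.2 hL (d + 1))
  | sum v N b ihN ihb =>
    have h := hok
    simp only [ok, Bool.and_eq_true, decide_eq_true_eq] at h
    exact spec_sum hok hL d (ihN h.1.2 hL d) (ihb h.2 (List.forall_mem_cons.2 ⟨h.1.1.1, hL⟩) _)
  | find v N b ihN ihb =>
    have h := hok
    simp only [ok, Bool.and_eq_true, decide_eq_true_eq] at h
    exact spec_find hok hL d (ihN h.1.2 hL d) (ihb h.2 (List.forall_mem_cons.2 ⟨h.1.1.1, hL⟩) _)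

end HExpr

end RAM
/-! ### The Faddeev–LeVerrier algorithm -/

section FaddeevLeVerrier

open Polynomial Matrix

variable {m : Type*} [Fintype m] [DecidableEq m] {R : Type*} [CommRing R]

/-- Jacobi's formula for `X - M`, compared permutation by permutation. The product rule drops one
factor, whose derivative is `1` on the diagonal and `0` elsewhere; a diagonal entry of the adjugate
is the determinant with one row replaced by a unit vector. -/
theorem Matrix.derivative_charpoly (M : Matrix m m R) :
    derivative M.charpoly = M.charmatrix.adjugate.trace := by
  have hd : ∀ i j, derivative (M.charmatrix i j) = if i = j then 1 else 0 := by
    intro i j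
    by_cases h : i = j
    · subst h; simp [charmatrix_apply_eq]
    · simp [h]
  simp only [charpoly, trace, diag_apply, adjugate_apply, det_apply, derivative_sum,
    derivative_smul, derivative_prod_finset, hd]
  rw [Finset.sum_comm]
  refine Finset.sum_congr rfl fun σ _ => ?_
  rw [Finset.smul_sum]
  refine Finset.sum_congr rfl fun i _ => ?_
  congr 1
  by_cases h : σ i = i
  · rw [← Finset.mul_prod_erase _ _ (Finset.mem_univ i)]
    rw [if_pos h, mul_one, h, updateRow_self, Pi.single_eq_same, one_mul]
    refine Finset.prod_congr rfl fun k hk => ?_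
    have hk' : σ k ≠ i := fun h' => (Finset.ne_of_mem_erase hk) (σ.injective (h'.trans h.symm))
    rw [updateRow_ne hk']
  · rw [if_neg h, mul_zero]
    -- If `σ` moves `i`, the replaced row contributes its entry in the column `σ.symm i ≠ i`, which
    -- is `0`.
    refine (Finset.prod_eq_zero (Finset.mem_univ (σ.symm i)) ?_).symm
    rw [σ.apply_symm_apply, updateRow_self, Pi.single_eq_of_ne]
    intro h'
    exact h (by rw [← h', σ.apply_symm_apply, h'])

/-- The matrix coefficients of the adjugate of `X - M`. -/
noncomputable def Matrix.adjCoeff (M : Matrix m m R) (k : ℕ) : Matrix m m R :=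
  M.charmatrix.adjugate.map fun p => p.coeff k

/-- This is `(X - M) * adj (X - M) = charpoly * 1`, solved for the term with `X`. Comparing
coefficients yields the recursion of the algorithm. -/
theorem Matrix.X_mul_adjugate_charmatrix (M : Matrix m m R) (i j : m) :
    X * M.charmatrix.adjugate i j =
      (∑ l, C (M i l) * M.charmatrix.adjugate l j) +
        M.charpoly * C ((1 : Matrix m m R) i j) := by
  have h := M.charmatrix.mul_adjugate
  have h1 : ((1 : Matrix m m R[X]) i j) = C ((1 : Matrix m m R) i j) := by
    by_cases hij : i = j <;> simp [one_apply, hij]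
  rw [charpoly, ← h1, ← smul_eq_mul M.charmatrix.det, ← smul_apply, ← h]
  generalize M.charmatrix.adjugate = B
  rw [charmatrix, sub_mul, sub_apply, mul_apply (M := C.mapMatrix M)]
  simp

theorem Matrix.mul_adjCoeff_zero (M : Matrix m m R) :
    M * M.adjCoeff 0 + M.charpoly.coeff 0 • (1 : Matrix m m R) = 0 := by
  ext i j
  have h := congrArg (fun p => p.coeff 0) (M.X_mul_adjugate_charmatrix i j)
  simp only [coeff_X_mul_zero, coeff_add, finsetSum_coeff, coeff_C_mul, coeff_mul_C] at h
  rw [add_apply, mul_apply, smul_apply, smul_eq_mul, zero_apply, h]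
  rfl

theorem Matrix.adjCoeff_eq_mul_adjCoeff_succ (M : Matrix m m R) (k : ℕ) :
    M.adjCoeff k = M * M.adjCoeff (k + 1) + M.charpoly.coeff (k + 1) • (1 : Matrix m m R) := by
  ext i j
  have h := congrArg (fun p => p.coeff (k + 1)) (M.X_mul_adjugate_charmatrix i j)
  simp only [coeff_X_mul, coeff_add, finsetSum_coeff, coeff_C_mul, coeff_mul_C] at h
  rw [add_apply, mul_apply, smul_apply, smul_eq_mul]
  exact h

/-- The coefficients vanish in high degrees, and the recursion carries the zero downwards as long as
it only meets coefficients of the characteristic polynomial beyond its degree. -/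
theorem Matrix.adjCoeff_eq_zero [Nontrivial R] (M : Matrix m m R) {k : ℕ} (hk : Fintype.card m ≤ k) :
    M.adjCoeff k = 0 := by
  obtain ⟨K, hK⟩ : ∃ K, ∀ k, K ≤ k → M.adjCoeff k = 0 := by
    refine ⟨(Finset.univ.sup fun i => Finset.univ.sup fun j =>
      (M.charmatrix.adjugate i j).natDegree) + 1, fun k hk => ?_⟩
    ext i j
    refine coeff_eq_zero_of_natDegree_lt ?_
    refine Nat.lt_of_lt_of_le (Nat.lt_succ_of_le ?_) hk
    exact (Finset.le_sup (f := fun j => (M.charmatrix.adjugate i j).natDegree)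
      (Finset.mem_univ j)).trans (Finset.le_sup (f := fun i => Finset.univ.sup fun j =>
      (M.charmatrix.adjugate i j).natDegree) (Finset.mem_univ i))
  induction h : K - k generalizing k with
  | zero => exact hK k (by omega)
  | succ d ih =>
    rw [adjCoeff_eq_mul_adjCoeff_succ, ih (by omega) (by omega), mul_zero, zero_add,
      coeff_eq_zero_of_natDegree_lt, zero_smul]
    rw [charpoly_natDegree_eq_dim]; omega

theorem Matrix.trace_adjCoeff (M : Matrix m m R) (k : ℕ) :
    (M.adjCoeff k).trace = (k + 1) * M.charpoly.coeff (k + 1) := by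
  have h := congrArg (fun p => p.coeff k) M.derivative_charpoly
  simp only [coeff_derivative, trace, finsetSum_coeff, diag_apply] at h
  rw [mul_comm, h]
  simp [trace, adjCoeff]

/-- The trace of the recursion, combined with the formula for the derivative. This identity makes
the division in the iteration exact. -/
theorem Matrix.trace_mul_adjCoeff (M : Matrix m m R) (k : ℕ) :
    (M * M.adjCoeff k).trace = (k - Fintype.card m) * M.charpoly.coeff k := by
  rcases k with _ | k
  · rw [eq_neg_of_add_eq_zero_left M.mul_adjCoeff_zero]
    simp [mul_comm]
  · have h := congrArg trace (M.adjCoeff_eq_mul_adjCoeff_succ k)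
    rw [trace_adjCoeff, trace_add, trace_smul, trace_one, smul_eq_mul] at h
    rw [eq_sub_of_add_eq h.symm]
    push_cast
    ring

/-- The iteration of the Faddeev–LeVerrier algorithm. -/
def faddeevLeVerrier (M : Matrix m m ℤ) : ℕ → Matrix m m ℤ × ℤ
  | 0 => (0, 1)
  | k + 1 =>
    let B := M * (faddeevLeVerrier M k).1 + (faddeevLeVerrier M k).2 • (1 : Matrix m m ℤ)
    (B, (0 - (M * B).trace) / ((k : ℤ) + 1))

theorem faddeevLeVerrier_succ_fst (M : Matrix m m ℤ) (k : ℕ) (i j : m) :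
    (faddeevLeVerrier M (k + 1)).1 i j =
      ∑ l, M i l * (faddeevLeVerrier M k).1 l j + if i = j then (faddeevLeVerrier M k).2 else 0 := by
  simp only [faddeevLeVerrier, Matrix.add_apply, Matrix.smul_apply, Matrix.mul_apply,
    Matrix.one_apply, smul_eq_mul, mul_ite, mul_one, mul_zero]

theorem faddeevLeVerrier_succ_snd (M : Matrix m m ℤ) (k : ℕ) :
    (faddeevLeVerrier M (k + 1)).2 =
      (0 - ∑ i, ∑ l, M i l * (faddeevLeVerrier M (k + 1)).1 l i) / ((k : ℤ) + 1) := by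
  rw [faddeevLeVerrier]
  rfl

theorem faddeevLeVerrier_eq (M : Matrix m m ℤ) {k : ℕ} (hk : k ≤ Fintype.card m) :
    faddeevLeVerrier M k =
      (M.adjCoeff (Fintype.card m - k), M.charpoly.coeff (Fintype.card m - k)) := by
  induction k with
  | zero =>
    have h1 : M.charpoly.coeff (Fintype.card m) = 1 := by
      have := M.charpoly_monic.coeff_natDegree
      rwa [M.charpoly_natDegree_eq_dim] at this
    simp [faddeevLeVerrier, M.adjCoeff_eq_zero le_rfl, h1]
  | succ k ih =>
    have e : Fintype.card m - k = Fintype.card m - (k + 1) + 1 := by omega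
    have hB : M * (faddeevLeVerrier M k).1 + (faddeevLeVerrier M k).2 • (1 : Matrix m m ℤ) =
        M.adjCoeff (Fintype.card m - (k + 1)) := by
      rw [ih (by omega), e, ← adjCoeff_eq_mul_adjCoeff_succ]
    simp only [faddeevLeVerrier, hB, Prod.mk.injEq, true_and]
    rw [trace_mul_adjCoeff]
    -- For the coefficient of index `card m - (k + 1)`, the factor in `trace_mul_adjCoeff` is `-(k +
    -- 1)`; the sign cancels against that in the definition.
    refine Int.ediv_eq_of_eq_mul_right (by omega) ?_
    push_cast [Nat.cast_sub hk]
    ring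

theorem mul_faddeevLeVerrier (M : Matrix m m ℤ) :
    M * (faddeevLeVerrier M (Fintype.card m)).1 =
      -(faddeevLeVerrier M (Fintype.card m)).2 • (1 : Matrix m m ℤ) := by
  rw [faddeevLeVerrier_eq M le_rfl]
  simp only [Nat.sub_self, neg_smul]
  exact eq_neg_of_add_eq_zero_left M.mul_adjCoeff_zero

theorem abs_faddeevLeVerrier (M : Matrix m m ℤ) :
    |(faddeevLeVerrier M (Fintype.card m)).2| = |M.det| := by
  rw [faddeevLeVerrier_eq M le_rfl, M.det_eq_sign_charpoly_coeff]
  simp [abs_mul]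

/-- Each step enlarges the entries at most by the factor `2 N² a`, where `N` is the order of the
matrix, since dividing by an integer does not increase the absolute value. After at most `N` steps
the bit length is still polynomial. -/
theorem abs_faddeevLeVerrier_le [Nonempty m] (M : Matrix m m ℤ) {a : ℤ} (ha : 1 ≤ a)
    (hM : ∀ i j, |M i j| ≤ a) (k : ℕ) :
    (∀ i j, |(faddeevLeVerrier M k).1 i j| ≤ (2 * (Fintype.card m : ℤ) ^ 2 * a) ^ k) ∧
      |(faddeevLeVerrier M k).2| ≤
        (Fintype.card m : ℤ) ^ 2 * a * (2 * (Fintype.card m : ℤ) ^ 2 * a) ^ k := by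
  have hn : (1 : ℤ) ≤ Fintype.card m := by exact_mod_cast Fintype.card_pos
  have hmul : ∀ (B : Matrix m m ℤ) (y : ℤ), (∀ i j, |B i j| ≤ y) → ∀ i j,
      |(M * B) i j| ≤ Fintype.card m * (a * y) := by
    intro B y hB i j
    rw [mul_apply]
    refine (Finset.abs_sum_le_sum_abs _ _).trans ((Finset.sum_le_card_nsmul _ _ (a * y) ?_).trans
      (by simp))
    intro l _
    rw [abs_mul]
    exact mul_le_mul (hM i l) (hB l j) (abs_nonneg _) (by omega)
  induction k with
  | zero =>
    refine ⟨fun i j => by simp [faddeevLeVerrier], ?_⟩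
    simp only [faddeevLeVerrier, abs_one, pow_zero, mul_one]
    exact one_le_mul_of_one_le_of_one_le (one_le_pow₀ hn) ha
  | succ k ih =>
    obtain ⟨ih1, ih2⟩ := ih
    set N : ℤ := (Fintype.card m : ℤ)
    set y := 2 * N ^ 2 * a with hy
    have hyk : 0 ≤ y ^ k := by positivity
    have hB : ∀ i j, |(faddeevLeVerrier M (k + 1)).1 i j| ≤ y ^ (k + 1) := by
      intro i j
      simp only [faddeevLeVerrier, Matrix.add_apply, Matrix.smul_apply, smul_eq_mul]
      have h1 := hmul _ _ ih1 i j
      have h2 : |(faddeevLeVerrier M k).2 * (1 : Matrix m m ℤ) i j| ≤ N ^ 2 * a * y ^ k := by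
        by_cases hij : i = j
        · rw [hij, one_apply_eq, mul_one]; exact ih2
        · simp only [one_apply, hij, if_false, mul_zero, abs_zero]; positivity
      have h3 : N * (a * y ^ k) ≤ N ^ 2 * a * y ^ k := by
        have : N ≤ N ^ 2 := by nlinarith
        nlinarith [mul_nonneg (show 0 ≤ a by omega) hyk]
      calc _ ≤ _ := abs_add_le _ _
        _ ≤ N ^ 2 * a * y ^ k + N ^ 2 * a * y ^ k := add_le_add (h1.trans h3) h2
        _ = y ^ (k + 1) := by rw [pow_succ, hy]; ring
    refine ⟨hB, ?_⟩
    have h1 : |(faddeevLeVerrier M (k + 1)).2| ≤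
        |0 - (M * (faddeevLeVerrier M (k + 1)).1).trace| := by
      simp only [faddeevLeVerrier]
      exact Int.abs_ediv_le_abs _ _
    refine h1.trans ?_
    rw [zero_sub, abs_neg, trace]
    refine (Finset.abs_sum_le_sum_abs _ _).trans ((Finset.sum_le_card_nsmul _ _ _
      fun i _ => hmul _ _ hB i i).trans ?_)
    simp only [Finset.card_univ, nsmul_eq_mul]
    apply le_of_eq
    ring

end FaddeevLeVerrier
/-! ### Programs built from expressions -/

namespace RAM

open Filter

namespace HExpr

instance : Add HExpr := ⟨op .add⟩
instance : Sub HExpr := ⟨op .sub⟩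
instance : Mul HExpr := ⟨op .mul⟩
instance : Div HExpr := ⟨op .div⟩
instance : Mod HExpr := ⟨op .mod⟩
instance (k : ℕ) : OfNat HExpr k := ⟨const k⟩

/-- The comparison of two expressions. -/
def lt (x y : HExpr) : HExpr := op .lt x y

/-- The equality test of two expressions. -/
def eq (x y : HExpr) : HExpr := op .eq x y

/-- The test whether `b` holds for all `v < N`. -/
def all (v : ℕ) (N b : HExpr) : HExpr := eq (find v N (eq b 0)) N

variable (x y : HExpr) (σ : Store) (R : ℕ)

@[simp] theorem eval_const (c : ℤ) : (const c).eval σ = c := rfl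
@[simp] theorem eval_ofNat (k : ℕ) : (ofNat(k) : HExpr).eval σ = k := rfl
@[simp] theorem eval_var (v : ℕ) : (var v).eval σ = σ v 0 := rfl
@[simp] theorem eval_read (a : ℕ) : (read a x).eval σ = σ a (x.eval σ) := rfl
@[simp] theorem eval_add : (x + y).eval σ = x.eval σ + y.eval σ := rfl
@[simp] theorem eval_sub : (x - y).eval σ = x.eval σ - y.eval σ := rfl
@[simp] theorem eval_mul : (x * y).eval σ = x.eval σ * y.eval σ := rfl
@[simp] theorem eval_div : (x / y).eval σ = x.eval σ / y.eval σ := rfl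
@[simp] theorem eval_mod : (x % y).eval σ = x.eval σ % y.eval σ := rfl
@[simp] theorem eval_lt : (lt x y).eval σ = if x.eval σ < y.eval σ then 1 else 0 := rfl
@[simp] theorem eval_eq : (eq x y).eval σ = if x.eval σ = y.eval σ then 1 else 0 := rfl
@[simp] theorem eval_sum (v : ℕ) : (sum v x y).eval σ =
    ∑ k ∈ Finset.range (x.eval σ).toNat, y.eval (σ.set v 0 k) := rfl
theorem eval_find (v : ℕ) : (find v x y).eval σ =
    scan (x.eval σ).toNat (fun k => y.eval (σ.set v 0 k)) (x.eval σ).toNat := rfl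

theorem eval_all_ne_zero {v : ℕ} (h : 0 ≤ x.eval σ) : (all v x y).eval σ ≠ 0 ↔
    ∀ k < (x.eval σ).toNat, y.eval (σ.set v 0 k) ≠ 0 := by
  have h1 : (all v x y).eval σ ≠ 0 ↔ (find v x (eq y 0)).eval σ = x.eval σ := by
    rw [all, eval_eq]; split_ifs <;> simp [*]
  rw [h1, eval_find]
  obtain ⟨m, hm⟩ := Int.eq_ofNat_of_zero_le h
  rw [hm, Int.toNat_natCast, Nat.cast_inj, scan_eq_iff]
  simp

theorem eval_all_eq {v : ℕ} : (all v x y).eval σ = 0 ∨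
    (all v x y).eval σ = 1 := by
  simp only [all, eval_eq]
  split_ifs <;> simp

@[simp] theorem rng_ofNat (k : ℕ) : (ofNat(k) : HExpr).Rng R σ := trivial
@[simp] theorem rng_var (v : ℕ) : (var v).Rng R σ := trivial
@[simp] theorem rng_read (a : ℕ) : (read a x).Rng R σ ↔ x.Rng R σ := Iff.rfl
@[simp] theorem rng_add : (x + y).Rng R σ ↔ x.Rng R σ ∧ y.Rng R σ := Iff.rfl
@[simp] theorem rng_sub : (x - y).Rng R σ ↔ x.Rng R σ ∧ y.Rng R σ := Iff.rfl
@[simp] theorem rng_mul : (x * y).Rng R σ ↔ x.Rng R σ ∧ y.Rng R σ := Iff.rfl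
@[simp] theorem rng_div : (x / y).Rng R σ ↔ x.Rng R σ ∧ y.Rng R σ := Iff.rfl
@[simp] theorem rng_mod : (x % y).Rng R σ ↔ x.Rng R σ ∧ y.Rng R σ := Iff.rfl
@[simp] theorem rng_lt : (lt x y).Rng R σ ↔ x.Rng R σ ∧ y.Rng R σ := Iff.rfl
@[simp] theorem rng_eq : (eq x y).Rng R σ ↔ x.Rng R σ ∧ y.Rng R σ := Iff.rfl
@[simp] theorem rng_sum (v : ℕ) : (sum v x y).Rng R σ ↔ x.Rng R σ ∧
    (0 ≤ x.eval σ ∧ x.eval σ ≤ R) ∧ ∀ k : ℕ, (k : ℤ) < x.eval σ → y.Rng R (σ.set v 0 k) := Iff.rfl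
@[simp] theorem rng_find (v : ℕ) : (find v x y).Rng R σ ↔ x.Rng R σ ∧
    (0 ≤ x.eval σ ∧ x.eval σ ≤ R) ∧ ∀ k : ℕ, (k : ℤ) < x.eval σ → y.Rng R (σ.set v 0 k) := Iff.rfl
@[simp] theorem rng_all (v : ℕ) : (all v x y).Rng R σ ↔ x.Rng R σ ∧
    (0 ≤ x.eval σ ∧ x.eval σ ≤ R) ∧ ∀ k : ℕ, (k : ℤ) < x.eval σ → y.Rng R (σ.set v 0 k) := by
  simp only [all, rng_eq, rng_find, rng_ofNat, and_true]
  exact and_iff_left_of_imp fun h => h.1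

/-- Stating results for all large `c` lets finitely many program pieces share one constant, without
tracking maxima. -/
theorem exists_forall_spec {e : HExpr} (hok : e.ok [] = true) (d : ℕ) :
    ∀ᶠ c in atTop, Spec e [] d c := by
  obtain ⟨c, hc⟩ := exists_spec hok (by simp) d
  exact eventually_atTop.2 ⟨c, fun c' h => hc.mono h⟩

end HExpr

open HExpr

/-! ### Frame conditions, assignments and the filling of arrays. -/

/-- The memories agree on the arrays below `60`, except `5` and those in `F`. -/
def Same (F : List ℕ) (σ σ' : Store) : Prop :=
  ∀ b < 60, b ≠ 5 → b ∉ F → σ' b = σ b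

theorem Same.trans {F F' F'' : List ℕ} {σ σ' σ'' : Store} (h : Same F σ σ') (h' : Same F' σ' σ'')
    (hF : F ⊆ F'' := by decide) (hF' : F' ⊆ F'' := by decide) : Same F'' σ σ'' :=
  fun b hb h5 hm => (h' b hb h5 fun h => hm (hF' h)).trans (h b hb h5 fun h => hm (hF h))

theorem Same.mono {F F' : List ℕ} {σ σ' : Store} (h : Same F σ σ')
    (hF : F ⊆ F' := by decide) : Same F' σ σ' :=
  fun b hb h5 hm => h b hb h5 fun h => hm (hF h)

theorem Same.get {F : List ℕ} {σ σ' : Store} (h : Same F σ σ') (b : ℕ)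
    (hb : b < 60 := by decide) (h5 : b ≠ 5 := by decide) (hF : b ∉ F := by decide) : σ' b = σ b :=
  h b hb h5 hF

theorem Same.refl (F : List ℕ) (σ : Store) : Same F σ σ := fun _ _ _ _ => rfl

theorem Same.set {F : List ℕ} {σ σ' : Store} (h : Same F σ σ') {a : ℕ} (ha : a ∈ F) (i x : ℤ) :
    Same F σ (σ'.set a i x) := fun b hb h5 hF => by
  rw [Store.set_of_ne _ (by rintro rfl; exact hF ha), h b hb h5 hF]

/-- All cells of the arrays below `60`, except `5`, are at most `2 ^ w` in absolute value. -/
def Bdd (w : ℕ) (σ : Store) : Prop := ∀ b < 60, b ≠ 5 → ∀ i, |σ b i| ≤ 2 ^ w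

theorem Bdd.bd {w : ℕ} {σ : Store} (h : Bdd w σ) : Bd [] w σ := ⟨h, by simp⟩

theorem Bdd.same {w : ℕ} {σ σ' : Store} (h : Bdd w σ) (hs : Same [] σ σ') : Bdd w σ' :=
  fun b h60 h5 i => by rw [hs b h60 h5 (by simp)]; exact h b h60 h5 i

theorem Bdd.set {w : ℕ} {σ : Store} (h : Bdd w σ) {x : ℤ} (hx : |x| ≤ 2 ^ w) (a : ℕ) (i : ℤ) :
    Bdd w (σ.set a i x) := fun b h60 h5 j => by
  rw [Store.set_apply]; split_ifs
  · exact hx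
  · exact h b h60 h5 j

/-- Store the value of `e` in the cell `i` of the array `a`. -/
def assign (a : ℕ) (i e : HExpr) : Program :=
  .seq (i.compile 0) (.seq (e.compile 1) (.write a (tmp 0) (tmp 1)))

theorem eventually_assign (a : ℕ) {i e : HExpr} (hi : i.ok [] = true) (he : e.ok [] = true) :
    ∀ᶠ c in atTop, ∀ (w R : ℕ) (σ : Store), 100 ≤ R → R ≤ 2 ^ w → Bdd w σ → i.Rng R σ → e.Rng R σ →
      Runs (w * c + 2) (R ^ (c + 1)) (assign a i e) σ
        (fun σ' => Same [] (σ.set a (i.eval σ) (e.eval σ)) σ') := by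
  filter_upwards [exists_forall_spec hi 0, exists_forall_spec he 1, eventually_ge_atTop 10]
    with c h0 h1 hc w R σ hR hw hb hri hre
  have hw1 := Bd.one_le (by omega) hw
  obtain ⟨hs0, hv0⟩ := h0 w R σ (by omega) hw hb.bd hri
  refine hs0.seq (T₂ := R ^ c + 5) (fun σ₁ hσ₁ => ?_) ?_
  swap
  · have : 1 ≤ R ^ c := Nat.one_le_pow _ _ (by omega)
    rw [pow_succ]; nlinarith
  have hr' := rng_congr he (avoids_five he (by simp)) hσ₁.2.agree hre
  have he' := eval_congr he (avoids_five he (by simp)) hσ₁.2.agree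
  obtain ⟨hs1, hv1⟩ := h1 w R σ₁ (by omega) hw (hσ₁.2.bd hb.bd) hr'
  refine hs1.seq (T₂ := 5) (fun σ₂ hσ₂ => ?_) (by omega)
  have e1 : σ₂ 5 (0 : ℕ) = i.eval σ := by rw [hσ₂.2.2.2 _ (by norm_num), hσ₁.1]
  have e2 : σ₂ 5 (1 : ℕ) = e.eval σ := by rw [hσ₂.1, he']
  refine Runs.write (fits_tmp hw1 (by omega) (by rw [e1]; exact hv0))
    (fits_tmp hw1 (by omega) (by rw [hσ₂.1]; exact hv1)) (by simp [Expr.cost, tmp]) ?_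
  simp only [tmp, Expr.eval, e1, e2]
  intro b h60 h5 _
  funext j
  rw [Store.set_apply, Store.set_apply, hσ₂.2.1 b h60 h5, hσ₁.2.1 b h60 h5]

theorem eventually_put (a : ℕ) {e : HExpr} (he : e.ok [] = true) :
    ∀ᶠ c in atTop, ∀ (w R : ℕ) (σ : Store), 100 ≤ R → R ^ 4 ≤ 2 ^ w → Bdd w σ → e.Rng R σ →
      |e.eval σ| ≤ 2 ^ w → a < 60 ∧ a ≠ 5 →
      Runs (w * c + 2) (R ^ (c + 1)) (assign a 0 e) σ
        (fun σ' => Same [a] σ σ' ∧ σ' a 0 = e.eval σ ∧ Bdd w σ') := by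
  filter_upwards [eventually_assign a (i := 0) rfl he] with c h w R σ hR hw hb hr hv ha
  refine (h w R σ hR ((Nat.le_self_pow (by norm_num) R).trans hw) hb (by simp) hr).imp le_rfl
    fun σ' hs => ⟨((Same.refl [a] σ).set (by simp) _ _).trans hs (by simp) (by simp), ?_,
      (hb.set hv _ _).same hs⟩
  rw [hs a ha.1 ha.2 (by simp)]
  exact Store.set_self _ _ _ _

/-- Run `p` for the values of the counter `v` below the cell `0` of the array `N`. -/
def forTo (v N : ℕ) (p : Program) : Program :=
  .seq (.write v (.const 0) (.const 0)) (forL v (.read N (.const 0)) p)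

theorem Runs.forTo {w c T T' K v N : ℕ} {p : Program} {σ : Store} (I : ℕ → Store → Prop)
    (hc : 10 ≤ c) (hw : 1 ≤ w) (hK : K ≤ 2 ^ w) (h0 : I 0 (σ.set v 0 0))
    (hI : ∀ k σ, k ≤ K → I k σ → σ v 0 = k ∧ σ N 0 = K)
    (hp : ∀ k σ, k < K → I k σ →
      Runs (w * c + 2) T p σ fun σ' => σ' v 0 = k ∧ I (k + 1) (σ'.set v 0 ((k : ℤ) + 1)))
    (hT : K * (T + 12) + 15 ≤ T') : Runs (w * c + 2) T' (forTo v N p) σ (I K) := by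
  have hK' : ((K : ℕ) : ℤ) ≤ 2 ^ w := by exact_mod_cast hK
  have hk : ∀ k : ℕ, k ≤ K + 1 → bitLength (k : ℤ) ≤ w * c + 2 := fun k hk => by
    refine bitLength_le (a := w + 1) ?_ (by nlinarith)
    rw [Nat.abs_cast, pow_succ]
    have : (1 : ℤ) ≤ 2 ^ w := one_le_pow₀ (by norm_num)
    have : (k : ℤ) ≤ K + 1 := by exact_mod_cast hk
    linarith
  have hz : bitLength (0 : ℤ) ≤ w * c + 2 := hk 0 (by omega)
  refine (Runs.write (i := .const 0) (v := .const 0) (T := 3) hz hz (by simp [Expr.cost])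
    (Q := I 0) h0).seq (T₂ := K * (T + 12) + 12) (fun σ₁ hσ₁ => ?_) (by omega)
  refine Runs.forL (K := K) (T := T) I hσ₁ (fun k τ hkK hτ => ?_) hk hp
    (by simp only [Expr.cost]; ring_nf; omega)
  obtain ⟨h1, h2⟩ := hI k τ hkK hτ
  refine ⟨h1, h2, hz, ?_⟩
  simp only [Expr.eval, h2]
  exact hk K (by omega)

/-- Store the values of `e` for `var 40 = 0, …, K - 1` in the array `a`, where `K` is the content
of the cell `0` of the array `N`. -/
def fill (a N : ℕ) (e : HExpr) : Program := forTo 40 N (assign a (var 40) e)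

theorem eventually_fill (a N : ℕ) {e : HExpr} (he : e.ok [] = true) (hav : e.avoids a = true)
    (ha : a < 60 ∧ a ≠ 5 ∧ a ≠ 40 ∧ a ≠ N := by decide)
    (hN : N < 60 ∧ N ≠ 5 ∧ N ≠ 40 := by decide) :
    ∀ᶠ c in atTop, ∀ (w R K : ℕ) (σ : Store), 100 ≤ R → R ^ 4 ≤ 2 ^ w → Bdd w σ → σ N 0 = K →
      K ≤ R ^ 3 → (∀ k : ℕ, k < K → e.Rng R (σ.set 40 0 k) ∧ |e.eval (σ.set 40 0 k)| ≤ 2 ^ w) →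
      Runs (w * c + 2) (R ^ (c + 5)) (fill a N e) σ fun σ' => Same [a, 40] σ σ' ∧
        (∀ k : ℕ, k < K → σ' a k = e.eval (σ.set 40 0 k)) ∧ Bdd w σ' := by
  filter_upwards [eventually_assign a (i := var 40) (e := e) rfl he, eventually_ge_atTop 10]
    with c h0 hc w R K σ hR hw hb hK hKR hk
  have hR4 : R ^ 3 ≤ R ^ 4 := Nat.pow_le_pow_right (by omega) (by omega)
  have hRw : R ≤ 2 ^ w := (Nat.le_self_pow (by norm_num) R).trans hw
  have hw1 := Bd.one_le (by omega) hRw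
  have hKw : K ≤ 2 ^ w := hKR.trans (hR4.trans hw)
  have hKw' : (K : ℤ) ≤ 2 ^ w := by exact_mod_cast hKw
  refine (Runs.forTo (K := K) (T := R ^ (c + 1)) (fun k τ => Same [a, 40] σ τ ∧ τ 40 = (σ.set 40 0 k) 40 ∧
    (∀ j : ℕ, j < k → τ a j = e.eval (σ.set 40 0 j)) ∧ Bdd w τ) hc hw1 hKw ?_ ?_ ?_ le_rfl).imp ?_
    (fun σ' h => ⟨h.1, h.2.2.1, h.2.2.2⟩)
  · exact ⟨(Same.refl _ _).set (by simp) _ _, rfl, fun j hj => absurd hj (by omega),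
      hb.set (by simp) _ _⟩
  · rintro k τ - ⟨h1, h2, -, -⟩
    refine ⟨by rw [h2, Store.set_self], ?_⟩
    rw [h1 N hN.1 hN.2.1 (by simp only [List.mem_cons, List.not_mem_nil, or_false]; omega), hK]
  · rintro k τ hkK ⟨h1, h2, h3, h4⟩
    -- Since `e` does not read the array being filled, its value now is the one it would have in the
    -- initial memory.
    have hag : Agree a [] (σ.set 40 0 k) τ := by
      refine ⟨fun b h60 h5 hba => ?_, by simp⟩
      by_cases hb40 : b = 40
      · rw [hb40, h2]
      · rw [Store.set_of_ne _ hb40, h1 b h60 h5 (by simp [hb40, hba])]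
    obtain ⟨hr, hv⟩ := hk k hkK
    refine (h0 w R τ hR hRw h4 trivial (rng_congr he hav hag hr)).imp le_rfl fun σ' hσ' => ?_
    rw [← eval_congr he hav hag] at hσ'
    have h2' : τ 40 0 = k := by rw [h2, Store.set_self]
    simp only [eval_var, h2'] at hσ'
    have e40 : σ' 40 = τ 40 := by
      rw [hσ' 40 (by norm_num) (by norm_num) (by simp), Store.set_of_ne _ (by omega)]
    have ea : σ' a = (τ.set a k (e.eval (σ.set 40 0 k))) a := hσ' a ha.1 ha.2.1 (by simp)
    have hkw : |(k : ℤ) + 1| ≤ 2 ^ w := by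
      rw [abs_of_nonneg (by positivity)]; have : (k : ℤ) + 1 ≤ K := by exact_mod_cast hkK
      linarith
    refine ⟨by rw [e40, h2'], ?_, ?_, ?_, ?_⟩
    · refine Same.set (fun b h60 h5 hF => ?_) (by simp) _ _
      rw [hσ' b h60 h5 (by simp), Store.set_of_ne _ (by rintro rfl; simp at hF), h1 b h60 h5 hF]
    · funext j
      rw [Store.set_apply, Store.set_apply, e40, h2, Store.set_apply]
      push_cast
      split_ifs <;> rfl
    · intro j hj
      rw [Store.set_of_ne _ (by omega), ea, Store.set_apply]
      rcases Nat.lt_succ_iff_lt_or_eq.1 hj with h | rfl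
      · rw [if_neg (by omega), h3 j h]
      · rw [if_pos ⟨rfl, rfl⟩]
    · exact ((h4.set hv a k).same hσ').set hkw _ _
  · have hc1 : 1 ≤ R ^ (c + 1) := Nat.one_le_pow _ _ (by omega)
    have e1 : R ^ (c + 5) = R * (R ^ 3 * R ^ (c + 1)) := by ring
    have h3 : 1 ≤ R ^ 3 := Nat.one_le_pow _ _ (by omega)
    have h2 : K * (R ^ (c + 1) + 12) ≤ R ^ 3 * (R ^ (c + 1) * 13) :=
      Nat.mul_le_mul hKR (by omega)
    have h4 : 1 ≤ R ^ 3 * R ^ (c + 1) := Nat.mul_pos h3 hc1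
    rw [e1]
    nlinarith

/-- The assumption `100 ≤ R` is made for this: raising the exponent by one leaves room for a hundred
pieces, so that sums of times become linear arithmetic. -/
theorem pow_step {R a b : ℕ} (hR : 100 ≤ R) (h : a < b) : 100 * R ^ a ≤ R ^ b :=
  calc 100 * R ^ a ≤ R * R ^ a := Nat.mul_le_mul_right _ hR
    _ = R ^ (a + 1) := by ring
    _ ≤ R ^ b := Nat.pow_le_pow_right (by omega) h

theorem loop_time_le {R a K : ℕ} (hR : 100 ≤ R) (ha : 1 ≤ a) (hK : K ≤ R) :
    K * (R ^ a + 12) + 15 ≤ R ^ (a + 2) := by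
  have h1 := pow_step (a := 0) (b := a) hR ha
  have h2 := Nat.mul_le_mul hK (le_refl (R ^ a + 12))
  have h3 : R ^ (a + 2) = R * (R * R ^ a) := by ring
  have h4 := Nat.mul_le_mul_left (R ^ a) hR
  rw [h3]
  nlinarith

theorem Runs.of_time {B T T' : ℕ} {p : Program} {σ : Store} {Q : Store → Prop}
    (h : Runs B T p σ Q) (hT : T ≤ T') : Runs B T' p σ Q :=
  h.imp hT fun _ h => h

theorem Runs.then {B T₁ T₂ : ℕ} {p q : Program} {σ : Store} {Q Q₁ : Store → Prop}
    (hp : Runs B T₁ p σ Q₁) (hq : ∀ σ', Q₁ σ' → Runs B T₂ q σ' Q) :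
    Runs B (T₁ + T₂) (.seq p q) σ Q :=
  hp.seq hq le_rfl

end RAM

/-! ### Storage of matrices and the Faddeev–LeVerrier program -/

namespace RAM

open Filter HExpr

theorem forall_lt_mul_iff {m n : ℕ} {P : ℕ → Prop} :
    (∀ k < m * n, P k) ↔ ∀ (i : Fin m) (j : Fin n), P (j + n * i) := by
  refine ⟨fun h i j => h _ ?_, fun h k hk => ?_⟩
  · have h1 := i.2
    have h2 := j.2
    calc (j : ℕ) + n * i < n + n * i := by omega
      _ = n * (i + 1) := by ring
      _ ≤ n * m := Nat.mul_le_mul_left n h1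
      _ = m * n := mul_comm _ _
  · have hn : 0 < n := Nat.pos_of_ne_zero fun h => by simp [h] at hk
    have := h ⟨k / n, Nat.div_lt_of_lt_mul (by rwa [mul_comm] at hk)⟩ ⟨k % n, Nat.mod_lt k hn⟩
    simpa [Nat.mod_add_div] using this

@[simp] theorem index_div {n : ℕ} (i : ℤ) (j : Fin n) : ((j : ℕ) + (n : ℤ) * i) / n = i := by
  have h := j.2
  rw [Int.add_mul_ediv_left _ _ (by omega), Int.ediv_eq_zero_of_lt (by omega) (by omega), zero_add]

@[simp] theorem fin_emod {n : ℕ} (j : Fin n) : ((j : ℕ) : ℤ) % n = j := by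
  have h := j.2
  rw [Int.emod_eq_of_lt (by omega) (by omega)]

/-- The array `f` holds the matrix `M` in row-major order. -/
def HoldsMat {m n : ℕ} (f : ℤ → ℤ) (M : Fin m → Fin n → ℤ) : Prop :=
  ∀ (i : Fin m) (j : Fin n), f ((j : ℕ) + (n : ℤ) * (i : ℕ)) = M i j

/-- The array `f` holds the vector `v`. -/
def HoldsVec {m : ℕ} (f : ℤ → ℤ) (v : Fin m → ℤ) : Prop := ∀ i : Fin m, f (i : ℕ) = v i

theorem eventually_fillMat (a N : ℕ) {e : HExpr} (he : e.ok [] = true) (hav : e.avoids a = true)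
    (ha : a < 60 ∧ a ≠ 5 ∧ a ≠ 40 ∧ a ≠ N := by decide)
    (hN : N < 60 ∧ N ≠ 5 ∧ N ≠ 40 := by decide) :
    ∀ᶠ c in atTop, ∀ (w R m n : ℕ) (F : Fin m → Fin n → ℤ) (σ : Store),
      100 ≤ R → R ^ 4 ≤ 2 ^ w → Bdd w σ → σ N 0 = m * n → m * n ≤ R ^ 3 →
      (∀ (i : Fin m) (j : Fin n), e.Rng R (σ.set 40 0 ((j : ℕ) + (n : ℤ) * (i : ℕ))) ∧
        e.eval (σ.set 40 0 ((j : ℕ) + (n : ℤ) * (i : ℕ))) = F i j ∧ |F i j| ≤ 2 ^ w) →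
      Runs (w * c + 2) (R ^ (c + 5)) (fill a N e) σ fun σ' => Same [a, 40] σ σ' ∧
        HoldsMat (σ' a) F ∧ Bdd w σ' := by
  filter_upwards [eventually_fill a N he hav ha hN] with c h w R m n F σ hR hw hb hK hKR hF
  refine (h w R (m * n) σ hR hw hb (by rw [hK]; push_cast; rfl) hKR ?_).imp le_rfl fun σ' hσ' =>
    ⟨hσ'.1, fun i j => ?_, hσ'.2.2⟩
  · rw [forall_lt_mul_iff]
    intro i j
    push_cast
    rw [(hF i j).2.1]
    exact ⟨(hF i j).1, (hF i j).2.2⟩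
  · have := forall_lt_mul_iff.1 hσ'.2.1 i j
    push_cast at this
    rw [this, (hF i j).2.1]

theorem eventually_fillVec (a N : ℕ) {e : HExpr} (he : e.ok [] = true) (hav : e.avoids a = true)
    (ha : a < 60 ∧ a ≠ 5 ∧ a ≠ 40 ∧ a ≠ N := by decide)
    (hN : N < 60 ∧ N ≠ 5 ∧ N ≠ 40 := by decide) :
    ∀ᶠ c in atTop, ∀ (w R m : ℕ) (F : Fin m → ℤ) (σ : Store),
      100 ≤ R → R ^ 4 ≤ 2 ^ w → Bdd w σ → σ N 0 = m → m ≤ R ^ 3 →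
      (∀ i : Fin m, e.Rng R (σ.set 40 0 (i : ℕ)) ∧
        e.eval (σ.set 40 0 (i : ℕ)) = F i ∧ |F i| ≤ 2 ^ w) →
      Runs (w * c + 2) (R ^ (c + 5)) (fill a N e) σ fun σ' => Same [a, 40] σ σ' ∧
        HoldsVec (σ' a) F ∧ Bdd w σ' := by
  filter_upwards [eventually_fill a N he hav ha hN] with c h w R m F σ hR hw hb hK hKR hF
  refine (h w R m σ hR hw hb hK hKR fun k hk => ?_).imp le_rfl fun σ' hσ' =>
    ⟨hσ'.1, fun i => ?_, hσ'.2.2⟩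
  · rw [(hF ⟨k, hk⟩).2.1]
    exact ⟨(hF ⟨k, hk⟩).1, (hF ⟨k, hk⟩).2.2⟩
  · rw [hσ'.2.1 i i.2, (hF i).2.1]

/-- The memory holds the dimension and the numbers of entries of the matrices. -/
structure Base (n w R : ℕ) (σ : Store) : Prop where
  one_le : 1 ≤ n
  le : n + 1 ≤ R
  hundred_le : 100 ≤ R
  pow_le : R ^ 4 ≤ 2 ^ w
  bdd : Bdd w σ
  h0 : σ 0 0 = n
  h37 : σ 37 0 = n * n
  h38 : σ 38 0 = n + 1
  h39 : σ 39 0 = (n + 1) * n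

namespace Base

variable {n w R : ℕ} {σ : Store} (h : Base n w R σ)
include h

theorem mono {F : List ℕ} {σ' : Store} (hs : Same F σ σ') (hb : Bdd w σ')
    (hF : 0 ∉ F ∧ 37 ∉ F ∧ 38 ∉ F ∧ 39 ∉ F := by decide) : Base n w R σ' :=
  ⟨h.one_le, h.le, h.hundred_le, h.pow_le, hb,
    by rw [hs.get 0 (by decide) (by decide) hF.1, h.h0],
    by rw [hs.get 37 (by decide) (by decide) hF.2.1, h.h37],
    by rw [hs.get 38 (by decide) (by decide) hF.2.2.1, h.h38],
    by rw [hs.get 39 (by decide) (by decide) hF.2.2.2, h.h39]⟩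

theorem mul_self_le : n * n ≤ R ^ 3 := by
  have h1 := h.le
  have h2 : 1 ≤ R := by omega
  calc n * n ≤ R * R := Nat.mul_le_mul (by omega) (by omega)
    _ = R ^ 2 := by ring
    _ ≤ R ^ 3 := Nat.pow_le_pow_right h2 (by norm_num)

theorem succ_mul_le : (n + 1) * n ≤ R ^ 3 := by
  have h1 := h.le
  have h2 : 1 ≤ R := by omega
  calc (n + 1) * n ≤ R * R := Nat.mul_le_mul (by omega) (by omega)
    _ = R ^ 2 := by ring
    _ ≤ R ^ 3 := Nat.pow_le_pow_right h2 (by norm_num)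

theorem le_two_pow : R ≤ 2 ^ w := (Nat.le_self_pow (by norm_num) R).trans h.pow_le

theorem self_le_two_pow : n ≤ 2 ^ w := by have := h.le; have := h.le_two_pow; omega

theorem abs_le_two_pow {x : ℤ} (h0 : 0 ≤ x) (h1 : x ≤ R) : |x| ≤ 2 ^ w := by
  rw [abs_of_nonneg h0]
  have : (R : ℤ) ≤ 2 ^ w := by exact_mod_cast h.le_two_pow
  linarith

theorem abs_succ_le {k : ℕ} (hk : k < R) : |(k : ℤ) + 1| ≤ 2 ^ w :=
  h.abs_le_two_pow (by positivity) (by omega)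

theorem one_le_w : 1 ≤ w := Bd.one_le (by have := h.hundred_le; omega) h.le_two_pow

end Base

/-- The entry of the next matrix in the Faddeev–LeVerrier algorithm. -/
def flMat : HExpr :=
  sum 60 (var 0) (read 6 (var 60 + var 0 * (var 40 / var 0)) *
    read 7 (var 40 % var 0 + var 0 * var 60)) + var 9 * eq (var 40 / var 0) (var 40 % var 0)

/-- The next coefficient in the Faddeev–LeVerrier algorithm. -/
def flCoeff : HExpr :=
  (0 - sum 60 (var 0) (sum 61 (var 0) (read 6 (var 61 + var 0 * var 60) *
    read 7 (var 60 + var 0 * var 61)))) / (var 41 + 1)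

/-- The Faddeev–LeVerrier algorithm for the matrix in the array `6`. -/
def flProg : Program :=
  .seq (fill 7 37 0) (.seq (assign 9 0 1) (forTo 41 0
    (.seq (fill 8 37 flMat) (.seq (fill 7 37 (read 8 (var 40))) (assign 9 0 flCoeff)))))

/-- After `k` rounds the array `7` and the cell `9` hold the two components of `faddeevLeVerrier M
k`. The next matrix is built in the array `8` and then copied, because each of its entries needs a
whole column of the old one. -/
theorem eventually_fl : ∀ᶠ c in atTop, ∀ (w R n : ℕ) (σ : Store)
    (M : Matrix (Fin n) (Fin n) ℤ), Base n w R σ → HoldsMat (σ 6) M →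
    (∀ k ≤ n, (∀ i j, |(faddeevLeVerrier M k).1 i j| ≤ 2 ^ w) ∧
      |(faddeevLeVerrier M k).2| ≤ 2 ^ w) →
    Runs (w * c + 2) (R ^ (c + 9)) flProg σ fun σ' =>
      Same [7, 8, 9, 40, 41] σ σ' ∧ Bdd w σ' ∧ HoldsMat (σ' 7) (faddeevLeVerrier M n).1 ∧
        σ' 9 0 = (faddeevLeVerrier M n).2 := by
  filter_upwards [eventually_fillMat 7 37 (e := 0) rfl rfl, eventually_put 9 (e := 1) rfl,
    eventually_fillMat 8 37 (e := flMat) rfl rfl,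
    eventually_fillMat 7 37 (e := read 8 (var 40)) rfl rfl,
    eventually_put 9 (e := flCoeff) rfl,
    eventually_ge_atTop 10] with c h1 h2 h3 h4 h5 hc w R n σ M hB hM hbd
  have hR := hB.hundred_le
  have hw := hB.pow_le
  have hnR := hB.le
  have hone : (1 : ℤ) ≤ 2 ^ w := one_le_pow₀ (by norm_num)
  apply Runs.of_time
  case h =>
    apply Runs.then (h1 w R n n 0 σ hR hw hB.bdd hB.h37 hB.mul_self_le (fun i j => by simp))
    rintro σ₁ ⟨s1, m1, b1⟩
    apply Runs.then (h2 w R σ₁ hR hw b1 (by simp) (by simpa using hone) (by decide))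
    rintro σ₂ ⟨s2, e2, b2⟩
    have hs2 : Same [7, 8, 9, 40, 41] σ σ₂ := s1.trans s2
    refine (Runs.forTo (K := n) (T := R ^ (c + 6)) (T' := R ^ (c + 8))
      (fun k τ => Same [7, 8, 9, 40, 41] σ τ ∧ Bdd w τ ∧ τ 41 0 = k ∧
        HoldsMat (τ 7) (faddeevLeVerrier M k).1 ∧ τ 9 0 = (faddeevLeVerrier M k).2)
      hc hB.one_le_w hB.self_le_two_pow ?_ ?_ ?_ (loop_time_le hR (by omega) (by omega))).imp le_rfl
      (fun σ' h => ⟨h.1, h.2.1, h.2.2.2⟩)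
    · refine ⟨hs2.set (by simp) _ _, b2.set (by simp) _ _, Store.set_self _ _ _ _, ?_, ?_⟩
      · rw [Store.set_of_ne _ (by decide), s2.get 7]
        exact m1
      · rw [Store.set_of_ne _ (by decide), e2]
        simp [faddeevLeVerrier]
    · rintro k τ - ⟨g1, -, g2, -⟩
      exact ⟨g2, by rw [g1.get 0, hB.h0]⟩
    · rintro k τ hk ⟨g1, g2, g3, g4, g5⟩
      have hBτ := hB.mono g1 g2
      have hMτ : HoldsMat (τ 6) M := by rw [g1.get 6]; exact hM
      apply Runs.of_time
      case h =>
        have p3 := h3 w R n n (faddeevLeVerrier M (k + 1)).1 τ hR hw g2 hBτ.h37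
          hB.mul_self_le fun i j => ⟨by simp [flMat, Store.set_apply, hBτ.h0, show n ≤ R by omega],
            by simp [flMat, Store.set_apply, hBτ.h0, Finset.sum_range,
              faddeevLeVerrier_succ_fst, hMτ _ _, g4 _ _, g5, Fin.ext_iff],
            (hbd (k + 1) (by omega)).1 i j⟩
        apply Runs.then p3
        rintro τ₁ ⟨t1, n1, d1⟩
        have hB1 := hBτ.mono t1 d1
        apply Runs.then (h4 w R n n (faddeevLeVerrier M (k + 1)).1 τ₁ hR hw d1 hB1.h37
          hB.mul_self_le fun i j => ⟨by simp, by simp [Store.set_apply, n1 _ _],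
            (hbd (k + 1) (by omega)).1 i j⟩)
        rintro τ₂ ⟨t2, n2, d2⟩
        have hB2 := hB1.mono t2 d2
        have e41 : τ₂ 41 0 = k := by rw [t2.get 41, t1.get 41, g3]
        have h6 : HoldsMat (τ₂ 6) M := by rw [t2.get 6, t1.get 6]; exact hMτ
        have hval : flCoeff.eval τ₂ = (faddeevLeVerrier M (k + 1)).2 := by
          rw [faddeevLeVerrier_succ_snd]
          simp [flCoeff, Store.set_apply, hB2.h0, Finset.sum_range, h6 _ _, n2 _ _, e41]
        refine (h5 w R τ₂ hR hw d2 ?_ ?_ (by decide)).imp le_rfl fun τ₃ ⟨t3, e3, d3⟩ => ?_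
        · simp [flCoeff, Store.set_apply, hB2.h0, show n ≤ R by omega]
        · rw [hval]; exact (hbd (k + 1) (by omega)).2
        · have hs3 : Same [7, 8, 9, 40, 41] σ τ₃ :=
            ((g1.trans t1 (F'' := [7, 8, 9, 40, 41])).trans t2 (F'' := [7, 8, 9, 40, 41])).trans t3
          refine ⟨by rw [t3.get 41, e41], hs3.set (by simp) _ _,
            d3.set (hB.abs_succ_le (k := k) (by omega)) _ _, by simp, ?_, ?_⟩
          · rw [Store.set_of_ne _ (by decide), t3.get 7]; exact n2
          · rw [Store.set_of_ne _ (by decide), e3, hval]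
      case hT =>
        have := pow_step (a := c + 5) (b := c + 6) hR (by omega)
        have := pow_step (a := c + 1) (b := c + 6) hR (by omega)
        omega
  case hT =>
    have := pow_step (a := c + 8) (b := c + 9) hR (by omega)
    have := pow_step (a := c + 5) (b := c + 9) hR (by omega)
    have := pow_step (a := c + 1) (b := c + 9) hR (by omega)
    omega

end RAM
/-! ### Rows without common divisors -/

section RowGcd

variable {m n : ℕ}

/-- The greatest common divisor of the entries of a row. -/
def rowGcd (A : Matrix (Fin m) (Fin n) ℤ) (i : Fin m) : ℕ :=
  Finset.univ.gcd fun j => (A i j).natAbs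

theorem dvd_rowGcd_iff {A : Matrix (Fin m) (Fin n) ℤ} {i : Fin m} {d : ℕ} :
    d ∣ rowGcd A i ↔ ∀ j, (d : ℤ) ∣ A i j := by
  simp [rowGcd, Finset.dvd_gcd_iff, Int.natCast_dvd]

theorem rowGcd_dvd (A : Matrix (Fin m) (Fin n) ℤ) (i : Fin m) (j : Fin n) :
    (rowGcd A i : ℤ) ∣ A i j :=
  dvd_rowGcd_iff.1 dvd_rfl j

/-- The matrix with the rows divided by their greatest common divisors. -/
def primRows (A : Matrix (Fin m) (Fin n) ℤ) : Matrix (Fin m) (Fin n) ℤ :=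
  Matrix.of fun i j => A i j / rowGcd A i

theorem rowGcd_mul_primRows (A : Matrix (Fin m) (Fin n) ℤ) (i : Fin m) (j : Fin n) :
    (rowGcd A i : ℤ) * primRows A i j = A i j :=
  Int.mul_ediv_cancel' (rowGcd_dvd A i j)

theorem abs_primRows_le (A : Matrix (Fin m) (Fin n) ℤ) (i : Fin m) (j : Fin n) :
    |primRows A i j| ≤ |A i j| :=
  Int.abs_ediv_le_abs _ _

/-- The square matrix of the rows other than `p`. -/
def dropRow (A : Matrix (Fin (n + 1)) (Fin n) ℤ) (p : Fin (n + 1)) : Matrix (Fin n) (Fin n) ℤ :=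
  A.submatrix p.succAbove id

/-- Every term of the Leibniz formula contains an entry of the row `i`. So the gcds are bounded by
nonzero maximal minors, and searching for them by trial is affordable. -/
theorem rowGcd_dvd_det (A : Matrix (Fin (n + 1)) (Fin n) ℤ) {i p : Fin (n + 1)} (h : i ≠ p) :
    (rowGcd A i : ℤ) ∣ (dropRow A p).det := by
  obtain ⟨k, rfl⟩ := Fin.exists_succAbove_eq h
  rw [Matrix.det_apply]
  refine Finset.dvd_sum fun σ _ => Dvd.dvd.mul_left ?_ _
  refine Dvd.dvd.trans ?_ (Finset.dvd_prod_of_mem _ (Finset.mem_univ (σ.symm k)))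
  simpa [dropRow] using rowGcd_dvd A (p.succAbove k) (σ.symm k)

theorem rowGcd_le_abs_det (A : Matrix (Fin (n + 1)) (Fin n) ℤ) {i p : Fin (n + 1)} (h : i ≠ p)
    (hp : (dropRow A p).det ≠ 0) : (rowGcd A i : ℤ) ≤ |(dropRow A p).det| :=
  Int.le_of_dvd (abs_pos.2 hp) ((dvd_abs _ _).2 (rowGcd_dvd_det A h))

theorem rowGcd_pos {A : Matrix (Fin (n + 1)) (Fin n) ℤ} {i p : Fin (n + 1)} (h : i ≠ p)
    (hp : (dropRow A p).det ≠ 0) : 0 < rowGcd A i := by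
  refine Nat.pos_of_ne_zero fun h0 => hp ?_
  have := rowGcd_dvd_det A h
  rwa [h0, Nat.cast_zero, zero_dvd_iff] at this

end RowGcd

namespace RAM

open Filter HExpr

/-- As `k` increases, the candidates `D - k` decrease from an upper bound, so the first common
divisor met is the greatest. -/
theorem sub_scan_eq_rowGcd {m n D : ℕ} {A : Matrix (Fin m) (Fin n) ℤ} {i : Fin m} {f : ℕ → ℤ}
    (h0 : 0 < rowGcd A i) (hD : rowGcd A i ≤ D)
    (hf : ∀ k < D, f k ≠ 0 ↔ ∀ j, A i j % ((D : ℤ) - k) = 0) :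
    ((D : ℤ) - (scan D f D : ℕ)) = rowGcd A i := by
  have hd : ∀ k < D, f k ≠ 0 ↔ D - k ∣ rowGcd A i := by
    intro k hk
    rw [hf k hk, dvd_rowGcd_iff]
    refine forall_congr' fun j => ?_
    rw [← Int.dvd_iff_emod_eq_zero, Nat.cast_sub hk.le]
  have h1 : f (D - rowGcd A i) ≠ 0 := by
    rw [hd _ (by omega), Nat.sub_sub_self hD]
  rcases scan_spec (f := f) (le_refl D) with ⟨-, h2⟩ | ⟨h2, h3, h4⟩
  · exact absurd (h2 _ (by omega)) h1
  · rw [hd _ h2] at h3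
    have h5 := Nat.le_of_dvd h0 h3
    have h6 : ¬ (D - rowGcd A i < scan D f D) := fun h => h1 (h4 _ h)
    omega

/-- The absolute value of an expression. -/
def HExpr.abs (e : HExpr) : HExpr := e * (1 - 2 * lt e 0)

@[simp] theorem HExpr.eval_abs (e : HExpr) (σ : Store) : e.abs.eval σ = |e.eval σ| := by
  simp only [HExpr.abs, eval_mul, eval_sub, eval_ofNat, eval_lt, Nat.cast_zero, Nat.cast_one,
    Nat.cast_ofNat]
  split_ifs with h
  · rw [abs_of_neg h]; ring
  · rw [abs_of_nonneg (not_lt.1 h)]; ring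

@[simp] theorem HExpr.rng_abs (R : ℕ) (e : HExpr) (σ : Store) : e.abs.Rng R σ ↔ e.Rng R σ := by
  simp [HExpr.abs]

/-- The bounds on the integers in the Faddeev–LeVerrier algorithm for the square submatrices. -/
def MinorBound {n : ℕ} (w : ℕ) (A : Matrix (Fin (n + 1)) (Fin n) ℤ) : Prop :=
  ∀ p, ∀ k ≤ n, (∀ i j, |(faddeevLeVerrier (dropRow A p) k).1 i j| ≤ 2 ^ w) ∧
    |(faddeevLeVerrier (dropRow A p) k).2| ≤ 2 ^ w

/-- The entries of the submatrix of the rows other than `p`. -/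
def minorEntry (src : ℕ) (p : HExpr) : HExpr :=
  read src (var 40 % var 0 + var 0 * (var 40 / var 0 + (1 - lt (var 40 / var 0) p)))

/-- The Faddeev–LeVerrier algorithm for the rows other than `p` of the matrix in `src`. -/
def minorProg (src : ℕ) (p : HExpr) : Program := .seq (fill 6 37 (minorEntry src p)) flProg

theorem coe_succAbove {n : ℕ} (q : Fin (n + 1)) (i : Fin n) :
    ((q.succAbove i : ℕ) : ℤ) = (i : ℕ) + (1 - if ((i : ℕ) : ℤ) < (q : ℕ) then 1 else 0) := by
  by_cases h : i.castSucc < q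
  · rw [Fin.succAbove_of_castSucc_lt _ _ h, if_pos (by simpa [Fin.lt_def] using h)]; simp
  · rw [Fin.succAbove_of_le_castSucc _ _ (not_lt.1 h), if_neg (by simpa [Fin.lt_def] using h)]
    simp

theorem eventually_minor (src : ℕ) (p : HExpr) (hok : (minorEntry src p).ok [] = true)
    (hav : (minorEntry src p).avoids 6 = true)
    (hs : src < 60 ∧ src ≠ 5 ∧ src ≠ 40 := by decide) :
    ∀ᶠ c in atTop, ∀ (w R n : ℕ) (σ : Store) (A : Matrix (Fin (n + 1)) (Fin n) ℤ) (q : Fin (n + 1)),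
    Base n w R σ → HoldsMat (σ src) A → MinorBound w A →
    (∀ x, p.eval (σ.set 40 0 x) = (q : ℕ) ∧ p.Rng R (σ.set 40 0 x)) →
    Runs (w * c + 2) (R ^ (c + 10)) (minorProg src p) σ fun σ' =>
      Same [6, 7, 8, 9, 40, 41] σ σ' ∧ Bdd w σ' ∧
        HoldsMat (σ' 7) (faddeevLeVerrier (dropRow A q) n).1 ∧
        σ' 9 0 = (faddeevLeVerrier (dropRow A q) n).2 := by
  filter_upwards [eventually_fillMat 6 37 hok hav, eventually_fl, eventually_ge_atTop 10]
    with c h1 h2 hc w R n σ A q hB hA hbd hq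
  have hR := hB.hundred_le
  have hw := hB.pow_le
  have p1 := h1 w R n n (dropRow A q) σ hR hw hB.bdd hB.h37 hB.mul_self_le fun i j => by
    refine ⟨by simp [minorEntry, (hq _).2], ?_, ?_⟩
    · rw [dropRow, Matrix.submatrix_apply, ← hA, coe_succAbove]
      simp [minorEntry, (hq _).1, Store.set_apply, hB.h0, hs.2.2]
    · rw [dropRow, Matrix.submatrix_apply, ← hA]
      exact hB.bdd _ hs.1 hs.2.1 _
  apply Runs.of_time
  case h =>
    apply Runs.then p1
    rintro σ₁ ⟨s1, m1, b1⟩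
    refine (h2 w R n σ₁ (dropRow A q) (hB.mono s1 b1) m1 (hbd q)).imp le_rfl
      fun σ₂ ⟨s2, b2, m2, e2⟩ => ⟨s1.trans s2, b2, m2, e2⟩
  case hT =>
    have := pow_step (a := c + 5) (b := c + 10) hR (by omega)
    have := pow_step (a := c + 9) (b := c + 10) hR (by omega)
    omega

/-- The program that computes the greatest common divisors of the rows of the matrix in `src`, and
the matrix of the divided rows. -/
def primProg (src g dst : ℕ) : Program :=
  .seq (minorProg src (var 0)) (.seq (assign 35 0 (var 9).abs) (.seq (minorProg src 0)
    (.seq (assign 35 0 (var 35 + (var 9).abs))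
      (.seq (fill g 38 (var 35 - find 60 (var 35) (all 61 (var 0)
          (eq (read src (var 61 + var 0 * var 40) % (var 35 - var 60)) 0))))
        (fill dst 39 (read src (var 40) / read g (var 40 / var 0)))))))

/-- The test whether `var 35 - var 60` divides a row. -/
def rowDvd (src : ℕ) : HExpr :=
  all 61 (var 0) (eq (read src (var 61 + var 0 * var 40) % (var 35 - var 60)) 0)

theorem primProg_eq (src g dst : ℕ) : primProg src g dst =
    .seq (minorProg src (var 0)) (.seq (assign 35 0 (var 9).abs) (.seq (minorProg src 0)
    (.seq (assign 35 0 (var 35 + (var 9).abs))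
      (.seq (fill g 38 (var 35 - find 60 (var 35) (rowDvd src)))
        (fill dst 39 (read src (var 40) / read g (var 40 / var 0))))))) := rfl

/-- The arrays used by `primProg`. -/
def primArrays (g dst : ℕ) : List ℕ := [6, 7, 8, 9, 35, 40, 41, g, dst]

/-- The search for the gcd of a row needs a bound that the program can compute: the sum of the
absolute values of two maximal minors. The factor `2` in the assumption on determinants keeps this
sum at most `R`. -/
theorem eventually_prim (src g dst : ℕ)
    (h₁ : (minorEntry src (var 0)).ok [] = true ∧ (minorEntry src (var 0)).avoids 6 = true)
    (h₂ : (minorEntry src 0).ok [] = true ∧ (minorEntry src 0).avoids 6 = true)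
    (h₃ : (var 35 - find 60 (var 35) (rowDvd src)).ok [] = true ∧
      (var 35 - find 60 (var 35) (rowDvd src)).avoids g = true)
    (h₄ : (read src (var 40) / read g (var 40 / var 0)).ok [] = true ∧
      (read src (var 40) / read g (var 40 / var 0)).avoids dst = true)
    (hs : (src < 60 ∧ src ≠ 5 ∧ src ≠ 40) ∧ (g < 60 ∧ g ≠ 5 ∧ g ≠ 40 ∧ g ≠ 38) ∧
      (dst < 60 ∧ dst ≠ 5 ∧ dst ≠ 40 ∧ dst ≠ 39) ∧ src ∉ primArrays g dst ∧ g ≠ dst ∧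
      (0 ∉ primArrays g dst ∧ 37 ∉ primArrays g dst ∧ 38 ∉ primArrays g dst ∧
        39 ∉ primArrays g dst) := by decide) :
    ∀ᶠ c in atTop, ∀ (w R n : ℕ) (σ : Store) (A : Matrix (Fin (n + 1)) (Fin n) ℤ),
    Base n w R σ → HoldsMat (σ src) A → MinorBound w A →
    (∀ p, (dropRow A p).det ≠ 0 ∧ 2 * |(dropRow A p).det| ≤ R) →
    Runs (w * c + 2) (R ^ (c + 12)) (primProg src g dst) σ fun σ' =>
      Same (primArrays g dst) σ σ' ∧ Bdd w σ' ∧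
        HoldsVec (σ' g) (fun i => (rowGcd A i : ℤ)) ∧ HoldsMat (σ' dst) (primRows A) := by
  obtain ⟨hs1, hs2, hs3, hs4, hs5, hs6⟩ := hs
  filter_upwards [eventually_minor src (var 0) h₁.1 h₁.2 hs1,
    eventually_put 35 (e := (var 9).abs) rfl,
    eventually_minor src 0 h₂.1 h₂.2 hs1,
    eventually_put 35 (e := var 35 + (var 9).abs) rfl,
    eventually_fillVec g 38 h₃.1 h₃.2 hs2,
    eventually_fillMat dst 39 h₄.1 h₄.2 hs3,
    eventually_ge_atTop 10] with c t1 t2 t3 t4 t5 t6 hc w R n σ A hB hA hbd hdet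
  have hR := hB.hundred_le
  have hw := hB.pow_le
  have hdetFL : ∀ p, |(faddeevLeVerrier (dropRow A p) n).2| = |(dropRow A p).det| := fun p => by
    have := abs_faddeevLeVerrier (dropRow A p)
    rwa [Fintype.card_fin] at this
  have h0last : (0 : Fin (n + 1)) ≠ Fin.last n := by
    have := hB.one_le
    rw [Ne, Fin.ext_iff]; simp; omega
  have hother : ∀ i : Fin (n + 1), i ≠ Fin.last n ∨ i ≠ 0 := fun i => by
    by_contra! h
    exact h0last (h.2.symm.trans h.1)
  -- No row is missing from both minors, so every gcd divides one of them and is at most `D`.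
  set D : ℤ := |(dropRow A (Fin.last n)).det| + |(dropRow A 0).det| with hD
  have hd0 := (hdet 0).2
  have hdl := (hdet (Fin.last n)).2
  have hD0 : 0 ≤ D := by positivity
  have hDR : D ≤ R := by omega
  have hgpos : ∀ i, 0 < rowGcd A i := fun i => by
    rcases hother i with h | h
    · exact rowGcd_pos h (hdet _).1
    · exact rowGcd_pos h (hdet _).1
  have hgD : ∀ i, (rowGcd A i : ℤ) ≤ D := fun i => by
    rcases hother i with h | h
    · have := rowGcd_le_abs_det A h (hdet _).1
      have := abs_nonneg (dropRow A 0).det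
      omega
    · have := rowGcd_le_abs_det A h (hdet _).1
      have := abs_nonneg (dropRow A (Fin.last n)).det
      omega
  have hnR := hB.le
  rw [primProg_eq]
  apply Runs.of_time
  case h =>
    apply Runs.then (t1 w R n σ A (Fin.last n) hB hA hbd
      (fun x => ⟨by simp [Store.set_apply, hB.h0], by simp⟩))
    rintro σ₁ ⟨s1, b1, -, e1⟩
    apply Runs.then (t2 w R σ₁ hR hw b1 (by simp) (by
      simp only [eval_abs, eval_var, e1, abs_abs]
      exact (hbd (Fin.last n) n le_rfl).2) (by decide))
    rintro σ₂ ⟨s2, e2, b2⟩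
    have s2' : Same [6, 7, 8, 9, 35, 40, 41] σ σ₂ := s1.trans s2
    have hB2 := hB.mono s2' b2
    have hsrc : ∀ {F : List ℕ} {τ : Store}, F ⊆ primArrays g dst → Same F σ τ →
        HoldsMat (τ src) A := fun hF hτ => by
      rw [hτ src hs1.1 hs1.2.1 (fun h => hs4 (hF h))]; exact hA
    apply Runs.then (t3 w R n σ₂ A 0 hB2 (hsrc (by simp [primArrays]) s2') hbd
      (fun x => ⟨by simp, by simp⟩))
    rintro σ₃ ⟨s3, b3, -, e3⟩
    have s3' : Same [6, 7, 8, 9, 35, 40, 41] σ σ₃ := s2'.trans s3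
    have hval : (var 35 + (var 9).abs).eval σ₃ = D := by
      simp only [eval_add, eval_abs, eval_var, e3, hdetFL, s3.get 35, e2, e1, hD]
    apply Runs.then (t4 w R σ₃ hR hw b3 (by simp) (by
      rw [hval]; exact hB.abs_le_two_pow hD0 hDR) (by decide))
    rintro σ₄ ⟨s4, e4, b4⟩
    rw [hval] at e4
    have s4' : Same [6, 7, 8, 9, 35, 40, 41] σ σ₄ := s3'.trans s4
    have hB4 := hB.mono s4' b4
    have hA4 : HoldsMat (σ₄ src) A := hsrc (by simp [primArrays]) s4'
    obtain ⟨D', hD'⟩ := Int.eq_ofNat_of_zero_le hD0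
    have hg : ∀ i : Fin (n + 1), (var 35 - find 60 (var 35) (rowDvd src)).eval
        (σ₄.set 40 0 (i : ℕ)) = rowGcd A i := fun i => by
      simp only [eval_sub, eval_find, eval_var, Store.set_of_ne σ₄ (show 35 ≠ 40 by decide), e4, hD',
        Int.toNat_natCast]
      refine sub_scan_eq_rowGcd (hgpos i) (by have := hgD i; omega) fun k hk => ?_
      rw [rowDvd, eval_all_ne_zero _ _ _ (by simp [Store.set_apply, hB4.h0])]
      simp [Store.set_apply, hB4.h0, hs1.2.2, e4, hD', show src ≠ 61 by omega,
        show src ≠ 60 by omega]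
      refine ⟨fun h j => ?_, fun h j hj => ?_⟩
      · rw [← hA4]; exact h j j.2
      · have := h ⟨j, hj⟩
        rw [← hA4] at this; exact this
    have hgw : ∀ i, |(rowGcd A i : ℤ)| ≤ 2 ^ w := fun i =>
      hB.abs_le_two_pow (by positivity) ((hgD i).trans hDR)
    have hRle : n + 1 ≤ R ^ 3 := hnR.trans (Nat.le_self_pow (by norm_num) R)
    have hrng : ∀ i : Fin (n + 1), (var 35 - find 60 (var 35) (rowDvd src)).Rng R
        (σ₄.set 40 0 (i : ℕ)) := fun i => by
      simp [rowDvd, Store.set_apply, hB4.h0, e4, hD0, hDR, show n ≤ R by omega]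
    have p5 := t5 w R (n + 1) (fun i => (rowGcd A i : ℤ)) σ₄ hR hw b4
      (by rw [hB4.h38]; push_cast; rfl) hRle fun i => ⟨hrng i, hg i, hgw i⟩
    apply Runs.then p5
    rintro σ₅ ⟨s5, m5, b5⟩
    have hsub : [6, 7, 8, 9, 35, 40, 41] ⊆ primArrays g dst := by simp [primArrays]
    have hsub' : [g, 40] ⊆ primArrays g dst := by simp [primArrays]
    have s5' : Same (primArrays g dst) σ σ₅ := s4'.trans s5 hsub hsub'
    have hB5 := hB.mono s5' b5 hs6
    have hA5 : HoldsMat (σ₅ src) A := hsrc (List.Subset.refl _) s5'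
    have hsub6 : [dst, 40] ⊆ primArrays g dst := by simp [primArrays]
    have p6 := t6 w R (n + 1) n (primRows A) σ₅ hR hw b5
      (by rw [hB5.h39]; push_cast; rfl) hB.succ_mul_le fun i j => by
        refine ⟨by simp, ?_, ?_⟩
        · have := m5 i
          simp only at this
          simp [Store.set_apply, hB5.h0, hs1.2.2, hs2.2.2.1, hA5 _ _, primRows, this]
        · refine (abs_primRows_le A i j).trans ?_
          rw [← hA5 i j]
          exact hB5.bdd _ hs1.1 hs1.2.1 _
    refine p6.imp le_rfl fun σ₆ ⟨s6, m6, b6⟩ => ⟨s5'.trans s6 (List.Subset.refl _) hsub6, b6, ?_, m6⟩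
    rw [s6 g hs2.1 hs2.2.1 (by simp [hs5, hs2.2.2.1])]
    exact m5
  case hT =>
    have := pow_step (a := c + 10) (b := c + 12) hR (by omega)
    have := pow_step (a := c + 5) (b := c + 12) hR (by omega)
    have := pow_step (a := c + 1) (b := c + 12) hR (by omega)
    omega

end RAM
/-! ### Systems with equivalent rows -/

section RowEquiv

open Matrix

variable {n : ℕ}

/-- A system of inequalities `g i * A i x ≤ b i`. -/
structure ScaledSystem (n : ℕ) where
  A : Matrix (Fin (n + 1)) (Fin n) ℤ
  g : Fin (n + 1) → ℤ
  b : Fin (n + 1) → ℤ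

/-- An affine unimodular map `x ↦ U x + x₀` transforms the rows of `S` to those of `T`. -/
def ScaledSystem.RowEquiv (S T : ScaledSystem n) : Prop :=
  ∃ (ρ : Equiv.Perm (Fin (n + 1))) (U : Matrix (Fin n) (Fin n) ℤ) (x₀ : Fin n → ℤ),
    IsUnit U.det ∧ T.A.submatrix ρ id * U = S.A ∧
      ∀ i, (T.A *ᵥ x₀) (ρ i) * (S.g i * T.g (ρ i)) = T.b (ρ i) * S.g i - S.b i * T.g (ρ i)

/-- The rows of `T` that correspond to the rows of `S`: the last row corresponds to `p`, and the
other rows are given by `π`. -/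
def rowMap (p : Fin (n + 1)) (π : Fin n → Fin n) : Fin (n + 1) → Fin (n + 1) :=
  Fin.lastCases p fun i => p.succAbove (π i)

@[simp] theorem rowMap_last (p : Fin (n + 1)) (π : Fin n → Fin n) :
    rowMap p π (Fin.last n) = p := by simp [rowMap]

@[simp] theorem rowMap_castSucc (p : Fin (n + 1)) (π : Fin n → Fin n) (i : Fin n) :
    rowMap p π i.castSucc = p.succAbove (π i) := by simp [rowMap]

theorem rowMap_injective (p : Fin (n + 1)) {π : Fin n → Fin n} (h : π.Injective) :
    (rowMap p π).Injective := by
  intro i j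
  induction i using Fin.lastCases with
  | last =>
    induction j using Fin.lastCases with
    | last => simp
    | cast j => simp [(Fin.succAbove_ne p _).symm]
  | cast i =>
    induction j using Fin.lastCases with
    | last => simp [Fin.succAbove_ne p _]
    | cast j => simp [h.eq_iff]

/-- The differences of the right hand sides of corresponding rows. -/
def shift (S T : ScaledSystem n) (ro : Fin (n + 1) → Fin (n + 1)) (i : Fin (n + 1)) : ℤ :=
  (T.b (ro i) * S.g i - S.b i * T.g (ro i)) / (S.g i * T.g (ro i))

/-- The conditions under which the correspondence of the rows comes from an affine unimodular
map. Here `N` is `δ` times the inverse of the matrix of the rows of `S` other than the last. -/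
structure Verified (S T : ScaledSystem n) (N : Matrix (Fin n) (Fin n) ℤ) (δ δ' : ℕ)
    (p : Fin (n + 1)) (π : Fin n → Fin n) : Prop where
  det_eq : δ' = δ
  inj : π.Injective
  shift_mul : ∀ i, shift S T (rowMap p π) i * (S.g i * T.g (rowMap p π i)) =
    T.b (rowMap p π i) * S.g i - S.b i * T.g (rowMap p π i)
  row_dvd : ∀ r j, (δ : ℤ) ∣ ∑ i, N r i * T.A (p.succAbove (π i)) j
  shift_dvd : ∀ r, (δ : ℤ) ∣ ∑ i : Fin n, N r i * shift S T (rowMap p π) i.castSucc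
  row_last : ∀ j, ∑ i, (S.A (Fin.last n) ᵥ* N) i * T.A (p.succAbove (π i)) j = δ * T.A p j
  shift_last : ∑ i : Fin n, (S.A (Fin.last n) ᵥ* N) i * shift S T (rowMap p π) i.castSucc =
    δ * shift S T (rowMap p π) (Fin.last n)

/-- Soundness. With `P` the matched rows of `T` and `d` the shifts, the divisibilities say that `V =
M⁻¹ P` and `y = M⁻¹ d` are integral. As `|det P| = δ = |det M|`, the matrix `V` is unimodular. The
two conditions on the last row extend `S.A * V` and `S.A y` to it. -/
theorem Verified.rowEquiv {S T : ScaledSystem n} {N : Matrix (Fin n) (Fin n) ℤ} {δ δ' : ℕ}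
    {p : Fin (n + 1)} {π : Fin n → Fin n} (h : Verified S T N δ δ' p π)
    (hN : dropRow S.A (Fin.last n) * N = (δ : ℤ) • 1)
    (hδ : |(dropRow S.A (Fin.last n)).det| = δ) (hδ' : |(dropRow T.A p).det| = δ')
    (h0 : δ ≠ 0) : S.RowEquiv T := by
  have hz : (δ : ℤ) ≠ 0 := by exact_mod_cast h0
  set M := dropRow S.A (Fin.last n) with hM
  set d := shift S T (rowMap p π) with hd
  set P := (dropRow T.A p).submatrix π id with hP
  choose V hV using h.row_dvd
  choose y hy using h.shift_dvd
  have hNP : N * P = (δ : ℤ) • Matrix.of V := by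
    ext r j; simpa [Matrix.mul_apply, hP, dropRow] using hV r j
  have hNd : N *ᵥ (fun i : Fin n => d i.castSucc) = (δ : ℤ) • y := by
    ext r; simpa [Matrix.mulVec, dotProduct] using hy r
  have hMV : M * Matrix.of V = P := by
    have : (δ : ℤ) • (M * Matrix.of V) = (δ : ℤ) • P := by
      rw [← Matrix.mul_smul, ← hNP, ← Matrix.mul_assoc, hN, Matrix.smul_mul, Matrix.one_mul]
    exact smul_right_injective _ hz this
  have hMy : M *ᵥ y = fun i : Fin n => d i.castSucc := by
    have : (δ : ℤ) • (M *ᵥ y) = (δ : ℤ) • fun i : Fin n => d i.castSucc := by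
      rw [← Matrix.mulVec_smul, ← hNd, Matrix.mulVec_mulVec, hN, Matrix.smul_mulVec,
        Matrix.one_mulVec]
    exact smul_right_injective _ hz this
  have hdetP : |P.det| = δ := by
    have hb : Function.Bijective π := Finite.injective_iff_bijective.1 h.inj
    have : P = (dropRow T.A p).submatrix (Equiv.ofBijective π hb) id := rfl
    rw [this, Matrix.det_permute, abs_mul, hδ', h.det_eq]
    simp [← Int.natCast_natAbs]
  have hVu : IsUnit (Matrix.of V).det := by
    have h1 : |M.det| * |(Matrix.of V).det| = |M.det| * 1 := by
      rw [← abs_mul, ← Matrix.det_mul, hMV, hdetP, hδ, mul_one]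
    have h2 := mul_left_cancel₀ (by rw [hδ]; exact hz) h1
    exact Int.isUnit_iff_abs_eq.2 h2
  have hlast : S.A (Fin.last n) ᵥ* Matrix.of V = T.A p := by
    have : (δ : ℤ) • (S.A (Fin.last n) ᵥ* Matrix.of V) = (δ : ℤ) • T.A p := by
      rw [← Matrix.vecMul_smul, ← hNP, ← Matrix.vecMul_vecMul]
      ext j; simpa [Matrix.vecMul, dotProduct, hP, dropRow] using h.row_last j
    exact smul_right_injective _ hz this
  have hlasty : S.A (Fin.last n) ⬝ᵥ y = d (Fin.last n) := by
    have : (δ : ℤ) * (S.A (Fin.last n) ⬝ᵥ y) = δ * d (Fin.last n) := by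
      rw [← smul_eq_mul, ← dotProduct_smul, ← hNd, Matrix.dotProduct_mulVec]
      simpa [dotProduct] using h.shift_last
    exact mul_left_cancel₀ hz this
  have hinj := rowMap_injective p h.inj
  -- `V` carries rows of `S` to rows of `T`, while the affine map acts on points in the opposite
  -- direction. Hence `U = V⁻¹` and `x₀ = V⁻¹ y`.
  refine ⟨Equiv.ofBijective _ (Finite.injective_iff_bijective.1 hinj), (Matrix.of V)⁻¹,
    (Matrix.of V)⁻¹ *ᵥ y, by rwa [Matrix.isUnit_nonsing_inv_det_iff], ?_, ?_⟩
  · have hA : S.A * Matrix.of V = T.A.submatrix (rowMap p π) id := by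
      ext i j
      induction i using Fin.lastCases with
      | last => simpa [Matrix.vecMul, dotProduct, Matrix.mul_apply] using congrFun hlast j
      | cast i =>
        have := congrFun (congrFun hMV i) j
        simpa [Matrix.mul_apply, hP, hM, dropRow] using this
    change T.A.submatrix (rowMap p π) id * _ = _
    rw [← hA, Matrix.mul_assoc, Matrix.mul_nonsing_inv _ hVu, Matrix.mul_one]
  · have hx : ∀ i, (T.A *ᵥ ((Matrix.of V)⁻¹ *ᵥ y)) (rowMap p π i) = d i := by
      intro i
      have e : ∀ k : Fin n → ℤ, (k ᵥ* Matrix.of V) ⬝ᵥ ((Matrix.of V)⁻¹ *ᵥ y) = k ⬝ᵥ y :=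
        fun k => by
          rw [← Matrix.dotProduct_mulVec, Matrix.mulVec_mulVec, Matrix.mul_nonsing_inv _ hVu,
            Matrix.one_mulVec]
      induction i using Fin.lastCases with
      | last => rw [rowMap_last, ← hlasty, ← e, hlast]; rfl
      | cast i =>
        have h1 : S.A i.castSucc ᵥ* Matrix.of V = T.A (p.succAbove (π i)) := by
          ext j
          have := congrFun (congrFun hMV i) j
          simpa [Matrix.vecMul, dotProduct, Matrix.mul_apply, hP, hM, dropRow] using this
        have h2 := congrFun hMy i
        rw [rowMap_castSucc, ← h2]
        calc (T.A *ᵥ ((Matrix.of V)⁻¹ *ᵥ y)) (p.succAbove (π i))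
            = T.A (p.succAbove (π i)) ⬝ᵥ ((Matrix.of V)⁻¹ *ᵥ y) := rfl
          _ = S.A i.castSucc ⬝ᵥ y := by rw [← h1, e]
          _ = _ := by simp [hM, dropRow, Matrix.mulVec, dotProduct]
    intro i
    simp only [Equiv.ofBijective_apply, hx]
    exact h.shift_mul i

/-! ### Matching by rank within classes. -/

/-- `i` is matched with the partner of the same rank in its class. -/
def Ranked (m : Fin n → Fin n → Prop) (i i' : Fin n) : Prop :=
  m i i' ∧ {k | k < i ∧ m k i'}.ncard = {l | l < i' ∧ m i l}.ncard

section Ranked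

variable {E : Fin n → Fin n → Prop} (hE : Equivalence E) (σ : Equiv.Perm (Fin n))
include hE

/-- If `i < j` had the same partner, they would lie over one class, and `j` would have strictly more
predecessors there than `i`; but both numbers equal the rank of the partner. -/
theorem injective_of_ranked {π : Fin n → Fin n}
    (hπ : ∀ i, Ranked (fun i i' => E (σ i) i') i (π i)) : π.Injective := by
  have key : ∀ i j, i < j → π i ≠ π j := by
    intro i j hij h
    have h1 := hπ i
    have h2 := hπ j
    rw [← h] at h2
    have h3 : {l | l < π i ∧ E (σ j) l} = {l | l < π i ∧ E (σ i) l} := by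
      ext l
      refine and_congr_right fun _ => ⟨fun hl => ?_, fun hl => ?_⟩
      · exact hE.trans h1.1 (hE.trans (hE.symm h2.1) hl)
      · exact hE.trans h2.1 (hE.trans (hE.symm h1.1) hl)
    have h4 := h2.2
    rw [h3, ← h1.2] at h4
    have h5 : {k | k < i ∧ E (σ k) (π i)} ⊂ {k | k < j ∧ E (σ k) (π i)} :=
      ⟨fun k hk => ⟨hk.1.trans hij, hk.2⟩, fun hs => (hs ⟨hij, h1.1⟩).1.false⟩
    exact (Set.ncard_lt_ncard h5 (Set.toFinite _)).ne' h4
  intro i j h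
  rcases lt_trichotomy i j with hij | hij | hij
  · exact absurd h (key i j hij)
  · exact hij
  · exact absurd h.symm (key j i hij)

/-- The bijection `σ` shows that each class has as many sources as members. The number `r` of
earlier sources is therefore a valid position in the sorted class. -/
theorem exists_ranked (i : Fin n) : ∃ i', Ranked (fun i i' => E (σ i) i') i i' := by
  classical
  set C := Finset.univ.filter fun l => E (σ i) l with hC
  set r := (Finset.univ.filter fun k => k < i ∧ E (σ i) (σ k)).card with hr
  have hrC : r < C.card := by
    have h1 : (Finset.univ.filter fun k => k < i ∧ E (σ i) (σ k)) ⊂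
        Finset.univ.filter fun k => E (σ i) (σ k) := by
      rw [Finset.ssubset_iff_of_subset (fun k => by simp +contextual)]
      exact ⟨i, by simp [hE.refl]⟩
    refine (Finset.card_lt_card h1).trans_eq ?_
    refine Finset.card_bij (fun k _ => σ k) (by simp [hC]) (fun _ _ _ _ h => σ.injective h) ?_
    intro l hl
    exact ⟨σ.symm l, by simpa [hC] using hl, by simp⟩
  set f := C.orderEmbOfFin rfl with hf
  have hfC : ∀ x, E (σ i) (f x) := fun x =>
    (Finset.mem_filter.1 (C.orderEmbOfFin_mem rfl x)).2
  have hmem := hfC ⟨r, hrC⟩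
  refine ⟨f ⟨r, hrC⟩, hmem, ?_⟩
  have e1 : {k | k < i ∧ E (σ k) (f ⟨r, hrC⟩)}.ncard = r := by
    refine Eq.trans ?_ (Set.ncard_coe_finset _)
    congr 1
    ext k
    simp only [Set.mem_ofPred_eq, Finset.coe_filter, Finset.mem_univ, true_and]
    exact and_congr_right fun _ => ⟨fun h => hE.trans hmem (hE.symm h),
      fun h => hE.trans (hE.symm h) hmem⟩
  have e2 : {l | l < f ⟨r, hrC⟩ ∧ E (σ i) l} = f '' Set.Iio ⟨r, hrC⟩ := by
    ext l
    simp only [Set.mem_ofPred_eq, Set.mem_image, Set.mem_Iio]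
    constructor
    · rintro ⟨h1, h2⟩
      have : l ∈ Set.range f := by
        rw [hf, Finset.range_orderEmbOfFin]; simpa [hC] using h2
      obtain ⟨x, rfl⟩ := this
      exact ⟨x, f.lt_iff_lt.1 h1, rfl⟩
    · rintro ⟨x, hx, rfl⟩
      exact ⟨f.lt_iff_lt.2 hx, hfC x⟩
  rw [e1, e2, Set.ncard_image_of_injective _ f.injective, ← Finset.coe_Iio, Set.ncard_coe_finset]
  simp

end Ranked

/-! ### Codes, similarity of rows, and completeness of the test. -/

/-- The digits of `c` in base `δ` are the coefficients of a combination of the columns `x j` of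
`N`, for `j < s`, modulo `δ`. -/
def codeSum (N : Matrix (Fin n) (Fin n) ℤ) (δ s : ℕ) (x : ℕ → Fin n) (c : ℕ) (r : Fin n) : ℤ :=
  (∑ j ∈ Finset.range s, ((c / δ ^ j % δ : ℕ) : ℤ) * N r (x j)) % δ

/-- The row `i` of `S` and the row `i'` of `T` other than `p` look alike. -/
def LooksLike (S T : ScaledSystem n) (N N' : Matrix (Fin n) (Fin n) ℤ) (δ s : ℕ) (x : ℕ → Fin n)
    (code : Fin n → ℕ) (p : Fin (n + 1)) (i i' : Fin n) : Prop :=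
  (∀ r, (δ : ℤ) ∣ codeSum N' δ s x (code i) r - N' r i') ∧
    (S.A (Fin.last n) ᵥ* N) i = (T.A p ᵥ* N') i' ∧
    S.g i.castSucc * T.g (p.succAbove i') ∣
      T.b (p.succAbove i') * S.g i.castSucc - S.b i.castSucc * T.g (p.succAbove i')

/-- The hypothesis says that `b' / g' - b / g` is an integer. The fractional parts `r / g` and `r' /
g'` lie in `[0, 1)` and differ by an integer, so they are equal, and only the floors contribute. -/
theorem Int.ediv_eq_of_dvd_cross {b g b' g' : ℤ} (hg : 0 < g) (hg' : 0 < g')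
    (h : g * g' ∣ b' * g - b * g') : b' * g - b * g' = (b' / g' - b / g) * (g * g') := by
  obtain ⟨k, hk⟩ := h
  have h1 := Int.emod_add_mul_ediv b g
  have h2 := Int.emod_add_mul_ediv b' g'
  have h3 := Int.emod_nonneg b hg.ne'
  have h4 := Int.emod_nonneg b' hg'.ne'
  have h5 := Int.emod_lt_of_pos b hg
  have h6 := Int.emod_lt_of_pos b' hg'
  set q := b / g
  set q' := b' / g'
  set r := b % g
  set r' := b' % g'
  have e : r' * g - r * g' = (k - (q' - q)) * (g * g') := by
    rw [← h1, ← h2] at hk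
    linear_combination hk
  have hgg : 0 < g * g' := mul_pos hg hg'
  have u1 : r' * g - r * g' < g * g' := by nlinarith
  have u2 : -(g * g') < r' * g - r * g' := by nlinarith
  rw [e] at u1 u2
  have : k - (q' - q) = 0 := by
    have : k - (q' - q) < 1 := by nlinarith
    have : -1 < k - (q' - q) := by nlinarith
    omega
  rw [hk, show k = q' - q by omega]
  ring

/-- Over `ℤ` the factor `A` need not be invertible. It is cancelled on the left by its adjugate, as
its determinant is nonzero. -/
theorem Matrix.mul_eq_smul_one_comm {A B : Matrix (Fin n) (Fin n) ℤ} {δ : ℤ} (hδ : δ ≠ 0)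
    (h : A * B = δ • 1) : B * A = δ • 1 := by
  have hA : A.det ≠ 0 := fun h0 => by
    have := congrArg Matrix.det h
    rw [Matrix.det_mul, h0, zero_mul, Matrix.det_smul, Matrix.det_one, mul_one] at this
    exact pow_ne_zero _ hδ this.symm
  have h0 : A * (B * A) = A * (δ • 1) := by
    rw [← Matrix.mul_assoc, h, Matrix.smul_mul, Matrix.one_mul, Matrix.mul_smul, Matrix.mul_one]
  have h1 := congrArg (A.adjugate * ·) h0
  simp only [← Matrix.mul_assoc, Matrix.adjugate_mul] at h1
  simp only [Matrix.smul_mul, Matrix.one_mul] at h1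
  exact smul_right_injective _ hA h1

theorem Matrix.abs_det_submatrix_perm (A : Matrix (Fin n) (Fin n) ℤ) (σ : Equiv.Perm (Fin n)) :
    |(A.submatrix σ id).det| = |A.det| := by
  rw [Matrix.det_permute, abs_mul]
  rcases Int.units_eq_one_or (Equiv.Perm.sign σ) with h | h <;> simp [h]

/-- The divisibility expresses that `b₂ / g₂ - b₁ / g₁` is an integer, so it is transitive; the
middle denominator is cancelled. -/
theorem cross_trans {b₁ g₁ b₂ g₂ b₃ g₃ : ℤ} (h2 : g₂ ≠ 0) (h12 : g₁ * g₂ ∣ b₂ * g₁ - b₁ * g₂)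
    (h23 : g₂ * g₃ ∣ b₃ * g₂ - b₂ * g₃) : g₁ * g₃ ∣ b₃ * g₁ - b₁ * g₃ := by
  obtain ⟨k, hk⟩ := h12
  obtain ⟨l, hl⟩ := h23
  refine ⟨k + l, mul_left_cancel₀ h2 ?_⟩
  linear_combination g₁ * hl + g₃ * hk

theorem cross_symm {b₁ g₁ b₂ g₂ : ℤ} (h : g₁ * g₂ ∣ b₂ * g₁ - b₁ * g₂) :
    g₂ * g₁ ∣ b₁ * g₂ - b₂ * g₁ := by
  rw [mul_comm, ← neg_sub, dvd_neg]; exact h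

/-- Completeness. The true bijection gives `p` and `σ`. Whenever `x` gives the images of the
generators under `σ`, looking alike means lying in the class of `σ i`. So any rank matching `π`
replaces `σ i` by a row of the same class, and this changes each sum in `Verified` by a multiple of
`δ` or not at all. -/
theorem ScaledSystem.RowEquiv.exists_verified {S T : ScaledSystem n} (h : S.RowEquiv T)
    (hSg : ∀ i, 0 < S.g i) (hTg : ∀ i, 0 < T.g i) {N : Matrix (Fin n) (Fin n) ℤ} {δ : ℕ}
    {N' : Fin (n + 1) → Matrix (Fin n) (Fin n) ℤ} {δ' : Fin (n + 1) → ℕ}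
    (hN : dropRow S.A (Fin.last n) * N = (δ : ℤ) • 1)
    (hN' : ∀ p, dropRow T.A p * N' p = (δ' p : ℤ) • 1)
    (hδ : |(dropRow S.A (Fin.last n)).det| = δ) (hδ' : ∀ p, |(dropRow T.A p).det| = δ' p)
    (h0 : δ ≠ 0) {s : ℕ} {gen : ℕ → Fin n} {code : Fin n → ℕ}
    (hcode : ∀ i r, (δ : ℤ) ∣ codeSum N δ s gen (code i) r - N r i) :
    ∃ (p : Fin (n + 1)) (σ : Equiv.Perm (Fin n)), ∀ x : ℕ → Fin n,
      (∀ j < s, x j = σ (gen j)) → ∀ π : Fin n → Fin n,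
      (∀ i, (∃ i', Ranked (LooksLike S T N (N' p) δ s x code p) i i') →
        Ranked (LooksLike S T N (N' p) δ s x code p) i (π i)) →
      Verified S T N δ (δ' p) p π := by
  obtain ⟨ρ, U, x₀, hU, hA, hb⟩ := h
  have hz : (δ : ℤ) ≠ 0 := by exact_mod_cast h0
  set p := ρ (Fin.last n) with hp
  have hσ : ∀ i : Fin n, ∃ k, p.succAbove k = ρ i.castSucc := fun i =>
    Fin.exists_succAbove_eq fun h => (Fin.castSucc_lt_last i).ne (ρ.injective h)
  choose σ₀ hσ₀ using hσ
  have hσi : σ₀.Injective := fun i j hij => by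
    have := congrArg p.succAbove hij
    rw [hσ₀, hσ₀] at this
    exact Fin.castSucc_injective n (ρ.injective this)
  obtain ⟨σ, rfl⟩ : ∃ σ : Equiv.Perm (Fin n), ⇑σ = σ₀ :=
    ⟨Equiv.ofBijective _ (Finite.injective_iff_bijective.1 hσi), rfl⟩
  set M' := dropRow T.A p with hM'
  have hMU : M'.submatrix σ id * U = dropRow S.A (Fin.last n) := by
    ext i j
    have := congrFun (congrFun hA i.castSucc) j
    simpa [Matrix.mul_apply, hM', dropRow, hσ₀] using this
  have hpU : T.A p ᵥ* U = S.A (Fin.last n) := by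
    ext j
    have := congrFun (congrFun hA (Fin.last n)) j
    simpa [Matrix.mul_apply, Matrix.vecMul, dotProduct] using this
  have hdet : δ' p = δ := by
    have h1 : |(dropRow S.A (Fin.last n)).det| = |M'.det| := by
      rw [← hMU, Matrix.det_mul, abs_mul, Matrix.abs_det_submatrix_perm, Int.isUnit_iff_abs_eq.1 hU,
        mul_one]
    rw [hδ, hδ'] at h1
    exact_mod_cast h1.symm
  have hN'p : M' * N' p = (δ : ℤ) • 1 := by rw [hN', hdet]
  have e3 : N' p * M' = (δ : ℤ) • 1 := Matrix.mul_eq_smul_one_comm hz hN'p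
  -- From `M' σ * U = M`: both sides become `δ` times a permuted identity after multiplication by
  -- `M'`. Hence `U` carries relations among the columns of `N` modulo `δ` to relations among their
  -- images.
  have hNN : (N' p).submatrix id σ = U * N := by
    have e1 : M' * (N' p).submatrix id σ = (δ : ℤ) • (1 : Matrix (Fin n) (Fin n) ℤ).submatrix id σ := by
      ext i j
      exact congrFun (congrFun hN'p i) (σ j)
    have e2 : M' * (U * N) = (δ : ℤ) • (1 : Matrix (Fin n) (Fin n) ℤ).submatrix id σ := by
      have : (M'.submatrix σ id * U) * N = (δ : ℤ) • 1 := by rw [hMU, hN]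
      rw [Matrix.mul_assoc] at this
      ext i j
      have h3 := congrFun (congrFun this (σ.symm i)) j
      simp only [Matrix.mul_apply, Matrix.submatrix_apply, id, Equiv.apply_symm_apply,
        Matrix.smul_apply, Matrix.one_apply] at h3 ⊢
      rw [h3]
      simp [Equiv.symm_apply_eq]
    have e4 : (N' p * M') * (N' p).submatrix id σ = (N' p * M') * (U * N) := by
      rw [Matrix.mul_assoc, Matrix.mul_assoc, e1, e2]
    rw [e3, Matrix.smul_mul, Matrix.smul_mul, Matrix.one_mul, Matrix.one_mul] at e4
    exact smul_right_injective _ hz e4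
  have hNNi : ∀ r i, N' p r (σ i) = ∑ k, U r k * N k i := fun r i => by
    have := congrFun (congrFun hNN r) i
    simpa [Matrix.mul_apply] using this
  set lam' := T.A p ᵥ* N' p with hlam'
  have hlam : ∀ i, (S.A (Fin.last n) ᵥ* N) i = lam' (σ i) := fun i => by
    rw [← hpU, Matrix.vecMul_vecMul, ← hNN]; rfl
  refine ⟨p, σ, fun x hx π hπ => ?_⟩
  -- The code of column `i`, evaluated at the images of the generators, gives column `σ i` of `N'`
  -- modulo `δ`.
  have hcs : ∀ i r, (δ : ℤ) ∣ codeSum (N' p) δ s x (code i) r - N' p r (σ i) := by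
    intro i r
    have h1 : codeSum (N' p) δ s x (code i) r ≡
        ∑ k, U r k * codeSum N δ s gen (code i) k [ZMOD δ] := by
      refine (Int.mod_modEq _ _).trans ?_
      have h2 : ∑ j ∈ Finset.range s, ((code i / δ ^ j % δ : ℕ) : ℤ) * N' p r (x j) =
          ∑ k, U r k * ∑ j ∈ Finset.range s, ((code i / δ ^ j % δ : ℕ) : ℤ) * N k (gen j) := by
        simp_rw [Finset.mul_sum]
        rw [Finset.sum_comm]
        refine Finset.sum_congr rfl fun j hj => ?_
        rw [hx j (Finset.mem_range.1 hj), hNNi, Finset.mul_sum]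
        exact Finset.sum_congr rfl fun k _ => by ring
      rw [h2, Int.modEq_iff_dvd, ← Finset.sum_sub_distrib]
      refine Finset.dvd_sum fun k _ => ?_
      rw [← mul_sub]
      exact Dvd.dvd.mul_left (Int.modEq_iff_dvd.1 (Int.mod_modEq _ _).symm) _
    have h3 : ∑ k, U r k * codeSum N δ s gen (code i) k ≡ N' p r (σ i) [ZMOD δ] := by
      rw [hNNi, Int.modEq_comm, Int.modEq_iff_dvd, ← Finset.sum_sub_distrib]
      refine Finset.dvd_sum fun k _ => ?_
      rw [← mul_sub]
      exact Dvd.dvd.mul_left (hcode i k) _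
    exact Int.modEq_iff_dvd.1 (h1.trans h3).symm
  set E : Fin n → Fin n → Prop := fun l l' => (∀ r, (δ : ℤ) ∣ N' p r l - N' p r l') ∧
    lam' l = lam' l' ∧ T.g (p.succAbove l) * T.g (p.succAbove l') ∣
      T.b (p.succAbove l') * T.g (p.succAbove l) - T.b (p.succAbove l) * T.g (p.succAbove l') with hE
  have hEq : Equivalence E := by
    refine ⟨fun l => ⟨fun r => by simp, rfl, by simp⟩, fun h => ⟨fun r => ?_, h.2.1.symm,
      cross_symm h.2.2⟩, fun h h' => ⟨fun r => ?_, h.2.1.trans h'.2.1,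
      cross_trans (hTg _).ne' h.2.2 h'.2.2⟩⟩
    · exact (dvd_sub_comm).1 (h.1 r)
    · simpa using dvd_add (h.1 r) (h'.1 r)
  have hbi : ∀ i : Fin n, (T.A *ᵥ x₀) (p.succAbove (σ i)) *
      (S.g i.castSucc * T.g (p.succAbove (σ i))) = T.b (p.succAbove (σ i)) * S.g i.castSucc -
        S.b i.castSucc * T.g (p.succAbove (σ i)) := fun i => by
    rw [hσ₀]; exact hb i.castSucc
  have hLE : LooksLike S T N (N' p) δ s x code p = fun i i' => E (σ i) i' := by
    ext i i'
    have hc : S.g i.castSucc * T.g (p.succAbove (σ i)) ∣ T.b (p.succAbove (σ i)) * S.g i.castSucc -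
        S.b i.castSucc * T.g (p.succAbove (σ i)) := ⟨_, by rw [← hbi, mul_comm]⟩
    refine and_congr (forall_congr' fun r => ?_) (and_congr (by rw [hlam]) ⟨fun h => ?_, fun h => ?_⟩)
    · rw [← dvd_add_right (hcs i r) (c := N' p r (σ i) - N' p r i'), sub_add_sub_cancel]
    · exact cross_trans (hSg _).ne' (cross_symm hc) h
    · exact cross_trans (hTg _).ne' hc h
  rw [hLE] at hπ
  have hπ' := fun i => hπ i (exists_ranked hEq σ i)
  have hinj := injective_of_ranked hEq σ hπ'
  obtain ⟨π, rfl⟩ : ∃ π₀ : Equiv.Perm (Fin n), ⇑π₀ = π :=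
    ⟨Equiv.ofBijective _ (Finite.injective_iff_bijective.1 hinj), rfl⟩
  have hEi : ∀ i, E (σ i) (π i) := fun i => (hπ' i).1
  -- Within a class the quotients `b / g` have equal fractional parts, so the shift along `π` is
  -- that along `σ` plus a difference of floors.
  set z : Fin n → ℤ := fun l => T.b (p.succAbove l) / T.g (p.succAbove l) with hzdef
  have hcast : ∀ i : Fin n,
      T.b (p.succAbove (π i)) * S.g i.castSucc - S.b i.castSucc * T.g (p.succAbove (π i)) =
        (z (π i) - z (σ i) + (M' *ᵥ x₀) (σ i)) * (S.g i.castSucc * T.g (p.succAbove (π i))) := by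
    intro i
    have h1 := Int.ediv_eq_of_dvd_cross (hTg _) (hTg _) (hEi i).2.2
    have h2 := hbi i
    have h3 : (M' *ᵥ x₀) (σ i) = (T.A *ᵥ x₀) (p.succAbove (σ i)) := rfl
    rw [h3]
    refine mul_left_cancel₀ (hTg (p.succAbove (σ i))).ne' ?_
    linear_combination S.g i.castSucc * h1 - T.g (p.succAbove (π i)) * h2
  have hshift : ∀ i : Fin n, shift S T (rowMap p π) i.castSucc =
      z (π i) - z (σ i) + (M' *ᵥ x₀) (σ i) := fun i => by
    rw [shift, rowMap_castSucc, hcast,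
      Int.mul_ediv_cancel _ (mul_pos (hSg _) (hTg _)).ne']
  have hlast := hb (Fin.last n)
  have hshl : shift S T (rowMap p π) (Fin.last n) = (T.A *ᵥ x₀) p := by
    rw [shift, rowMap_last, ← hlast, Int.mul_ediv_cancel _ (mul_pos (hSg _) (hTg _)).ne']
  -- Since `U` is unimodular, divisibility of `N w` by `δ` can be tested on `U N w`, where the
  -- columns are those of `N'` permuted by `σ`.
  have hkey : ∀ w : Fin n → ℤ, (∀ r, (δ : ℤ) ∣ ∑ i, N' p r (σ i) * w i) →
      ∀ r, (δ : ℤ) ∣ ∑ i, N r i * w i := by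
    intro w hw
    choose y hy using hw
    have h1 : U *ᵥ (N *ᵥ w) = (δ : ℤ) • y := by
      rw [Matrix.mulVec_mulVec, ← hNN]
      ext r; simpa [Matrix.mulVec, dotProduct] using hy r
    have h2 : N *ᵥ w = (δ : ℤ) • (U⁻¹ *ᵥ y) := by
      rw [← Matrix.mulVec_smul, ← h1, Matrix.mulVec_mulVec, Matrix.nonsing_inv_mul _ hU,
        Matrix.one_mulVec]
    intro r
    exact ⟨(U⁻¹ *ᵥ y) r, congrFun h2 r⟩
  -- After reindexing by `π` the sums differ by terms with the factor `N' r (σ i) - N' r (π i)`,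
  -- which `δ` divides within a class.
  have hmove : ∀ (w : Fin n → ℤ) (r), (δ : ℤ) ∣ ∑ i, N' p r (σ i) * w (π i) - ∑ l, N' p r l * w l := by
    intro w r
    rw [← Equiv.sum_comp π (fun l => N' p r l * w l), ← Finset.sum_sub_distrib]
    refine Finset.dvd_sum fun i _ => ?_
    rw [← sub_mul]
    exact ((hEi i).1 r).mul_right _
  have hNM : ∀ (w : Fin n → ℤ) (r), ∑ l, N' p r l * (M' *ᵥ w) l = δ * w r := fun w r => by
    have : N' p *ᵥ (M' *ᵥ w) = (δ : ℤ) • w := by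
      rw [Matrix.mulVec_mulVec, e3, Matrix.smul_mulVec, Matrix.one_mulVec]
    exact congrFun this r
  have hlamM : ∀ (w : Fin n → ℤ), ∑ l, lam' l * (M' *ᵥ w) l = δ * (T.A *ᵥ w) p := fun w => by
    have : lam' ⬝ᵥ (M' *ᵥ w) = δ * (T.A p ⬝ᵥ w) := by
      rw [hlam', ← Matrix.dotProduct_mulVec, Matrix.mulVec_mulVec, e3, Matrix.smul_mulVec,
        Matrix.one_mulVec, dotProduct_smul, smul_eq_mul]
    exact this
  have hlamπ : ∀ w : Fin n → ℤ, ∑ i, (S.A (Fin.last n) ᵥ* N) i * w (π i) = ∑ l, lam' l * w l := by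
    intro w
    rw [← Equiv.sum_comp π (fun l => lam' l * w l)]
    exact Finset.sum_congr rfl fun i _ => by rw [hlam, (hEi i).2.1]
  have hcol : ∀ (j : Fin n) (l : Fin n), T.A (p.succAbove l) j = (M' *ᵥ Pi.single j 1) l :=
    fun j l => by simp [hM', dropRow]
  refine ⟨hdet, hinj, ?_, fun r j => ?_, fun r => ?_, fun j => ?_, ?_⟩
  · intro i
    induction i using Fin.lastCases with
    | last => rw [hshl, rowMap_last]; exact hlast
    | cast i => rw [hshift, rowMap_castSucc, hcast]
  · refine hkey _ (fun r => ?_) r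
    have h1 := hmove (M' *ᵥ Pi.single j 1) r
    rw [hNM] at h1
    simp_rw [hcol]
    exact (dvd_sub_left (dvd_mul_right _ _)).1 h1
  · refine hkey _ (fun r => ?_) r
    simp_rw [hshift, mul_add, mul_sub, Finset.sum_add_distrib, Finset.sum_sub_distrib]
    rw [Equiv.sum_comp σ (fun l => N' p r l * z l), Equiv.sum_comp σ (fun l => N' p r l * (M' *ᵥ x₀) l),
      hNM]
    exact dvd_add (hmove z r) (dvd_mul_right _ _)
  · simp_rw [hcol]
    rw [hlamπ, hlamM]
    simp
  · simp_rw [hshift, hshl, mul_add, mul_sub, Finset.sum_add_distrib, Finset.sum_sub_distrib]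
    rw [hlamπ z]
    simp_rw [hlam]
    rw [Equiv.sum_comp σ (fun l => lam' l * z l), Equiv.sum_comp σ (fun l => lam' l * (M' *ᵥ x₀) l),
      hlamM, sub_self, zero_add]

end RowEquiv
/-! ### Simplices -/

section Simplex

open Matrix Filter Topology

variable {n : ℕ}

/-- The value of the `i`-th inequality at `x`. -/
def IneqSystem.slack (S : IneqSystem n) (i : Fin (n + 1)) (x : Fin n → ℝ) : ℝ :=
  S.b i - ∑ j, (S.A i j : ℝ) * x j

theorem IneqSystem.mem_toSet {S : IneqSystem n} {x : Fin n → ℝ} :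
    x ∈ S.toSet ↔ ∀ i, 0 ≤ S.slack i x := by
  simp [IneqSystem.toSet, IneqSystem.slack, Pi.le_def, Matrix.mulVec, dotProduct]

theorem IneqSystem.slack_sum (S : IneqSystem n) (i : Fin (n + 1)) {ι : Type*} [Fintype ι]
    (w : ι → ℝ) (hw : ∑ k, w k = 1) (v : ι → Fin n → ℝ) :
    S.slack i (∑ k, w k • v k) = ∑ k, w k * S.slack i (v k) := by
  simp only [IneqSystem.slack, mul_sub, Finset.sum_sub_distrib, ← Finset.sum_mul, hw, one_mul,
    Finset.sum_apply, Pi.smul_apply, smul_eq_mul, Finset.mul_sum]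
  congr 1
  rw [Finset.sum_comm]
  exact Finset.sum_congr rfl fun k _ => Finset.sum_congr rfl fun j _ => by ring

theorem IsSimplex.exists_affineBasis {P : Set (Fin n → ℝ)} (h : IsSimplex P) :
    ∃ B : AffineBasis (Fin (n + 1)) ℝ (Fin n → ℝ), P = {x | ∀ k, 0 ≤ B.coord k x} := by
  obtain ⟨v, hv, rfl⟩ := h
  have ht : affineSpan ℝ (Set.range v) = ⊤ := by
    rw [hv.affineSpan_eq_top_iff_card_eq_finrank_add_one]; simp
  exact ⟨⟨v, hv, ht⟩, (⟨v, hv, ht⟩ : AffineBasis (Fin (n + 1)) ℝ (Fin n → ℝ)).convexHull_eq_nonneg_coord⟩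

theorem AffineBasis.exists_coord_eq (B : AffineBasis (Fin (n + 1)) ℝ (Fin n → ℝ))
    (w : Fin (n + 1) → ℝ) (hw : ∑ k, w k = 1) (k : Fin (n + 1)) :
    B.coord k (∑ l, w l • B l) = w k := by
  rw [← Finset.affineCombination_eq_linear_combination _ _ _ hw]
  exact B.coord_apply_combination_of_mem (Finset.mem_univ k) hw

/-- The facets of a simplex given by inequalities. -/
theorem IneqSystem.exists_perm [NeZero n] {S : IneqSystem n}
    (B : AffineBasis (Fin (n + 1)) ℝ (Fin n → ℝ)) (hB : S.toSet = {x | ∀ k, 0 ≤ B.coord k x}) :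
    ∃ (κ : Equiv.Perm (Fin (n + 1))) (c : Fin (n + 1) → ℝ), (∀ i, 0 < c i) ∧
      ∀ i x, S.slack i x = c i * B.coord (κ i) x := by
  have hnn : ∀ i k, 0 ≤ S.slack i (B k) := fun i k => by
    have : B k ∈ S.toSet := by
      rw [hB]; intro l; rw [B.coord_apply]; split_ifs <;> norm_num
    exact mem_toSet.1 this i
  -- Each vertex must have an inequality that is strict there and tight at all other vertices.
  -- Otherwise the facet opposite to the vertex could be crossed without violating any inequality.
  have hfacet : ∀ k, ∃ i, 0 < S.slack i (B k) ∧ ∀ l ≠ k, S.slack i (B l) = 0 := by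
    intro k
    by_contra! hcon
    have hn : (0 : ℝ) < n := by exact_mod_cast Nat.pos_of_ne_zero (NeZero.ne n)
    -- Barycentric weights of a point just beyond the barycentre of the facet opposite to `B k`;
    -- they sum to `-(n ε) + n (1 / n + ε) = 1`.
    set wt : ℝ → Fin (n + 1) → ℝ := fun ε l => if l = k then -(n * ε) else 1 / n + ε with hwt
    have hwk : ∀ ε, wt ε k = -(n * ε) := fun ε => by simp [hwt]
    have hwl : ∀ ε, ∀ l ∈ Finset.univ.erase k, wt ε l = 1 / n + ε := fun ε l hl => by
      simp [hwt, Finset.ne_of_mem_erase hl]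
    have hsum : ∀ (ε : ℝ) (a : Fin (n + 1) → ℝ), ∑ l, wt ε l * a l =
        -(n * ε) * a k + ∑ l ∈ Finset.univ.erase k, (1 / n + ε) * a l := fun ε a => by
      rw [← Finset.add_sum_erase _ _ (Finset.mem_univ k), hwk]
      congr 1
      exact Finset.sum_congr rfl fun l hl => by rw [hwl ε l hl]
    have hone : ∀ ε, ∑ l, wt ε l = 1 := fun ε => by
      have := hsum ε 1
      simp only [Pi.one_apply, mul_one, Finset.sum_const, Finset.card_erase_of_mem,
        Finset.mem_univ, Finset.card_univ, Fintype.card_fin, nsmul_eq_mul] at this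
      rw [this, add_tsub_cancel_right]
      field_simp
      ring
    have hev : ∀ i, ∀ᶠ ε in 𝓝[>] (0 : ℝ), 0 ≤ ∑ l, wt ε l * S.slack i (B l) := by
      intro i
      have hrest : ∀ ε > (0 : ℝ), ∀ l ∈ Finset.univ.erase k, 0 ≤ (1 / n + ε) * S.slack i (B l) :=
        fun ε hε l _ => mul_nonneg (by positivity) (hnn i l)
      rcases (hnn i k).eq_or_lt with h0 | hpos
      · filter_upwards [self_mem_nhdsWithin] with ε hε
        rw [hsum, ← h0, mul_zero, zero_add]
        exact Finset.sum_nonneg (hrest ε hε)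
      · obtain ⟨l, hl, hl0⟩ := hcon i hpos
        have hlpos : 0 < S.slack i (B l) := (hnn i l).lt_of_ne' hl0
        -- Below this threshold the loss `n ε * slack (B k)` is covered by the share `1 / n` of
        -- another vertex `B l` with positive slack.
        have hc : 0 < S.slack i (B l) / (n * n * S.slack i (B k)) := by positivity
        filter_upwards [Ioo_mem_nhdsGT hc] with ε hε
        rw [hsum]
        have h1 := Finset.single_le_sum (hrest ε hε.1) (Finset.mem_erase.2 ⟨hl, Finset.mem_univ l⟩)
        have h2 := (lt_div_iff₀ (by positivity)).1 hε.2
        have h3 : n * ε * S.slack i (B k) ≤ 1 / n * S.slack i (B l) := by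
          rw [div_mul_eq_mul_div, one_mul, le_div_iff₀ hn]
          linarith
        have h4 : 0 ≤ ε * S.slack i (B l) := mul_nonneg hε.1.le hlpos.le
        linarith
    obtain ⟨ε, hε, hε0⟩ := ((eventually_all.2 hev).and self_mem_nhdsWithin).exists
    have hmem : ∑ l, wt ε l • B l ∈ S.toSet :=
      mem_toSet.2 fun i => by rw [S.slack_sum i _ (hone ε)]; exact hε i
    rw [hB] at hmem
    have h5 := hmem k
    rw [B.exists_coord_eq _ (hone ε), hwk] at h5
    have h6 : 0 < n * ε := mul_pos hn hε0
    linarith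
  choose τ hτ1 hτ2 using hfacet
  have hτ : τ.Injective := fun k l h => by
    by_contra hkl
    have h1 := hτ1 l
    rw [← h, hτ2 k l (Ne.symm hkl)] at h1
    exact h1.false
  set e : Equiv.Perm (Fin (n + 1)) := Equiv.ofBijective τ (Finite.injective_iff_bijective.1 hτ)
  have he : ∀ i, τ (e.symm i) = i := fun i => e.apply_symm_apply i
  refine ⟨e.symm, fun i => S.slack i (B (e.symm i)), fun i => ?_, fun i x => ?_⟩
  · have := hτ1 (e.symm i); rwa [he] at this
  · have h1 := S.slack_sum i (fun k => B.coord k x) (B.sum_coord_apply_eq_one x) B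
    rw [B.linear_combination_coord_eq_self] at h1
    rw [h1, Finset.sum_eq_single (e.symm i), mul_comm]
    · intro k _ hk
      have := hτ2 (e.symm i) k hk
      rw [he] at this
      rw [this, mul_zero]
    · simp

/-- A kernel vector `z` would have the same slacks as `0` in all rows but `p`, hence the same
barycentric coordinates but one. As they sum to `1`, the last one agrees too, and `z = 0`. -/
theorem det_dropRow_ne_zero [NeZero n] {S : IneqSystem n} (hS : IsSimplex S.toSet) (p : Fin (n + 1)) :
    (dropRow S.A p).det ≠ 0 := by
  obtain ⟨B, hB⟩ := hS.exists_affineBasis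
  obtain ⟨κ, c, hc, hκ⟩ := IneqSystem.exists_perm B hB
  intro hdet
  have hdet' : ((dropRow S.A p).map (Int.cast : ℤ → ℝ)).det = 0 := by
    have := congrArg (Int.castRingHom ℝ) hdet
    rwa [RingHom.map_det, map_zero] at this
  obtain ⟨z, hz, hz0⟩ := Matrix.exists_mulVec_eq_zero_iff.2 hdet'
  have h1 : ∀ i, i ≠ p → S.slack i z = S.slack i 0 := by
    intro i hi
    obtain ⟨k, rfl⟩ := Fin.exists_succAbove_eq hi
    have := congrFun hz0 k
    simp only [Matrix.mulVec, dotProduct, dropRow, Matrix.map_apply, Matrix.submatrix_apply, id,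
      Pi.zero_apply] at this
    simp [IneqSystem.slack, this]
  have h2 : ∀ k, k ≠ κ p → B.coord k z = B.coord k 0 := by
    intro k hk
    have h3 := h1 (κ.symm k) (fun h => hk (by rw [← h]; simp))
    rw [hκ, hκ] at h3
    simpa using mul_left_cancel₀ (hc _).ne' h3
  refine hz (B.ext_elem fun k => ?_)
  by_cases hk : k = κ p
  · have e1 := B.sum_coord_apply_eq_one z
    have e2 := B.sum_coord_apply_eq_one (0 : Fin n → ℝ)
    rw [← Finset.add_sum_erase _ _ (Finset.mem_univ k)] at e1 e2
    rw [Finset.sum_congr rfl fun l hl => h2 l (by rw [← hk]; exact Finset.ne_of_mem_erase hl)] at e1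
    linarith
  · exact h2 k hk

/-- A nonsingular square submatrix forces the rank to be `n`, so that the hypothesis on `Δ` speaks
of the minors of order `n`. -/
theorem abs_det_dropRow_le [NeZero n] {S : IneqSystem n} (hS : IsSimplex S.toSet) {Δ : ℕ}
    (hΔ : IsDeltaModular Δ S.A) (p : Fin (n + 1)) : |(dropRow S.A p).det| ≤ Δ := by
  have hrank : (S.A.map (Int.cast : ℤ → ℝ)).rank = n := by
    apply le_antisymm
    · simpa using Matrix.rank_le_card_width (S.A.map (Int.cast : ℤ → ℝ))
    · have hdet : ((dropRow S.A p).map (Int.cast : ℤ → ℝ)).det ≠ 0 := by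
        have := (Int.castRingHom ℝ).map_det (dropRow S.A p)
        intro h
        rw [RingHom.mapMatrix_apply] at this
        erw [h] at this
        exact det_dropRow_ne_zero hS p (by simpa using this)
      have h1 := Matrix.rank_of_isUnit _ ((Matrix.isUnit_iff_isUnit_det _).2 hdet.isUnit)
      have h2 : ((dropRow S.A p).map (Int.cast : ℤ → ℝ)) =
        (S.A.map (Int.cast : ℤ → ℝ)).submatrix p.succAbove (Equiv.refl _) := rfl
      rw [h2] at h1
      have h3 := Matrix.rank_submatrix_le (S.A.map (Int.cast : ℤ → ℝ)) p.succAbove (Equiv.refl _)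
      rw [h1] at h3
      simpa using h3
  unfold IsDeltaModular maxMinor at hΔ
  rw [hrank] at hΔ
  have := Finset.sup_le_iff.1 hΔ (p.succAbove, id) (Finset.mem_univ _)
  rw [Int.abs_eq_natAbs]
  exact_mod_cast this

/-! ### Unimodular equivalence in terms of primitive rows. -/

/-- The system with the rows divided by their greatest common divisors. -/
def IneqSystem.scaled (S : IneqSystem n) : ScaledSystem n :=
  ⟨primRows S.A, fun i => rowGcd S.A i, S.b⟩

theorem rowGcd_pos_of_det {A : Matrix (Fin (n + 1)) (Fin n) ℤ} [NeZero n]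
    (h : ∀ p, (dropRow A p).det ≠ 0) (i : Fin (n + 1)) : 0 < rowGcd A i := by
  by_cases hi : i = 0
  · refine rowGcd_pos (p := Fin.last n) ?_ (h _)
    have := NeZero.ne n
    rw [hi, Ne, Fin.ext_iff]; simp; omega
  · exact rowGcd_pos hi (h _)

theorem rowGcd_primRows {A : Matrix (Fin (n + 1)) (Fin n) ℤ} {i : Fin (n + 1)}
    (h : 0 < rowGcd A i) : rowGcd (primRows A) i = 1 := by
  have h1 : rowGcd A i = rowGcd A i * rowGcd (primRows A) i := by
    have h2 : rowGcd A i * rowGcd (primRows A) i =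
        Finset.univ.gcd fun j => rowGcd A i * (primRows A i j).natAbs := by
      rw [Finset.gcd_mul_left, normalize_eq]; rfl
    rw [h2]
    refine congrArg (Finset.gcd Finset.univ) (funext fun j => ?_)
    rw [← rowGcd_mul_primRows A i j, Int.natAbs_mul, Int.natAbs_natCast]
  exact (Nat.eq_of_mul_eq_mul_left h (by rw [mul_one]; exact h1)).symm

theorem IneqSystem.slack_eq (S : IneqSystem n) (i : Fin (n + 1)) (x : Fin n → ℝ) :
    S.slack i x = S.b i - S.scaled.g i * ∑ j, (S.scaled.A i j : ℝ) * x j := by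
  rw [IneqSystem.slack, Finset.mul_sum]
  congr 1
  refine Finset.sum_congr rfl fun j _ => ?_
  rw [← mul_assoc]
  congr 1
  exact_mod_cast (rowGcd_mul_primRows S.A i j).symm

/-- With `f` the affine map, `g_S` times the slack of the row `ρ i` of `T` at `f x` equals `g_T`
times the slack of the row `i` of `S` at `x`. So `f` preserves and reflects membership, and it is
onto because `U` is invertible. -/
theorem ScaledSystem.RowEquiv.unimodularEquiv {S T : IneqSystem n} (hS : ∀ i, 0 < rowGcd S.A i)
    (hT : ∀ i, 0 < rowGcd T.A i) (h : S.scaled.RowEquiv T.scaled) :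
    UnimodularEquiv S.toSet T.toSet := by
  obtain ⟨ρ, U, x₀, hU, hA, hb⟩ := h
  refine ⟨U, x₀, hU, ?_⟩
  set f : (Fin n → ℝ) → (Fin n → ℝ) := fun x => (U.map (Int.cast : ℤ → ℝ)).mulVec x + fun i => (x₀ i : ℝ)
  have hmem : ∀ x, f x ∈ T.toSet ↔ x ∈ S.toSet := by
    intro x
    rw [IneqSystem.mem_toSet, IneqSystem.mem_toSet, ← ρ.forall_congr_right]
    refine forall_congr' fun i => ?_
    have hAi : ∀ j, ∑ k, T.scaled.A (ρ i) k * U k j = S.scaled.A i j := fun j => by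
      rw [← hA]; rfl
    have h1 : ∑ j, (T.scaled.A (ρ i) j : ℝ) * f x j =
        ∑ j, (S.scaled.A i j : ℝ) * x j + ((T.scaled.A *ᵥ x₀) (ρ i) : ℤ) := by
      simp only [f, Pi.add_apply, mul_add, Finset.sum_add_distrib, Matrix.mulVec, dotProduct,
        Matrix.map_apply, ← hAi, Int.cast_sum, Int.cast_mul, Finset.mul_sum, Finset.sum_mul]
      rw [Finset.sum_comm]
      simp only [mul_assoc]
    have hbi : (((T.scaled.A *ᵥ x₀) (ρ i) : ℤ) : ℝ) * (S.scaled.g i * T.scaled.g (ρ i)) =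
        T.b (ρ i) * S.scaled.g i - S.b i * T.scaled.g (ρ i) := by exact_mod_cast hb i
    have hg : (0 : ℝ) < S.scaled.g i := by
      have : (0 : ℤ) < S.scaled.g i := Int.natCast_pos.2 (hS i)
      exact Int.cast_pos.2 this
    have hg' : (0 : ℝ) < T.scaled.g (ρ i) := by
      have : (0 : ℤ) < T.scaled.g (ρ i) := Int.natCast_pos.2 (hT (ρ i))
      exact Int.cast_pos.2 this
    rw [T.slack_eq, S.slack_eq, h1]
    rw [← mul_nonneg_iff_of_pos_left hg, ← mul_nonneg_iff_of_pos_left (b := (S.b i : ℝ) - _) hg']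
    refine iff_of_eq (congrArg _ ?_)
    linear_combination -hbi
  have hUr : IsUnit (U.map (Int.cast : ℤ → ℝ)).det := by
    have := (Int.castRingHom ℝ).map_det U
    rw [RingHom.mapMatrix_apply] at this
    exact this ▸ hU.map (Int.castRingHom ℝ)
  ext y
  constructor
  · rintro ⟨x, hx, rfl⟩
    exact (hmem x).2 hx
  · intro hy
    have e : f ((U.map (Int.cast : ℤ → ℝ))⁻¹ *ᵥ (y - fun i => (x₀ i : ℝ))) = y := by
      simp only [f]
      rw [Matrix.mulVec_mulVec, Matrix.mul_nonsing_inv _ hUr, Matrix.one_mulVec, sub_add_cancel]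
    exact ⟨_, (hmem _).1 (by rw [e]; exact hy), e⟩

/-- Two primitive vectors on the same ray are equal. -/
theorem eq_of_gcd_eq_one {u v : Fin n → ℤ} (hu : (Finset.univ.gcd fun j => (u j).natAbs) = 1)
    (hv : (Finset.univ.gcd fun j => (v j).natAbs) = 1) {a b : ℝ} (ha : 0 < a) (hb : 0 < b)
    (h : ∀ j, a * u j = b * v j) : u = v := by
  funext j
  have hcross : ∀ k, v k * u j = u k * v j := fun k => by
    have : (v k : ℝ) * u j = u k * v j := by
      refine mul_left_cancel₀ (mul_pos ha hb).ne' ?_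
      linear_combination b * v k * h j - b * v j * h k
    exact_mod_cast this
  have h1 : (u j).natAbs = (v j).natAbs := by
    have e1 : (Finset.univ.gcd fun k => (u j).natAbs * (v k).natAbs) = (u j).natAbs := by
      rw [Finset.gcd_mul_left, hv]; simp
    have e2 : (Finset.univ.gcd fun k => (v j).natAbs * (u k).natAbs) = (v j).natAbs := by
      rw [Finset.gcd_mul_left, hu]; simp
    rw [← e1, ← e2]
    congr 1
    funext k
    rw [← Int.natAbs_mul, ← Int.natAbs_mul, mul_comm, hcross, mul_comm]
  rcases Int.natAbs_eq_natAbs_iff.1 h1 with h2 | h2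
  · exact h2
  · have h3 := h j
    rw [h2] at h3
    have h4 : (v j : ℝ) * (a + b) = 0 := by push_cast at h3; linarith
    have h5 : (v j : ℝ) = 0 := by
      rcases mul_eq_zero.1 h4 with h | h
      · exact h
      · linarith
    have h6 : v j = 0 := by exact_mod_cast h5
    rw [h2, h6, neg_zero]

/-- Pulling `T` back along the map gives a second system for the simplex of `S`. In both systems the
slacks are positive multiples of the same barycentric coordinates, so the rows are proportional up
to a permutation, and primitive rows on one ray coincide. -/
theorem UnimodularEquiv.rowEquiv [NeZero n] {S T : IneqSystem n} (hS : IsSimplex S.toSet)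
    (hT : IsSimplex T.toSet) (h : UnimodularEquiv S.toSet T.toSet) :
    S.scaled.RowEquiv T.scaled := by
  obtain ⟨U, x₀, hU, himg⟩ := h
  have hgS := rowGcd_pos_of_det (det_dropRow_ne_zero hS)
  have hgT := rowGcd_pos_of_det (det_dropRow_ne_zero hT)
  set f : (Fin n → ℝ) → (Fin n → ℝ) := fun x => (U.map (Int.cast : ℤ → ℝ)).mulVec x + fun i => (x₀ i : ℝ) with hf
  have hUr : IsUnit (U.map (Int.cast : ℤ → ℝ)).det := by
    have := (Int.castRingHom ℝ).map_det U
    rw [RingHom.mapMatrix_apply] at this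
    exact this ▸ hU.map (Int.castRingHom ℝ)
  have hfi : f.Injective := by
    intro x y hxy
    have := add_right_cancel hxy
    exact Matrix.mulVec_injective_of_isUnit ((Matrix.isUnit_iff_isUnit_det _).2 hUr) this
  set T' : IneqSystem n := ⟨T.A * U, fun i => T.b i - (T.A *ᵥ x₀) i⟩ with hT'
  have hslack : ∀ i x, T'.slack i x = T.slack i (f x) := by
    intro i x
    simp only [IneqSystem.slack, hT', hf, Matrix.mul_apply, Pi.add_apply, mul_add,
      Finset.sum_add_distrib, Matrix.mulVec, dotProduct, Matrix.map_apply, Int.cast_sum,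
      Int.cast_mul, Finset.mul_sum, Finset.sum_mul, Int.cast_sub]
    rw [Finset.sum_comm]
    simp only [mul_assoc]
    ring
  have hset : T'.toSet = S.toSet := by
    ext x
    rw [IneqSystem.mem_toSet]
    simp only [hslack]
    rw [← IneqSystem.mem_toSet, ← himg, hfi.mem_set_image]
  obtain ⟨B, hB⟩ := hS.exists_affineBasis
  obtain ⟨κ, c, hc, hκ⟩ := IneqSystem.exists_perm B hB
  obtain ⟨κ', c', hc', hκ'⟩ := IneqSystem.exists_perm (S := T') B (hset.trans hB)
  set ρ := κ.trans κ'.symm with hρ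
  have hslack2 : ∀ i x, c i * T'.slack (ρ i) x = c' (ρ i) * S.slack i x := by
    intro i x
    rw [hκ, hκ']
    simp only [hρ, Equiv.trans_apply, Equiv.apply_symm_apply]
    ring
  have hbi : ∀ i, c i * (T'.b (ρ i) : ℝ) = c' (ρ i) * S.b i := fun i => by
    simpa [IneqSystem.slack] using hslack2 i 0
  have hAi : ∀ i j, c i * (T'.A (ρ i) j : ℝ) = c' (ρ i) * S.A i j := fun i j => by
    have := hslack2 i (Pi.single j 1)
    simp only [IneqSystem.slack, Pi.single_apply, mul_ite, mul_one, mul_zero, Finset.sum_ite_eq',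
      Finset.mem_univ, if_true, mul_sub, hbi] at this
    linarith
  have hprod : ∀ i j, T'.A i j = rowGcd T.A i * (primRows T.A * U) i j := fun i j => by
    simp only [hT', Matrix.mul_apply, Finset.mul_sum]
    refine Finset.sum_congr rfl fun k _ => ?_
    rw [← mul_assoc, rowGcd_mul_primRows]
  -- A common divisor of a row of the product would remain one after multiplying back by the
  -- integral matrix `U⁻¹`.
  have hgcd1 : ∀ i, rowGcd (primRows T.A * U) i = 1 := fun i => by
    refine Nat.dvd_one.1 ?_
    refine Dvd.dvd.trans (dvd_rowGcd_iff.2 fun j => ?_) (rowGcd_primRows (hgT i)).dvd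
    have h1 : primRows T.A i j = (primRows T.A * U * U⁻¹) i j := by
      rw [Matrix.mul_assoc, Matrix.mul_nonsing_inv _ hU, Matrix.mul_one]
    rw [h1, Matrix.mul_apply]
    exact Finset.dvd_sum fun k _ => (rowGcd_dvd (primRows T.A * U) i k).mul_right _
  have hrow : ∀ i, (primRows T.A * U) (ρ i) = primRows S.A i := by
    intro i
    have hpos : (0 : ℝ) < rowGcd T.A (ρ i) := by exact_mod_cast hgT _
    have hpos' : (0 : ℝ) < rowGcd S.A i := by exact_mod_cast hgS _
    refine eq_of_gcd_eq_one (hgcd1 _) (rowGcd_primRows (hgS i)) (mul_pos (hc i) hpos)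
      (mul_pos (hc' (ρ i)) hpos') fun j => ?_
    have h1 := hAi i j
    rw [hprod, ← rowGcd_mul_primRows S.A] at h1
    push_cast at h1
    linarith
  -- Once the primitive rows agree, the ratio of the scalars is read off at a nonzero entry; it then
  -- fixes the right hand sides.
  have hscale : ∀ i, c i * (rowGcd T.A (ρ i) : ℝ) = c' (ρ i) * rowGcd S.A i := by
    intro i
    obtain ⟨j, hj⟩ : ∃ j, primRows S.A i j ≠ 0 := by
      by_contra! h0
      have := rowGcd_primRows (hgS i)
      rw [rowGcd, Finset.gcd_eq_zero_iff.2 (by simp [h0])] at this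
      exact zero_ne_one this
    have h1 := hAi i j
    rw [hprod, ← rowGcd_mul_primRows S.A, hrow] at h1
    push_cast at h1
    refine mul_right_cancel₀ (b := (primRows S.A i j : ℝ)) (by exact_mod_cast hj) ?_
    linarith
  refine ⟨ρ, U, x₀, hU, ?_, fun i => ?_⟩
  · ext i j
    exact congrFun (hrow i) j
  · have h1 := hbi i
    have h2 := hscale i
    have h3 : (T.A *ᵥ x₀) (ρ i) = rowGcd T.A (ρ i) * (primRows T.A *ᵥ x₀) (ρ i) := by
      simp only [Matrix.mulVec, dotProduct, Finset.mul_sum, ← mul_assoc, rowGcd_mul_primRows]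
    have h4 : (T'.b (ρ i) : ℝ) = T.b (ρ i) - rowGcd T.A (ρ i) * ((primRows T.A *ᵥ x₀) (ρ i) : ℤ) := by
      simp only [hT', h3]; push_cast; ring
    rw [h4] at h1
    have h5 : (((primRows T.A *ᵥ x₀) (ρ i) : ℤ) : ℝ) * (rowGcd S.A i * rowGcd T.A (ρ i)) =
        T.b (ρ i) * rowGcd S.A i - S.b i * rowGcd T.A (ρ i) := by
      refine mul_left_cancel₀ (hc i).ne' ?_
      linear_combination -(rowGcd S.A i : ℝ) * h1 + S.b i * h2
    exact_mod_cast h5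

end Simplex
/-! ### Generators of the cokernel of a matrix -/

section Generators

open Matrix

variable {n : ℕ}

theorem Matrix.card_quotient_range (M : Matrix (Fin n) (Fin n) ℤ) (hM : M.det ≠ 0) :
    Nat.card ((Fin n → ℤ) ⧸ LinearMap.range M.mulVecLin) = M.det.natAbs := by
  have hinj : Function.Injective M.mulVecLin := by
    intro x y h
    have h1 : M *ᵥ (x - y) = 0 := by
      rw [Matrix.mulVec_sub, sub_eq_zero]; exact h
    have := Matrix.eq_zero_of_mulVec_eq_zero hM h1
    exact sub_eq_zero.1 this
  rw [← Submodule.natAbs_det_equiv _ (LinearEquiv.ofInjective M.mulVecLin hinj)]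
  congr 1
  rw [← LinearMap.det_toLin']
  congr 1

/-- Used in base `δ` for the coefficients in codes, and in base `n` for the guessed images of the
generators. -/
theorem exists_digits {δ : ℕ} (k : ℕ) (f : ℕ → ℕ) (hf : ∀ j < k, f j < δ) :
    ∃ c < δ ^ k, ∀ j < k, c / δ ^ j % δ = f j := by
  induction k with
  | zero => exact ⟨0, by simp, by simp⟩
  | succ k ih =>
    obtain ⟨c, hc, hj⟩ := ih fun j hj => hf j (by omega)
    have hfk := hf k (by omega)
    have hδ : 0 < δ := by omega
    refine ⟨c + δ ^ k * f k, ?_, fun j hjk => ?_⟩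
    · calc c + δ ^ k * f k < δ ^ k + δ ^ k * f k := by omega
        _ = δ ^ k * (f k + 1) := by ring
        _ ≤ δ ^ k * δ := Nat.mul_le_mul_left _ hfk
        _ = δ ^ (k + 1) := by ring
    · rcases Nat.lt_succ_iff_lt_or_eq.1 hjk with h | rfl
      · obtain ⟨m, rfl⟩ : ∃ m, k = j + 1 + m := ⟨k - (j + 1), by omega⟩
        have : c + δ ^ (j + 1 + m) * f (j + 1 + m) = c + δ ^ j * (δ * (δ ^ m * f (j + 1 + m))) := by
          ring
        rw [this, Nat.add_mul_div_left _ _ (by positivity), Nat.add_mul_mod_self_left, hj j h]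
      · rw [Nat.add_mul_div_left _ _ (by positivity), Nat.div_eq_of_lt hc, zero_add,
          Nat.mod_eq_of_lt hfk]

/-- No `gen j` is a combination of its predecessors. -/
def Independent (N : Matrix (Fin n) (Fin n) ℤ) (δ s : ℕ) (gen : ℕ → Fin n) : Prop :=
  ∀ j < s, ∀ c < δ ^ j, ∃ r, ¬ (δ : ℤ) ∣ codeSum N δ j gen c r - N r (gen j)

theorem codeSum_modEq {N : Matrix (Fin n) (Fin n) ℤ} {δ s : ℕ} {gen : ℕ → Fin n} {c : ℕ}
    {a : ℕ → ℤ} (h : ∀ j < s, ((c / δ ^ j % δ : ℕ) : ℤ) ≡ a j [ZMOD δ]) (r : Fin n) :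
    codeSum N δ s gen c r ≡ ∑ j ∈ Finset.range s, a j * N r (gen j) [ZMOD δ] := by
  refine (Int.mod_modEq _ _).trans ?_
  rw [Int.modEq_iff_dvd, ← Finset.sum_sub_distrib]
  refine Finset.dvd_sum fun j hj => ?_
  rw [← sub_mul]
  exact (Int.modEq_iff_dvd.1 (h j (Finset.mem_range.1 hj))).mul_right _

/-- Only coefficients modulo `δ` matter, and reduced coefficients are the digits of a code. -/
theorem Independent.not_combination {N : Matrix (Fin n) (Fin n) ℤ} {δ s : ℕ} {gen : ℕ → Fin n}
    (h : Independent N δ s gen) (hδ : δ ≠ 0) {j : ℕ} (hj : j < s) (a : ℕ → ℤ) :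
    ∃ r, ¬ (δ : ℤ) ∣ ∑ l ∈ Finset.range j, a l * N r (gen l) - N r (gen j) := by
  have hz : (0 : ℤ) < δ := by exact_mod_cast Nat.pos_of_ne_zero hδ
  obtain ⟨c, hc, hd⟩ := exists_digits (δ := δ) j (fun l => (a l % δ).toNat) fun l _ => by
    have := Int.emod_lt_of_pos (a l) hz
    have := Int.emod_nonneg (a l) hz.ne'
    omega
  obtain ⟨r, hr⟩ := h j hj c hc
  refine ⟨r, fun hdvd => hr ?_⟩
  have h1 := codeSum_modEq (N := N) (gen := gen) (s := j) (c := c) (a := a) (fun l hl => by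
    rw [hd l hl, Int.toNat_of_nonneg (Int.emod_nonneg (a l) hz.ne')]
    exact Int.mod_modEq _ _) r
  have h2 := Int.modEq_iff_dvd.1 h1.symm
  have := dvd_add h2 hdvd
  rwa [sub_add_sub_cancel] at this

/-- The `2 ^ s` subset sums of the unit vectors at the generators are distinct in the cokernel of
`M`, whose order is `δ`. If two agreed, applying `N` would express the column at the largest index
of the symmetric difference through earlier ones modulo `δ`. -/
theorem Independent.two_pow_le {M N : Matrix (Fin n) (Fin n) ℤ} {δ s : ℕ} {gen : ℕ → Fin n}
    (h : Independent N δ s gen) (hδ : δ ≠ 0) (hMN : M * N = (δ : ℤ) • 1) (hM : |M.det| = δ) :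
    2 ^ s ≤ δ := by
  have hz : (δ : ℤ) ≠ 0 := by exact_mod_cast hδ
  have hdet : M.det ≠ 0 := fun h0 => by rw [h0, abs_zero] at hM; exact hz hM.symm
  have hcard := M.card_quotient_range hdet
  have hδ' : M.det.natAbs = δ := by
    rw [Int.abs_eq_natAbs] at hM; exact_mod_cast hM
  have hNM : N * M = (δ : ℤ) • 1 := Matrix.mul_eq_smul_one_comm hz hMN
  rw [hδ'] at hcard
  have hfin : Finite ((Fin n → ℤ) ⧸ LinearMap.range M.mulVecLin) :=
    Nat.finite_of_card_ne_zero (by rw [hcard]; exact hδ)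
  set F : Finset (Fin s) → ((Fin n → ℤ) ⧸ LinearMap.range M.mulVecLin) := fun J =>
    Submodule.Quotient.mk (∑ j ∈ J, Pi.single (gen j) 1)
  have hF : F.Injective := by
    intro J K hJK
    by_contra hne
    obtain ⟨z, hz'⟩ := (Submodule.Quotient.eq _).1 hJK
    have hval : ∀ r, ∑ j ∈ J, N r (gen j) - ∑ j ∈ K, N r (gen j) = δ * z r := by
      intro r
      have h1 := congrArg (N *ᵥ ·) hz'
      simp only [Matrix.mulVecLin_apply, Matrix.mulVec_mulVec, hNM, Matrix.smul_mulVec,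
        Matrix.one_mulVec, Matrix.mulVec_sub, Matrix.mulVec_sum] at h1
      have := congrFun h1 r
      simpa using this.symm
    have hsd : (symmDiff J K).Nonempty := by
      rw [Finset.nonempty_iff_ne_empty]
      intro h0
      exact hne (symmDiff_eq_bot.1 h0)
    set m := (symmDiff J K).max' hsd with hm
    have hmax : ∀ l, m < l → (l ∈ J ↔ l ∈ K) := by
      intro l hl
      by_contra hcon
      have : l ∈ symmDiff J K := by
        rw [Finset.mem_symmDiff]; tauto
      exact absurd (Finset.le_max' _ l this) (not_le.2 hl)
    have hmm := Finset.max'_mem _ hsd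
    rw [← hm, Finset.mem_symmDiff] at hmm
    -- The coefficients of the forbidden combination are differences of indicators. Above the
    -- maximum `m` the two sets agree, so those terms cancel.
    have hkey : ∀ J K : Finset (Fin s), (∀ l, m < l → (l ∈ J ↔ l ∈ K)) → m ∈ J → m ∉ K →
        ∀ z : Fin n → ℤ, (∀ r, ∑ j ∈ J, N r (gen j) - ∑ j ∈ K, N r (gen j) = δ * z r) → False := by
      intro J K hmax hJ hK z hval
      obtain ⟨r, hr⟩ := h.not_combination hδ m.2 fun l =>
        if hl : l < s then (if ⟨l, hl⟩ ∈ K then 1 else 0) - (if ⟨l, hl⟩ ∈ J then 1 else 0) else 0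
      refine hr ⟨-z r, ?_⟩
      have e1 : ∑ j ∈ J, N r (gen j) - ∑ j ∈ K, N r (gen j) =
          ∑ j : Fin s, ((if j ∈ J then 1 else 0) - (if j ∈ K then 1 else 0)) * N r (gen j) := by
        simp [sub_mul, Finset.sum_sub_distrib]
      have e2 : ∑ l ∈ Finset.range m, (if hl : l < s then (if (⟨l, hl⟩ : Fin s) ∈ K then (1 : ℤ) else 0) -
          (if (⟨l, hl⟩ : Fin s) ∈ J then 1 else 0) else 0) * N r (gen l) =
          ∑ j ∈ Finset.univ.filter (· < m), ((if j ∈ K then (1 : ℤ) else 0) - (if j ∈ J then 1 else 0)) * N r (gen j) := by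
        refine Finset.sum_bij' (fun l hl => ⟨l, (Finset.mem_range.1 hl).trans m.2⟩) (fun j _ => j)
          ?_ ?_ ?_ ?_ ?_
        · intro l hl; exact Finset.mem_filter.2 ⟨Finset.mem_univ _, Finset.mem_range.1 hl⟩
        · intro l hl; exact Finset.mem_range.2 (Finset.mem_filter.1 hl).2
        · simp
        · simp
        · intro l hl; simp [(Finset.mem_range.1 hl).trans m.2]
      have e3 : ∑ j : Fin s, ((if j ∈ J then (1 : ℤ) else 0) - (if j ∈ K then 1 else 0)) * N r (gen j) =
          N r (gen m) - ∑ j ∈ Finset.univ.filter (· < m), ((if j ∈ K then (1 : ℤ) else 0) - (if j ∈ J then 1 else 0)) * N r (gen j) := by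
        rw [← Finset.sum_filter_add_sum_filter_not Finset.univ (· < m),
          ← Finset.add_sum_erase (Finset.univ.filter fun j => ¬ j < m) _ (a := m) (by simp)]
        rw [Finset.sum_eq_zero (s := (Finset.univ.filter fun j => ¬ j < m).erase m)]
        · simp only [hJ, hK, if_true, if_false, ← Finset.sum_neg_distrib, sub_eq_add_neg]
          rw [add_comm]
          congr 1
          · ring
          · exact Finset.sum_congr rfl fun j _ => by ring
        · intro j hj
          simp only [Finset.mem_erase, Finset.mem_filter, Finset.mem_univ, true_and, not_lt] at hj
          have := hmax j (lt_of_le_of_ne hj.2 (Ne.symm hj.1))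
          by_cases hjJ : j ∈ J
          · simp [hjJ, this.1 hjJ]
          · simp [hjJ, mt this.2 hjJ]
      rw [e2]
      have := hval r
      rw [e1, e3] at this
      linarith
    rcases hmm with ⟨h1, h2⟩ | ⟨h1, h2⟩
    · exact hkey J K hmax h1 h2 z hval
    · refine hkey K J (fun l hl => (hmax l hl).symm) h1 h2 (-z) fun r => ?_
      have := hval r
      simp only [Pi.neg_apply]
      linarith
  have := Nat.card_le_card_of_injective F hF
  rwa [hcard, Nat.card_eq_fintype_card, Fintype.card_finset, Fintype.card_fin] at this

end Generators
/-! ### The adjugate and the coordinates of a row -/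

open Matrix in
/-- The adjugate of `M` up to the sign, such that the product with `M` is positive. -/
def adjInt {n : ℕ} (M : Matrix (Fin n) (Fin n) ℤ) : Matrix (Fin n) (Fin n) ℤ :=
  Matrix.of fun i j =>
    (1 - 2 * if 0 < (faddeevLeVerrier M n).2 then 1 else 0) * (faddeevLeVerrier M n).1 i j

theorem abs_faddeevLeVerrier_fin {n : ℕ} (M : Matrix (Fin n) (Fin n) ℤ) :
    |(faddeevLeVerrier M n).2| = |M.det| := by
  have := abs_faddeevLeVerrier M
  rwa [Fintype.card_fin] at this

theorem mul_adjInt {n : ℕ} (M : Matrix (Fin n) (Fin n) ℤ) :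
    M * adjInt M = (M.det.natAbs : ℤ) • 1 := by
  have h1 := mul_faddeevLeVerrier M
  rw [Fintype.card_fin] at h1
  have h2 : adjInt M = (1 - 2 * if 0 < (faddeevLeVerrier M n).2 then 1 else 0 : ℤ) •
      (faddeevLeVerrier M n).1 := rfl
  rw [h2, Matrix.mul_smul, h1, smul_smul, ← Int.abs_eq_natAbs, ← abs_faddeevLeVerrier_fin]
  congr 1
  split_ifs with h
  · rw [abs_of_pos h]; ring
  · rw [abs_of_nonpos (not_lt.1 h)]; ring

theorem abs_adjInt {n : ℕ} (M : Matrix (Fin n) (Fin n) ℤ) (i j : Fin n) :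
    |adjInt M i j| = |(faddeevLeVerrier M n).1 i j| := by
  simp only [adjInt, Matrix.of_apply, abs_mul]
  split_ifs <;> simp

/-- The coordinates of the row `p` with respect to the other rows, times the determinant. -/
def rowCoords {n : ℕ} (A : Matrix (Fin (n + 1)) (Fin n) ℤ) (p : Fin (n + 1)) : Fin n → ℤ :=
  Matrix.vecMul (A p) (adjInt (dropRow A p))

namespace RAM

open Filter HExpr

/-- The entries of `adjInt`. -/
def adjEntry : HExpr := read 7 (var 40) * (1 - 2 * lt 0 (var 9))

/-- The entries of `rowCoords`. -/
def coordEntry (src v N : ℕ) : HExpr :=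
  sum 60 (var 0) (read src (var 60 + var 0 * var v) * read N (var 40 + var 0 * var 60))

/-- The program that computes `adjInt`, the determinant and `rowCoords` for the row `var v`. -/
def adjProg (src v N D l : ℕ) : Program :=
  .seq (minorProg src (var v)) (.seq (fill N 37 adjEntry)
    (.seq (assign D 0 (var 9).abs) (fill l 0 (coordEntry src v N))))

/-- The arrays used by `adjProg`. -/
def adjArrays (N D l : ℕ) : List ℕ := [6, 7, 8, 9, 40, 41, N, D, l]

theorem eventually_adj (src v N D l : ℕ)
    (h₁ : (minorEntry src (var v)).ok [] = true ∧ (minorEntry src (var v)).avoids 6 = true)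
    (h₂ : adjEntry.ok [] = true ∧ adjEntry.avoids N = true)
    (h₃ : (coordEntry src v N).ok [] = true ∧ (coordEntry src v N).avoids l = true)
    (hs : (src < 60 ∧ src ≠ 5 ∧ src ≠ 40) ∧ (N < 60 ∧ N ≠ 5 ∧ N ≠ 40 ∧ N ≠ 37) ∧
      (D < 60 ∧ D ≠ 5) ∧ (l < 60 ∧ l ≠ 5 ∧ l ≠ 40 ∧ l ≠ 0) ∧ (v < 60 ∧ v ≠ 5) ∧
      src ∉ adjArrays N D l ∧ v ∉ adjArrays N D l ∧ N ≠ D ∧ N ≠ l ∧ D ≠ l ∧ N ≠ 9 ∧ D ≠ 40 ∧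
      (0 ∉ adjArrays N D l ∧ 37 ∉ adjArrays N D l ∧ 38 ∉ adjArrays N D l ∧
        39 ∉ adjArrays N D l) := by decide) :
    ∀ᶠ c in atTop, ∀ (w R n : ℕ) (σ : Store) (A : Matrix (Fin (n + 1)) (Fin n) ℤ)
      (p : Fin (n + 1)), Base n w R σ → HoldsMat (σ src) A → MinorBound w A →
    (∀ i, |rowCoords A p i| ≤ 2 ^ w) → σ v 0 = (p : ℕ) →
    Runs (w * c + 2) (R ^ (c + 12)) (adjProg src v N D l) σ fun σ' =>
      Same (adjArrays N D l) σ σ' ∧ Bdd w σ' ∧ HoldsMat (σ' N) (adjInt (dropRow A p)) ∧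
        σ' D 0 = ((dropRow A p).det.natAbs : ℕ) ∧ HoldsVec (σ' l) (rowCoords A p) := by
  obtain ⟨hs1, hs2, hs3, hs4, hs5, hs6, hs7, hs8, hs9, hs10, hs11, hs12, hs13⟩ := hs
  filter_upwards [eventually_minor src (var v) h₁.1 h₁.2 hs1,
    eventually_fillMat N 37 h₂.1 h₂.2 hs2, eventually_put D (e := (var 9).abs) rfl,
    eventually_fillVec l 0 h₃.1 h₃.2 hs4] with c t1 t2 t3 t4 w R n σ A p hB hA hbd hlam hv
  have hR := hB.hundred_le
  have hw := hB.pow_le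
  have hnR := hB.le
  have hv40 : v ≠ 40 := fun h => hs7 (by simp [adjArrays, h])
  have p1 := t1 w R n σ A p hB hA hbd (fun x => ⟨by simp [Store.set_apply, hv40, hv], by simp⟩)
  have hsub1 : [6, 7, 8, 9, 40, 41] ⊆ adjArrays N D l := by simp [adjArrays]
  have hsub2 : [N, 40] ⊆ adjArrays N D l := by simp [adjArrays]
  have hsub3 : [D] ⊆ adjArrays N D l := by simp [adjArrays]
  have hsub4 : [l, 40] ⊆ adjArrays N D l := by simp [adjArrays]
  apply Runs.of_time
  case h =>
    apply Runs.then p1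
    rintro σ₁ ⟨s1, b1, m1, e1⟩
    have s1' : Same (adjArrays N D l) σ σ₁ := s1.mono hsub1
    have hB1 := hB.mono s1' b1 hs13
    have p2 := t2 w R n n (adjInt (dropRow A p)) σ₁ hR hw b1 hB1.h37 hB.mul_self_le fun i j => by
      refine ⟨by simp [adjEntry], ?_, ?_⟩
      · simp [adjEntry, Store.set_apply, m1 _ _, e1, adjInt, mul_comm]
      · rw [abs_adjInt]; exact (hbd p n le_rfl).1 i j
    apply Runs.then p2
    rintro σ₂ ⟨s2, m2, b2⟩
    have s2' : Same (adjArrays N D l) σ σ₂ := s1'.trans s2 (List.Subset.refl _) hsub2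
    have e2 : σ₂ 9 0 = (faddeevLeVerrier (dropRow A p) n).2 := by
      rw [s2.get 9 (by decide) (by decide) (by simp; exact hs11.symm), e1]
    have hval : (var 9).abs.eval σ₂ = ((dropRow A p).det.natAbs : ℕ) := by
      rw [eval_abs, eval_var, e2, abs_faddeevLeVerrier_fin, Int.abs_eq_natAbs]
    have p3 := t3 w R σ₂ hR hw b2 (by simp) (by
      rw [eval_abs, eval_var, e2, abs_abs]; exact (hbd p n le_rfl).2) hs3
    rw [hval] at p3
    apply Runs.then p3
    rintro σ₃ ⟨s3, e3, b3⟩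
    have s3' : Same (adjArrays N D l) σ σ₃ := s2'.trans s3 (List.Subset.refl _) hsub3
    have hB3 := hB.mono s3' b3 hs13
    have m3 : HoldsMat (σ₃ N) (adjInt (dropRow A p)) := by
      rw [s3 N hs2.1 hs2.2.1 (by simpa using hs8)]; exact m2
    have hA3 : HoldsMat (σ₃ src) A := by rw [s3' src hs1.1 hs1.2.1 hs6]; exact hA
    have hv3 : σ₃ v 0 = (p : ℕ) := by rw [s3' v hs5.1 hs5.2 hs7, hv]
    have hsrc60 : src ≠ 60 := by omega
    have hN60 : N ≠ 60 := by omega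
    have hv60 : v ≠ 60 := by omega
    have p4 := t4 w R n (rowCoords A p) σ₃ hR hw b3 hB3.h0
      (by have := Nat.le_self_pow (n := 3) (by norm_num) R; omega) fun i => by
        refine ⟨by simp [coordEntry, Store.set_apply, hB3.h0, show n ≤ R by omega], ?_, hlam i⟩
        simp [coordEntry, Store.set_apply, hB3.h0, hv40, hsrc60, hN60, hv60, hv3, hs1.2.2, hs2.2.2.1,
          Finset.sum_range, m3 _ _, hA3 _ _, rowCoords, Matrix.vecMul, dotProduct]
    refine p4.imp le_rfl fun σ₄ ⟨s4, m4, b4⟩ => ⟨s3'.trans s4 (List.Subset.refl _) hsub4, b4, ?_, ?_, m4⟩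
    · rw [s4 N hs2.1 hs2.2.1 (by simp; exact ⟨hs9, hs2.2.2.1⟩)]; exact m3
    · rw [s4 D hs3.1 hs3.2 (by simp; exact ⟨hs10, hs12⟩), e3]
  case hT =>
    have := pow_step (a := c + 10) (b := c + 12) hR (by omega)
    have := pow_step (a := c + 5) (b := c + 12) hR (by omega)
    have := pow_step (a := c + 1) (b := c + 12) hR (by omega)
    omega

theorem eventually_adjS : ∀ᶠ c in atTop, ∀ (w R n : ℕ) (σ : Store)
    (A : Matrix (Fin (n + 1)) (Fin n) ℤ) (p : Fin (n + 1)), Base n w R σ → HoldsMat (σ 11) A →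
    MinorBound w A → (∀ i, |rowCoords A p i| ≤ 2 ^ w) → σ 0 0 = (p : ℕ) →
    Runs (w * c + 2) (R ^ (c + 12)) (adjProg 11 0 14 15 17) σ fun σ' =>
      Same (adjArrays 14 15 17) σ σ' ∧ Bdd w σ' ∧ HoldsMat (σ' 14) (adjInt (dropRow A p)) ∧
        σ' 15 0 = ((dropRow A p).det.natAbs : ℕ) ∧ HoldsVec (σ' 17) (rowCoords A p) :=
  eventually_adj 11 0 14 15 17 ⟨rfl, rfl⟩ ⟨rfl, rfl⟩ ⟨rfl, rfl⟩

theorem eventually_adjT : ∀ᶠ c in atTop, ∀ (w R n : ℕ) (σ : Store)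
    (A : Matrix (Fin (n + 1)) (Fin n) ℤ) (p : Fin (n + 1)), Base n w R σ → HoldsMat (σ 13) A →
    MinorBound w A → (∀ i, |rowCoords A p i| ≤ 2 ^ w) → σ 44 0 = (p : ℕ) →
    Runs (w * c + 2) (R ^ (c + 12)) (adjProg 13 44 25 26 28) σ fun σ' =>
      Same (adjArrays 25 26 28) σ σ' ∧ Bdd w σ' ∧ HoldsMat (σ' 25) (adjInt (dropRow A p)) ∧
        σ' 26 0 = ((dropRow A p).det.natAbs : ℕ) ∧ HoldsVec (σ' 28) (rowCoords A p) :=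
  eventually_adj 13 44 25 26 28 ⟨rfl, rfl⟩ ⟨rfl, rfl⟩ ⟨rfl, rfl⟩

end RAM

/-! ### The search for generators -/

namespace RAM

open Filter HExpr

theorem eventually_store (a : ℕ) {i e : HExpr} (hi : i.ok [] = true) (he : e.ok [] = true)
    (ha : a < 60 ∧ a ≠ 5 := by decide) :
    ∀ᶠ c in atTop, ∀ (w R : ℕ) (σ : Store), 100 ≤ R → R ^ 4 ≤ 2 ^ w → Bdd w σ → i.Rng R σ →
      e.Rng R σ → |e.eval σ| ≤ 2 ^ w →
      Runs (w * c + 2) (R ^ (c + 1)) (assign a i e) σ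
        (fun σ' => Same [a] σ σ' ∧ (∀ j, σ' a j = if j = i.eval σ then e.eval σ else σ a j) ∧
          Bdd w σ') := by
  filter_upwards [eventually_assign a hi he] with c h w R σ hR hw hb hri hr hv
  refine (h w R σ hR ((Nat.le_self_pow (by norm_num) R).trans hw) hb hri hr).imp le_rfl
    fun σ' hs => ⟨((Same.refl [a] σ).set (by simp) _ _).trans hs (by simp) (by simp), fun j => ?_,
      (hb.set hv _ _).same hs⟩
  rw [hs a ha.1 ha.2 (by simp), Store.set_apply]
  simp

/-- The state of the greedy choice of generators after the treatment of `k` columns. -/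
structure GenState {n : ℕ} (N : Matrix (Fin n) (Fin n) ℤ) (δ k s : ℕ) (gen : ℕ → Fin n)
    (code : ℕ → ℕ) (τ : Store) : Prop where
  h14 : HoldsMat (τ 14) N
  h15 : τ 15 0 = δ
  h18 : τ 18 0 = s
  h19 : τ 19 0 = (δ ^ s : ℕ)
  h23 : τ 23 0 = (n ^ s : ℕ)
  h20 : ∀ j : ℕ, j ≤ s → τ 20 j = (δ ^ j : ℕ)
  h24 : ∀ j : ℕ, j ≤ s → τ 24 j = (n ^ j : ℕ)
  h22 : ∀ j : ℕ, j < s → τ 22 j = (gen j : ℕ)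
  h21 : ∀ i : ℕ, i < k → τ 21 i = code i
  lt : ∀ i < k, code i < δ ^ s
  dvd : ∀ i : Fin n, (i : ℕ) < k → ∀ r, (δ : ℤ) ∣ codeSum N δ s gen (code i) r - N r i
  indep : Independent N δ s gen

theorem GenState.mono {n : ℕ} {N : Matrix (Fin n) (Fin n) ℤ} {δ k s : ℕ} {gen : ℕ → Fin n}
    {code : ℕ → ℕ} {τ τ' : Store} (h : GenState N δ k s gen code τ) {F : List ℕ}
    (hs : Same F τ τ') (hF : 14 ∉ F ∧ 15 ∉ F ∧ 18 ∉ F ∧ 19 ∉ F ∧ 20 ∉ F ∧ 21 ∉ F ∧ 22 ∉ F ∧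
      23 ∉ F ∧ 24 ∉ F := by decide) : GenState N δ k s gen code τ' where
  h14 := by rw [hs.get 14 (by decide) (by decide) hF.1]; exact h.h14
  h15 := by rw [hs.get 15 (by decide) (by decide) hF.2.1]; exact h.h15
  h18 := by rw [hs.get 18 (by decide) (by decide) hF.2.2.1]; exact h.h18
  h19 := by rw [hs.get 19 (by decide) (by decide) hF.2.2.2.1]; exact h.h19
  h20 := by rw [hs.get 20 (by decide) (by decide) hF.2.2.2.2.1]; exact h.h20
  h21 := by rw [hs.get 21 (by decide) (by decide) hF.2.2.2.2.2.1]; exact h.h21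
  h22 := by rw [hs.get 22 (by decide) (by decide) hF.2.2.2.2.2.2.1]; exact h.h22
  h23 := by rw [hs.get 23 (by decide) (by decide) hF.2.2.2.2.2.2.2.1]; exact h.h23
  h24 := by rw [hs.get 24 (by decide) (by decide) hF.2.2.2.2.2.2.2.2]; exact h.h24
  lt := h.lt
  dvd := h.dvd
  indep := h.indep

/-- The test whether `var 43` is a code of the column `var 42`. -/
def genTest : HExpr :=
  all 60 (var 0) (eq ((sum 61 (var 18) ((var 43 / read 20 (var 61)) % var 15 *
    read 14 (read 22 (var 61) + var 0 * var 60)) % var 15 - read 14 (var 42 + var 0 * var 60)) %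
      var 15) 0)

theorem GenState.genTest {n w R : ℕ} {N : Matrix (Fin n) (Fin n) ℤ} {δ k s : ℕ} {gen : ℕ → Fin n}
    {code : ℕ → ℕ} {τ : Store} (h : GenState N δ k s gen code τ) (hB : Base n w R τ) {c : ℕ}
    {i : Fin n} (h43 : τ 43 0 = c) (h42 : τ 42 0 = (i : ℕ)) (hs : s ≤ R) :
    genTest.Rng R τ ∧ (genTest.eval τ = 0 ∨ genTest.eval τ = 1) ∧
      (genTest.eval τ ≠ 0 ↔ ∀ r, (δ : ℤ) ∣ codeSum N δ s gen c r - N r i) := by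
  have hn := hB.le
  refine ⟨?_, eval_all_eq _ _ _, ?_⟩
  · simp [RAM.genTest, Store.set_apply, hB.h0, h.h18, hs, show n ≤ R by omega]
  · rw [RAM.genTest, eval_all_ne_zero _ _ _ (by simp [hB.h0])]
    simp only [eval_var, hB.h0, Int.toNat_natCast]
    rw [Fin.forall_iff]
    refine forall_congr' fun r => forall_congr' fun hr => ?_
    have e1 : ∑ j ∈ Finset.range s, τ 43 0 / τ 20 j % τ 15 0 * τ 14 (τ 22 j + n * r) =
        ∑ j ∈ Finset.range s, ((c / δ ^ j % δ : ℕ) : ℤ) * N ⟨r, hr⟩ (gen j) := by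
      refine Finset.sum_congr rfl fun j hj => ?_
      have hj := Finset.mem_range.1 hj
      rw [h43, h.h20 j hj.le, h.h15, h.h22 j hj, ← h.h14]
      push_cast
      rfl
    have e2 : τ 14 (τ 42 0 + n * r) = N ⟨r, hr⟩ i := by rw [h42, ← h.h14]
    simp only [eval_eq, eval_mod, eval_sub, eval_sum, eval_mul, eval_div, eval_read, eval_var,
      eval_add, Store.set_apply, hB.h0, h.h18, h42, eval_ofNat]
    simp only [Nat.reduceEqDiff, false_and, if_false, and_true, if_true, Int.toNat_natCast]
    rw [h42] at e2
    rw [e1, e2, codeSum, h.h15, Int.dvd_iff_emod_eq_zero]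
    simp

/-- Search for a code of the column `var 42`. -/
def genSearch : Program :=
  .seq (assign 36 0 (var 19)) (forTo 43 19 (assign 36 0 (var 36 + genTest * (var 43 - var 36))))

/-- An explicit loop replaces `find`, because its range `δ ^ s` need not be at most `R`; the factor
`δ ^ s` is kept separate in the time bound. Every hit overwrites the previous one, so `δ ^ s` is
left exactly if there is no code. -/
theorem eventually_genSearch : ∀ᶠ c in atTop, ∀ (w R n : ℕ) (σ : Store)
    (N : Matrix (Fin n) (Fin n) ℤ) (δ k s : ℕ) (gen : ℕ → Fin n) (code : ℕ → ℕ) (i : Fin n),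
    Base n w R σ → GenState N δ k s gen code σ → σ 42 0 = (i : ℕ) → s ≤ R → δ ^ s ≤ 2 ^ w → δ ≠ 0 →
    Runs (w * c + 2) (R ^ (c + 3) * δ ^ s) genSearch σ fun σ' =>
      Same [36, 43] σ σ' ∧ Bdd w σ' ∧ ∃ x : ℕ, σ' 36 0 = x ∧
        ((x = δ ^ s ∧ ∀ y < δ ^ s, ¬ ∀ r, (δ : ℤ) ∣ codeSum N δ s gen y r - N r i) ∨
          (x < δ ^ s ∧ ∀ r, (δ : ℤ) ∣ codeSum N δ s gen x r - N r i)) := by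
  filter_upwards [eventually_put 36 (e := var 19) rfl,
    eventually_put 36 (e := var 36 + genTest * (var 43 - var 36)) rfl, eventually_ge_atTop 10]
    with c h1 h2 hc w R n σ N δ k s gen code i hB hG h42 hs hδw h0
  have hR := hB.hundred_le
  have hw := hB.pow_le
  have hδw' : ((δ ^ s : ℕ) : ℤ) ≤ 2 ^ w := by exact_mod_cast hδw
  have hpos : 1 ≤ R ^ (c + 1) := Nat.one_le_pow _ _ (by omega)
  have hδ : 0 < δ ^ s := Nat.pow_pos (Nat.pos_of_ne_zero h0)
  apply Runs.of_time
  case h =>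
    apply Runs.then (h1 w R σ hR hw hB.bdd (by simp) (by
      simp only [eval_var, hG.h19, Nat.abs_cast]; exact hδw') (by decide))
    rintro σ₁ ⟨s1, e1, b1⟩
    simp only [eval_var, hG.h19] at e1
    refine (Runs.forTo (K := δ ^ s) (T := R ^ (c + 1)) (T' := R ^ (c + 1) * 40 * δ ^ s)
      (fun m τ => Same [36, 43] σ τ ∧ Bdd w τ ∧ τ 43 0 = m ∧ ∃ x : ℕ, τ 36 0 = x ∧
        ((x = δ ^ s ∧ ∀ y < m, ¬ ∀ r, (δ : ℤ) ∣ codeSum N δ s gen y r - N r i) ∨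
          (x < δ ^ s ∧ ∀ r, (δ : ℤ) ∣ codeSum N δ s gen x r - N r i))) hc hB.one_le_w hδw ?_ ?_ ?_
            ?_).imp le_rfl (fun σ' h => ⟨h.1, h.2.1, h.2.2.2⟩)
    · exact ⟨(s1.mono (by decide)).set (by simp) _ _, b1.set (by simp) _ _, Store.set_self _ _ _ _,
        δ ^ s, by rw [Store.set_of_ne _ (by decide), e1], Or.inl ⟨rfl, by simp⟩⟩
    · rintro m τ - ⟨g1, -, g2, -⟩
      exact ⟨g2, by rw [g1.get 19, hG.h19]⟩
    · rintro m τ hm ⟨g1, g2, g3, x, g4, g5⟩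
      have hBτ := hB.mono g1 g2
      have hGτ := hG.mono g1
      obtain ⟨hr, h01, hiff⟩ := hGτ.genTest hBτ g3 (by rw [g1.get 42, h42]) hs
      -- The update `x + t * (m - x)` with a truth value `t` is a selection between `x` and `m`
      -- without branching.
      have hxw : x ≤ δ ^ s := by omega
      have hval : ∃ x' : ℕ, (var 36 + genTest * (var 43 - var 36)).eval τ = x' ∧
          ((x' = δ ^ s ∧ ∀ y < m + 1, ¬ ∀ r, (δ : ℤ) ∣ codeSum N δ s gen y r - N r i) ∨
          (x' < δ ^ s ∧ ∀ r, (δ : ℤ) ∣ codeSum N δ s gen x' r - N r i)) := by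
        simp only [eval_add, eval_mul, eval_sub, eval_var, g3, g4]
        rcases h01 with h | h
        · refine ⟨x, by rw [h]; ring, ?_⟩
          rcases g5 with ⟨g5, g6⟩ | g5
          · refine Or.inl ⟨g5, fun y hy => ?_⟩
            rcases Nat.lt_succ_iff_lt_or_eq.1 hy with hy | rfl
            · exact g6 y hy
            · exact fun hh => hiff.2 hh h
          · exact Or.inr g5
        · exact ⟨m, by rw [h]; ring, Or.inr ⟨hm, hiff.1 (by rw [h]; exact one_ne_zero)⟩⟩
      obtain ⟨x', hx', hx2⟩ := hval
      have hx'w : x' ≤ δ ^ s := by omega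
      refine (h2 w R τ hR hw g2 (by simpa using hr) (by
        rw [hx', Nat.abs_cast]; exact le_trans (by exact_mod_cast hx'w) hδw') (by decide)).imp le_rfl
        fun τ' ⟨t1, t2, t3⟩ => ⟨by rw [t1.get 43, g3], ?_, ?_, Store.set_self _ _ _ _, x', ?_, hx2⟩
      · exact (g1.trans t1 (F'' := [36, 43])).set (by simp) _ _
      · refine t3.set ?_ _ _
        rw [abs_of_nonneg (by positivity)]
        have : (m : ℤ) + 1 ≤ (δ ^ s : ℕ) := by exact_mod_cast hm
        linarith
      · rw [Store.set_of_ne _ (by decide), t2, hx']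
    · nlinarith
  case hT =>
    have := pow_step (a := c + 1) (b := c + 3) hR (by omega)
    nlinarith

theorem codeSum_congr {n : ℕ} {N : Matrix (Fin n) (Fin n) ℤ} {δ s : ℕ} {gen gen' : ℕ → Fin n}
    (h : ∀ j < s, gen' j = gen j) (c : ℕ) (r : Fin n) :
    codeSum N δ s gen' c r = codeSum N δ s gen c r := by
  rw [codeSum, codeSum]
  congr 1
  exact Finset.sum_congr rfl fun j hj => by rw [h j (Finset.mem_range.1 hj)]

/-- Old codes remain valid after a generator is added, since the new digit of a code below `δ ^ s`
is `0`. -/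
theorem codeSum_succ {n : ℕ} {N : Matrix (Fin n) (Fin n) ℤ} {δ s : ℕ} {gen : ℕ → Fin n}
    {c : ℕ} (hc : c < δ ^ s) (r : Fin n) :
    codeSum N δ (s + 1) gen c r = codeSum N δ s gen c r := by
  rw [codeSum, codeSum, Finset.sum_range_succ, Nat.div_eq_of_lt hc]
  simp

/-- In base `δ`, the number `δ ^ s` has the digit `1` at the position `s` and zeros below it, so it
encodes the new generator (trivially for `δ = 1`). -/
theorem dvd_codeSum_pow {n : ℕ} {N : Matrix (Fin n) (Fin n) ℤ} {δ s : ℕ} {gen : ℕ → Fin n}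
    (hδ : δ ≠ 0) (r : Fin n) :
    (δ : ℤ) ∣ codeSum N δ (s + 1) gen (δ ^ s) r - N r (gen s) := by
  have h1 := codeSum_modEq (N := N) (gen := gen) (s := s + 1) (c := δ ^ s) (δ := δ)
    (a := fun j => if j = s then 1 else 0) (fun j hj => by
      split_ifs with h
      · rw [h, Nat.div_self (by positivity)]
        push_cast
        exact Int.mod_modEq _ _
      · obtain ⟨m, rfl⟩ : ∃ m, s = j + (m + 1) := ⟨s - (j + 1), by omega⟩
        rw [pow_add, Nat.mul_div_cancel_left _ (by positivity), pow_succ, Nat.mul_mod_left]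
        simp) r
  have h2 : ∑ j ∈ Finset.range (s + 1), (if j = s then (1 : ℤ) else 0) * N r (gen j) =
      N r (gen s) := by simp
  rw [h2] at h1
  exact Int.modEq_iff_dvd.1 h1.symm

/-- The bounds for the greedy choice of generators. -/
structure GenBound {n : ℕ} (w R X Y : ℕ) (N : Matrix (Fin n) (Fin n) ℤ) (δ : ℕ) : Prop where
  ne_zero : δ ≠ 0
  lt : ∀ {s gen}, Independent N δ s gen → s < R
  le : ∀ {s gen}, Independent N δ s gen → δ ^ s ≤ X ∧ n ^ s ≤ Y
  le_pow : X ≤ 2 ^ w ∧ Y ≤ 2 ^ w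

/-- Record the result of the search for a code. -/
def genUpdate : Program :=
  .seq (assign 21 (var 42) (var 36)) (.seq (assign 22 (var 18) (var 42))
    (.seq (assign 35 0 (eq (var 36) (var 19))) (.seq (assign 19 0 (var 19 * (1 + var 35 * (var 15 - 1))))
      (.seq (assign 23 0 (var 23 * (1 + var 35 * (var 0 - 1)))) (.seq (assign 18 0 (var 18 + var 35))
        (.seq (assign 20 (var 18) (var 19)) (assign 24 (var 18) (var 23))))))))

/-- The arrays that hold the result of the greedy choice of generators. -/
def genArrays : List ℕ := [18, 19, 20, 21, 22, 23, 24, 35, 36, 42, 43]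

/-- The failure value `δ ^ s` of the search is also the right code of the column once that column
becomes the generator number `s`. So the result of the search is stored in either case, and the bit
`b` that records failure drives the remaining updates without branching. -/
theorem eventually_genUpdate : ∀ᶠ c in atTop, ∀ (w R n : ℕ) (σ : Store)
    (N : Matrix (Fin n) (Fin n) ℤ) (δ s : ℕ) (gen : ℕ → Fin n) (code : ℕ → ℕ) (i : Fin n)
    (x X Y : ℕ), Base n w R σ → GenBound w R X Y N δ → GenState N δ i s gen code σ →
    σ 42 0 = (i : ℕ) → σ 36 0 = x →
    ((x = δ ^ s ∧ ∀ y < δ ^ s, ¬ ∀ r, (δ : ℤ) ∣ codeSum N δ s gen y r - N r i) ∨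
      (x < δ ^ s ∧ ∀ r, (δ : ℤ) ∣ codeSum N δ s gen x r - N r i)) →
    Runs (w * c + 2) (R ^ (c + 3)) genUpdate σ fun σ' =>
      Same genArrays σ σ' ∧ Bdd w σ' ∧ σ' 42 0 = (i : ℕ) ∧
        ∃ s' gen' code', GenState N δ (i + 1) s' gen' code' σ' := by
  filter_upwards [eventually_store 21 (i := var 42) (e := var 36) rfl rfl,
    eventually_store 22 (i := var 18) (e := var 42) rfl rfl,
    eventually_put 35 (e := eq (var 36) (var 19)) rfl,
    eventually_put 19 (e := var 19 * (1 + var 35 * (var 15 - 1))) rfl,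
    eventually_put 23 (e := var 23 * (1 + var 35 * (var 0 - 1))) rfl,
    eventually_put 18 (e := var 18 + var 35) rfl,
    eventually_store 20 (i := var 18) (e := var 19) rfl rfl,
    eventually_store 24 (i := var 18) (e := var 23) rfl rfl]
    with c t1 t2 t3 t4 t5 t6 t7 t8 w R n σ N δ s gen code i x X Y hB hbd hG h42 h36 hx
  have hδ := hbd.ne_zero
  have hs := hbd.lt hG.indep
  have hR := hB.hundred_le
  have hw := hB.pow_le
  have hnR := hB.le
  have hxs : x ≤ δ ^ s := by omega
  set b : ℕ := if x = δ ^ s then 1 else 0 with hb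
  have hb1 : b ≤ 1 := by rw [hb]; split_ifs <;> omega
  set gen' : ℕ → Fin n := if x = δ ^ s then Function.update gen s i else gen with hgen'
  have hgen : ∀ j < s, gen' j = gen j := fun j hj => by
    rw [hgen']; split_ifs
    · rw [Function.update_of_ne (by omega)]
    · rfl
  have hind : Independent N δ (s + b) gen' := by
    rcases hx with ⟨hx1, hx2⟩ | ⟨hx1, hx2⟩
    · have hbv : b = 1 := by rw [hb, if_pos hx1]
      rw [hbv]
      intro j hj c hc
      rcases Nat.lt_succ_iff_lt_or_eq.1 hj with h | rfl
      · obtain ⟨r, hr⟩ := hG.indep j h c hc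
        exact ⟨r, by rwa [codeSum_congr fun l hl => hgen l (by omega), hgen j h]⟩
      · have := hx2 c hc
        push Not at this
        obtain ⟨r, hr⟩ := this
        refine ⟨r, ?_⟩
        rw [codeSum_congr fun l hl => hgen l (by omega), hgen', if_pos hx1, Function.update_self]
        exact hr
    · have hbv : b = 0 := by rw [hb, if_neg (by omega)]
      rw [hbv, add_zero, hgen', if_neg (by omega)]
      exact hG.indep
  have hbnd : δ ^ (s + b) ≤ 2 ^ w ∧ n ^ (s + b) ≤ 2 ^ w :=
    ⟨(hbd.le hind).1.trans hbd.le_pow.1, (hbd.le hind).2.trans hbd.le_pow.2⟩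
  have hbnd1 : ((δ ^ (s + b) : ℕ) : ℤ) ≤ 2 ^ w := by exact_mod_cast hbnd.1
  have hbnd2 : ((n ^ (s + b) : ℕ) : ℤ) ≤ 2 ^ w := by exact_mod_cast hbnd.2
  have hi := i.2
  apply Runs.of_time
  case h =>
    apply Runs.then (t1 w R σ hR hw hB.bdd (by simp) (by simp) (by
      simp only [eval_var]; exact hB.bdd 36 (by decide) (by decide) 0))
    rintro σ₁ ⟨s1, e1, b1⟩
    apply Runs.then (t2 w R σ₁ hR hw b1 (by simp) (by simp) (by
      simp only [eval_var]; exact b1 42 (by decide) (by decide) 0))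
    rintro σ₂ ⟨s2, e2, b2⟩
    have s2' : Same [21, 22] σ σ₂ := s1.trans s2
    have v3 : (eq (var 36) (var 19)).eval σ₂ = b := by
      simp only [eval_eq, eval_var, s2'.get 36, s2'.get 19, h36, hG.h19, hb, Nat.cast_inj]
      split_ifs <;> simp
    have p3 := t3 w R σ₂ hR hw b2 (by simp) (by
      rw [v3]; exact hB.abs_le_two_pow (by positivity) (by omega)) (by decide)
    rw [v3] at p3
    apply Runs.then p3
    rintro σ₃ ⟨s3, e3, b3⟩
    have s3' : Same [21, 22, 35] σ σ₃ := s2'.trans s3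
    have v4 : (var 19 * (1 + var 35 * (var 15 - 1))).eval σ₃ = (δ ^ (s + b) : ℕ) := by
      simp only [eval_mul, eval_var, eval_add, eval_sub, eval_ofNat, e3, s3'.get 19, s3'.get 15,
        hG.h19, hG.h15]
      have : b = 0 ∨ b = 1 := by omega
      rcases this with h | h <;> rw [h] <;> push_cast <;> ring
    have p4 := t4 w R σ₃ hR hw b3 (by simp) (by rw [v4, Nat.abs_cast]; exact hbnd1) (by decide)
    rw [v4] at p4
    apply Runs.then p4
    rintro σ₄ ⟨s4, e4, b4⟩
    have s4' : Same [21, 22, 35, 19] σ σ₄ := s3'.trans s4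
    have e4' : σ₄ 35 0 = b := by rw [s4.get 35, e3]
    have v5 : (var 23 * (1 + var 35 * (var 0 - 1))).eval σ₄ = (n ^ (s + b) : ℕ) := by
      simp only [eval_mul, eval_var, eval_add, eval_sub, eval_ofNat, e4', s4'.get 23, s4'.get 0,
        hG.h23, hB.h0]
      have : b = 0 ∨ b = 1 := by omega
      rcases this with h | h <;> rw [h] <;> push_cast <;> ring
    have p5 := t5 w R σ₄ hR hw b4 (by simp) (by rw [v5, Nat.abs_cast]; exact hbnd2) (by decide)
    rw [v5] at p5
    apply Runs.then p5
    rintro σ₅ ⟨s5, e5, b5⟩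
    have s5' : Same [21, 22, 35, 19, 23] σ σ₅ := s4'.trans s5
    have v6 : (var 18 + var 35).eval σ₅ = (s + b : ℕ) := by
      simp only [eval_var, eval_add, s5'.get 18, hG.h18, s5.get 35, e4']
      push_cast; rfl
    have p6 := t6 w R σ₅ hR hw b5 (by simp) (by
      rw [v6]; exact hB.abs_le_two_pow (by positivity) (by omega)) (by decide)
    rw [v6] at p6
    apply Runs.then p6
    rintro σ₆ ⟨s6, e6, b6⟩
    have s6' : Same [21, 22, 35, 19, 23, 18] σ σ₆ := s5'.trans s6
    have e6' : σ₆ 19 0 = (δ ^ (s + b) : ℕ) := by rw [s6.get 19, s5.get 19, e4]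
    have p7 := t7 w R σ₆ hR hw b6 (by simp) (by simp) (by
      rw [eval_var, e6', Nat.abs_cast]; exact hbnd1)
    simp only [eval_var, e6, e6'] at p7
    apply Runs.then p7
    rintro σ₇ ⟨s7, e7, b7⟩
    have s7' : Same [21, 22, 35, 19, 23, 18, 20] σ σ₇ := s6'.trans s7
    have e8 : σ₇ 23 0 = (n ^ (s + b) : ℕ) := by rw [s7.get 23, s6.get 23, e5]
    have e9 : σ₇ 18 0 = (s + b : ℕ) := by rw [s7.get 18, e6]
    have p8 := t8 w R σ₇ hR hw b7 (by simp) (by simp) (by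
      rw [eval_var, e8, Nat.abs_cast]; exact hbnd2)
    simp only [eval_var, e8, e9] at p8
    refine p8.imp le_rfl fun σ₈ ⟨s8, e10, b8⟩ => ?_
    have s8' : Same [21, 22, 35, 19, 23, 18, 20, 24] σ σ₈ := s7'.trans s8
    refine ⟨s8'.mono, b8, by rw [s8'.get 42, h42], s + b, gen', fun j => if j = i then x else code j, ?_⟩
    -- The column is written as generator number `s` in any case; the entry counts only if `s`
    -- grows.
    have r2 : ∀ j, σ₈ 22 j = if j = s then (i : ℤ) else σ 22 j := fun j => by
      rw [s8.get 22, s7.get 22, s6.get 22, s5.get 22, s4.get 22, s3.get 22, e2 j]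
      simp only [eval_var, s1.get 18, s1.get 22, s1.get 42, hG.h18, h42]
    constructor
    · rw [s8'.get 14]; exact hG.h14
    · rw [s8'.get 15]; exact hG.h15
    · rw [s8.get 18, e9]
    · rw [s8.get 19, s7.get 19, e6']
    · rw [s8.get 23, e8]
    · intro j hj
      rw [s8.get 20, e7]
      split_ifs with h
      · rw [show j = s + b by exact_mod_cast h]
      · rw [s6'.get 20]
        refine hG.h20 j ?_
        have : j ≠ s + b := fun h' => h (by exact_mod_cast h')
        omega
    · intro j hj
      rw [e10]
      split_ifs with h
      · rw [show j = s + b by exact_mod_cast h]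
      · rw [s7'.get 24]
        refine hG.h24 j ?_
        have : j ≠ s + b := fun h' => h (by exact_mod_cast h')
        omega
    · intro j hj
      rw [r2]
      by_cases h : j = s
      · have hb' : x = δ ^ s := by
          by_contra hne
          have : b = 0 := by rw [hb, if_neg hne]
          omega
        rw [h, if_pos rfl, hgen', if_pos hb', Function.update_self]
      · have hjs : j < s := by omega
        rw [if_neg (by exact_mod_cast h), hG.h22 j hjs, hgen j hjs]
    · intro j hj
      rw [s8.get 21, s7.get 21, s6.get 21, s5.get 21, s4.get 21, s3.get 21, s2.get 21, e1]
      simp only [eval_var, h42, h36, Nat.cast_inj]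
      split_ifs with h
      · rfl
      · exact hG.h21 j (by omega)
    · intro j hj
      have hmono : δ ^ s ≤ δ ^ (s + b) := Nat.pow_le_pow_right (Nat.pos_of_ne_zero hδ) (by omega)
      by_cases h : j = i
      · simp only [h, if_true]
        rcases hx with ⟨hx1, hx2⟩ | ⟨hx1, hx2⟩
        · have hbv : b = 1 := by rw [hb, if_pos hx1]
          -- Modulo `1` the code `0` fits every column, so a failed search implies `δ ≥ 2`, and `δ ^
          -- s < δ ^ (s + 1)`.
          have hδ1 : δ ≠ 1 := fun h1 => hx2 0 (by positivity) fun r => by simp [h1]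
          rw [hbv, hx1, pow_succ]
          have : 0 < δ ^ s := by positivity
          have : 2 ≤ δ := by omega
          nlinarith
        · omega
      · simp only [h, if_false]
        exact (hG.lt j (by omega)).trans_le hmono
    · intro j hj r
      by_cases h : (j : ℕ) = i
      · obtain rfl : j = i := Fin.ext h
        simp only [if_true]
        rcases hx with ⟨hx1, hx2⟩ | ⟨hx1, hx2⟩
        · have hbv : b = 1 := by rw [hb, if_pos hx1]
          have := dvd_codeSum_pow (N := N) (s := s) (gen := gen') hδ r
          rw [hgen', if_pos hx1] at this ⊢
          rw [hbv, hx1]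
          rwa [Function.update_self] at this
        · have hbv : b = 0 := by rw [hb, if_neg (by omega)]
          rw [hbv, add_zero, hgen', if_neg (by omega)]
          exact hx2 r
      · simp only [h, if_false]
        have hj' : (j : ℕ) < i := by omega
        have h1 := hG.dvd j hj' r
        have : b = 0 ∨ b = 1 := by omega
        rcases this with h2 | h2
        · rw [h2, add_zero, codeSum_congr hgen]; exact h1
        · rw [h2, codeSum_succ (hG.lt j hj'), codeSum_congr hgen]; exact h1
    · exact hind
  case hT =>
    have := pow_step (a := c + 1) (b := c + 3) hR (by omega)
    omega

/-- The greedy choice of generators. -/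
def genProg : Program :=
  .seq (assign 18 0 0) (.seq (assign 19 0 1) (.seq (assign 23 0 1) (.seq (assign 20 0 1)
    (.seq (assign 24 0 1) (forTo 42 0 (.seq genSearch genUpdate))))))

theorem eventually_gen : ∀ᶠ c in atTop, ∀ (w R n : ℕ) (σ : Store)
    (N : Matrix (Fin n) (Fin n) ℤ) (δ X Y : ℕ), Base n w R σ → GenBound w R X Y N δ →
    HoldsMat (σ 14) N → σ 15 0 = δ →
    Runs (w * c + 2) (R ^ (c + 7) * X) genProg σ fun σ' => Same genArrays σ σ' ∧ Bdd w σ' ∧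
      ∃ s gen code, GenState N δ n s gen code σ' := by
  filter_upwards [eventually_put 18 (e := 0) rfl, eventually_put 19 (e := 1) rfl,
    eventually_put 23 (e := 1) rfl, eventually_store 20 (i := 0) (e := 1) rfl rfl,
    eventually_store 24 (i := 0) (e := 1) rfl rfl, eventually_genSearch, eventually_genUpdate,
    eventually_ge_atTop 10] with c t1 t2 t3 t4 t5 t6 t7 hc w R n σ N δ X Y hB hbd h14 h15
  have hR := hB.hundred_le
  have hw := hB.pow_le
  have hnR := hB.le
  have hone : |((1 : ℕ) : ℤ)| ≤ 2 ^ w := hB.abs_le_two_pow (by norm_num) (by omega)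
  have hzero : |((0 : ℕ) : ℤ)| ≤ 2 ^ w := hB.abs_le_two_pow (by norm_num) (by omega)
  have hind0 : Independent N δ 0 fun _ => ⟨0, hB.one_le⟩ := fun j hj => absurd hj (by omega)
  have hX : 1 ≤ X := by simpa using (hbd.le hind0).1
  apply Runs.of_time
  case h =>
    apply Runs.then (t1 w R σ hR hw hB.bdd (by simp) hzero (by decide))
    rintro σ₁ ⟨s1, e1, b1⟩
    apply Runs.then (t2 w R σ₁ hR hw b1 (by simp) hone (by decide))
    rintro σ₂ ⟨s2, e2, b2⟩
    apply Runs.then (t3 w R σ₂ hR hw b2 (by simp) hone (by decide))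
    rintro σ₃ ⟨s3, e3, b3⟩
    apply Runs.then (t4 w R σ₃ hR hw b3 (by simp) (by simp) hone)
    rintro σ₄ ⟨s4, e4, b4⟩
    apply Runs.then (t5 w R σ₄ hR hw b4 (by simp) (by simp) hone)
    rintro σ₅ ⟨s5, e5, b5⟩
    have s5' : Same [18, 19, 23, 20, 24] σ σ₅ :=
      (((s1.trans s2 (F'' := [18, 19])).trans s3 (F'' := [18, 19, 23])).trans s4
        (F'' := [18, 19, 23, 20])).trans s5
    refine (Runs.forTo (K := n) (T := R ^ (c + 3) * X + R ^ (c + 3)) (T' := R ^ (c + 6) * X)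
      (fun k τ => Same genArrays σ τ ∧ Bdd w τ ∧ τ 42 0 = k ∧
        ∃ s gen code, GenState N δ k s gen code τ) hc hB.one_le_w hB.self_le_two_pow ?_ ?_ ?_
          ?_).imp le_rfl (fun σ' h => ⟨h.1, h.2.1, h.2.2.2⟩)
    · refine ⟨(s5'.mono (by decide)).set (by decide) _ _, b5.set (by simp) _ _,
        Store.set_self _ _ _ _, 0, fun _ => ⟨0, hB.one_le⟩, fun _ => 0, ?_⟩
      have s6 : Same [42] σ₅ (σ₅.set 42 0 0) := (Same.refl _ _).set (by simp) _ _
      constructor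
      · rw [s6.get 14, s5'.get 14]; exact h14
      · rw [s6.get 15, s5'.get 15]; exact h15
      · rw [s6.get 18, s5.get 18, s4.get 18, s3.get 18, s2.get 18, e1]; rfl
      · rw [s6.get 19, s5.get 19, s4.get 19, s3.get 19, e2]; simp
      · rw [s6.get 23, s5.get 23, s4.get 23, e3]; simp
      · intro j hj
        obtain rfl : j = 0 := by omega
        rw [s6.get 20, s5.get 20, e4]; simp
      · intro j hj
        obtain rfl : j = 0 := by omega
        rw [s6.get 24, e5]; simp
      · exact fun j hj => absurd hj (by omega)
      · exact fun j hj => absurd hj (by omega)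
      · exact fun j hj => absurd hj (by omega)
      · exact fun j hj => absurd hj (by omega)
      · exact hind0
    · rintro k τ - ⟨g1, -, g2, -⟩
      exact ⟨g2, by rw [g1.get 0, hB.h0]⟩
    · rintro k τ hk ⟨g1, g2, g3, s, gen, code, g4⟩
      have hBτ := hB.mono g1 g2
      have hle := hbd.le g4.indep
      apply Runs.of_time
      case h =>
        apply Runs.then (t6 w R n τ N δ k s gen code ⟨k, hk⟩ hBτ g4 g3 (hbd.lt g4.indep).le
          (hle.1.trans hbd.le_pow.1) hbd.ne_zero)
        rintro τ₁ ⟨r1, d1, x, d2, d3⟩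
        have p7 := t7 w R n τ₁ N δ s gen code ⟨k, hk⟩ x X Y (hBτ.mono r1 d1) hbd (g4.mono r1)
          (by rw [r1.get 42, g3]) d2 d3
        refine p7.imp le_rfl fun τ₂ ⟨r2, d4, d5, s', gen', code', d6⟩ => ⟨d5, ?_, ?_,
          Store.set_self _ _ _ _, s', gen', code', ?_⟩
        · exact ((g1.trans r1 (F'' := genArrays)).trans r2 (F'' := genArrays)).set (by decide) _ _
        · exact d4.set (hB.abs_succ_le (k := k) (by omega)) _ _
        · exact d6.mono (F := [42]) ((Same.refl _ _).set (by simp) _ _)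
      case hT =>
        have := Nat.mul_le_mul_left (R ^ (c + 3)) hle.1
        omega
    · have h1 := loop_time_le (a := c + 4) hR (by omega) (show n ≤ R by omega)
      have h2 := pow_step (a := c + 3) (b := c + 4) hR (by omega)
      have h3 : R ^ (c + 3) ≤ R ^ (c + 3) * X := Nat.le_mul_of_pos_right _ hX
      have h4 : R ^ (c + 3) * X + R ^ (c + 3) + 12 ≤ (R ^ (c + 4) + 12) * X := by
        have h5 := Nat.mul_le_mul_right X h2
        rw [mul_assoc] at h5
        rw [add_mul]
        omega
      calc n * (R ^ (c + 3) * X + R ^ (c + 3) + 12) + 15 ≤ n * ((R ^ (c + 4) + 12) * X) + 15 * X := by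
            have := Nat.mul_le_mul_left n h4
            omega
        _ = (n * (R ^ (c + 4) + 12) + 15) * X := by ring
        _ ≤ _ := Nat.mul_le_mul_right _ h1
  case hT =>
    have h1 := pow_step (a := c + 1) (b := c + 6) hR (by omega)
    have h2 := pow_step (a := c + 6) (b := c + 7) hR (by omega)
    have h3 := Nat.mul_le_mul_right X h2
    have h4 : R ^ (c + 6) ≤ R ^ (c + 6) * X := Nat.le_mul_of_pos_right _ hX
    rw [mul_assoc] at h3
    omega

end RAM

/-! ### The test of a guess -/

namespace RAM

open Filter HExpr

/-- The indicator of a proposition. -/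
noncomputable def ind (P : Prop) : ℤ := open scoped Classical in if P then 1 else 0

theorem ind_of {P : Prop} (h : P) : ind P = 1 := by simp [ind, h]

theorem ind_of_not {P : Prop} (h : ¬ P) : ind P = 0 := by simp [ind, h]

@[simp] theorem ind_eq_zero {P : Prop} : ind P = 0 ↔ ¬ P := by
  unfold ind; split_ifs <;> simp [*]

theorem ind_ne_zero {P : Prop} : ind P ≠ 0 ↔ P := by simp

theorem ind_mul {P Q : Prop} : ind P * ind Q = ind (P ∧ Q) := by
  by_cases hP : P <;> by_cases hQ : Q <;> simp [ind, hP, hQ]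

theorem abs_ind_le (P : Prop) : |ind P| ≤ 1 := by
  by_cases hP : P <;> simp [ind, hP]

theorem HExpr.eval_eq_ind (x y : HExpr) (σ : Store) :
    (eq x y).eval σ = ind (x.eval σ = y.eval σ) := by
  rw [eval_eq]; split_ifs with h <;> simp [ind, h]

theorem HExpr.eval_all_ind {v : ℕ} {x : HExpr} {σ : Store} {m : ℕ} (h : x.eval σ = m) (y : HExpr) :
    (all v x y).eval σ = ind (∀ k : Fin m, y.eval (σ.set v 0 (k : ℕ)) ≠ 0) := by
  have h1 := eval_all_ne_zero x y σ (v := v) (by rw [h]; positivity)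
  rw [h, Int.toNat_natCast] at h1
  have h2 : (all v x y).eval σ ≠ 0 ↔ ∀ k : Fin m, y.eval (σ.set v 0 (k : ℕ)) ≠ 0 := by
    rw [h1, Fin.forall_iff]
  rcases eval_all_eq x y σ (v := v) with h0 | h0
  · rw [h0, ind_of_not fun h => h2.2 h h0]
  · rw [h0, ind_of (h2.1 (by rw [h0]; exact one_ne_zero))]

/-- The memory holds the two systems, the inverse of the first one, and its generators. -/
structure Prep {n : ℕ} (S T : ScaledSystem n) (N : Matrix (Fin n) (Fin n) ℤ) (δ s : ℕ)
    (gen : ℕ → Fin n) (code : ℕ → ℕ) (τ : Store) : Prop where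
  h10 : HoldsVec (τ 10) S.g
  h2 : HoldsVec (τ 2) S.b
  h12 : HoldsVec (τ 12) T.g
  h4 : HoldsVec (τ 4) T.b
  h13 : HoldsMat (τ 13) T.A
  h17 : HoldsVec (τ 17) (Matrix.vecMul (S.A (Fin.last n)) N)
  state : GenState N δ n s gen code τ

/-- The memory holds a guess. -/
structure Guess {n : ℕ} (T : ScaledSystem n) (N' : Matrix (Fin n) (Fin n) ℤ) (δ' : ℕ)
    (p : Fin (n + 1)) (g : ℕ) (τ : Store) : Prop where
  h25 : HoldsMat (τ 25) N'
  h26 : τ 26 0 = δ'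
  h28 : HoldsVec (τ 28) (Matrix.vecMul (T.A p) N')
  h44 : τ 44 0 = (p : ℕ)
  h45 : τ 45 0 = g

/-- The arrays that are used for the test of a guess. -/
def testArrays : List ℕ := [29, 30, 31, 32, 33, 34, 35, 40]

section Mono

variable {n : ℕ} {S T : ScaledSystem n} {N N' : Matrix (Fin n) (Fin n) ℤ} {δ δ' s : ℕ}
  {gen : ℕ → Fin n} {code : ℕ → ℕ} {p : Fin (n + 1)} {g : ℕ} {τ τ' : Store}

theorem Prep.mono (h : Prep S T N δ s gen code τ) {F : List ℕ} (hs : Same F τ τ')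
    (hF : (10 ∉ F ∧ 2 ∉ F ∧ 12 ∉ F ∧ 4 ∉ F ∧ 13 ∉ F ∧ 17 ∉ F) ∧ 14 ∉ F ∧ 15 ∉ F ∧ 18 ∉ F ∧ 19 ∉ F ∧
      20 ∉ F ∧ 21 ∉ F ∧ 22 ∉ F ∧ 23 ∉ F ∧ 24 ∉ F := by decide) : Prep S T N δ s gen code τ' where
  h10 := by rw [hs.get 10 (by decide) (by decide) hF.1.1]; exact h.h10
  h2 := by rw [hs.get 2 (by decide) (by decide) hF.1.2.1]; exact h.h2
  h12 := by rw [hs.get 12 (by decide) (by decide) hF.1.2.2.1]; exact h.h12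
  h4 := by rw [hs.get 4 (by decide) (by decide) hF.1.2.2.2.1]; exact h.h4
  h13 := by rw [hs.get 13 (by decide) (by decide) hF.1.2.2.2.2.1]; exact h.h13
  h17 := by rw [hs.get 17 (by decide) (by decide) hF.1.2.2.2.2.2]; exact h.h17
  state := h.state.mono hs hF.2

theorem Guess.mono (h : Guess T N' δ' p g τ) {F : List ℕ} (hs : Same F τ τ')
    (hF : 25 ∉ F ∧ 26 ∉ F ∧ 28 ∉ F ∧ 44 ∉ F ∧ 45 ∉ F := by decide) : Guess T N' δ' p g τ' where
  h25 := by rw [hs.get 25 (by decide) (by decide) hF.1]; exact h.h25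
  h26 := by rw [hs.get 26 (by decide) (by decide) hF.2.1]; exact h.h26
  h28 := by rw [hs.get 28 (by decide) (by decide) hF.2.2.1]; exact h.h28
  h44 := by rw [hs.get 44 (by decide) (by decide) hF.2.2.2.1]; exact h.h44
  h45 := by rw [hs.get 45 (by decide) (by decide) hF.2.2.2.2]; exact h.h45

end Mono

/-- The combination of the guessed images of the generators that belongs to a code. -/
def imageEntry : HExpr :=
  sum 61 (var 18) ((read 21 (var 40 % var 0) / read 20 (var 61)) % var 15 *
    read 25 ((var 45 / read 24 (var 61)) % var 0 + var 0 * (var 40 / var 0))) % var 15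

/-- The test for `LooksLike`. -/
def likeEntry : HExpr :=
  all 60 (var 0) (eq ((read 29 (var 40 / var 0 + var 0 * var 60) -
      read 25 (var 40 % var 0 + var 0 * var 60)) % var 15) 0) *
    (eq (read 17 (var 40 / var 0)) (read 28 (var 40 % var 0)) *
      eq ((read 4 (var 40 % var 0 + (1 - lt (var 40 % var 0) (var 44))) * read 10 (var 40 / var 0) -
        read 2 (var 40 / var 0) * read 12 (var 40 % var 0 + (1 - lt (var 40 % var 0) (var 44)))) %
        (read 10 (var 40 / var 0) * read 12 (var 40 % var 0 + (1 - lt (var 40 % var 0) (var 44))))) 0)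

/-- The search for a partner of the same rank. -/
def matchEntry : HExpr :=
  find 60 (var 0) (read 31 (var 60 + var 0 * var 40) *
    eq (sum 61 (var 0) (lt (var 61) (var 40) * read 31 (var 60 + var 0 * var 61)))
      (sum 61 (var 0) (lt (var 61) (var 60) * read 31 (var 61 + var 0 * var 40)))) % var 0

/-- The values of `rowMap`. -/
def rowMapEntry : HExpr :=
  lt (var 40) (var 0) * (read 30 (var 40) + (1 - lt (read 30 (var 40)) (var 44))) +
    (1 - lt (var 40) (var 0)) * var 44

/-- The values of `shift`. -/
def shiftEntry : HExpr :=
  (read 4 (read 32 (var 40)) * read 10 (var 40) - read 2 (var 40) * read 12 (read 32 (var 40))) /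
    (read 10 (var 40) * read 12 (read 32 (var 40)))

variable {n w R : ℕ} {S T : ScaledSystem n} {N N' : Matrix (Fin n) (Fin n) ℤ} {δ δ' s : ℕ}
  {gen : ℕ → Fin n} {code : ℕ → ℕ} {p : Fin (n + 1)} {g : ℕ} {τ : Store}

theorem imageEntry_spec (hB : Base n w R τ) (hP : Prep S T N δ s gen code τ)
    (hG : Guess T N' δ' p g τ) (hs : s ≤ R) {x : ℕ → Fin n}
    (hx : ∀ j, (x j : ℕ) = g / n ^ j % n) (r i : Fin n) :
    imageEntry.Rng R (τ.set 40 0 ((i : ℕ) + (n : ℤ) * (r : ℕ))) ∧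
      imageEntry.eval (τ.set 40 0 ((i : ℕ) + (n : ℤ) * (r : ℕ))) = codeSum N' δ s x (code i) r := by
  have hst := hP.state
  refine ⟨by simp [imageEntry, Store.set_apply, hst.h18, hs], ?_⟩
  have e1 : ∑ j ∈ Finset.range s, τ 21 (i : ℕ) / τ 20 j % δ * τ 25 (τ 45 0 / τ 24 j % n + n * (r : ℕ)) =
      ∑ j ∈ Finset.range s, ((code i / δ ^ j % δ : ℕ) : ℤ) * N' r (x j) := by
    refine Finset.sum_congr rfl fun j hj => ?_
    have hj := Finset.mem_range.1 hj
    rw [hst.h20 j hj.le, hst.h24 j hj.le, hst.h21 i i.2, hG.h45, ← hG.h25, hx]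
    push_cast
    rfl
  simp [imageEntry, Store.set_apply, hst.h18, hB.h0, hst.h15, e1, codeSum]

theorem likeEntry_spec (hB : Base n w R τ) (hP : Prep S T N δ s gen code τ)
    (hG : Guess T N' δ' p g τ) {x : ℕ → Fin n}
    (h29 : HoldsMat (τ 29) fun r i : Fin n => codeSum N' δ s x (code i) r) (i i' : Fin n) :
    likeEntry.Rng R (τ.set 40 0 ((i' : ℕ) + (n : ℤ) * (i : ℕ))) ∧
      likeEntry.eval (τ.set 40 0 ((i' : ℕ) + (n : ℤ) * (i : ℕ))) =
        ind (LooksLike S T N N' δ s x (fun i => code i) p i i') := by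
  have hst := hP.state
  have hn := hB.le
  refine ⟨by simp [likeEntry, Store.set_apply, hB.h0, show n ≤ R by omega], ?_⟩
  have hr := coe_succAbove p i'
  have h10 := hP.h10 i.castSucc
  have h2 := hP.h2 i.castSucc
  rw [Fin.val_castSucc] at h10 h2
  have e4 := hP.h4 (p.succAbove i')
  have e12 := hP.h12 (p.succAbove i')
  rw [hr] at e4 e12
  rw [likeEntry, eval_mul, eval_mul, eval_eq_ind, eval_eq_ind, eval_all_ind (m := n)
    (by simp [Store.set_apply, hB.h0]), ind_mul, ind_mul]
  refine congrArg ind (propext (and_congr (forall_congr' fun r => ?_) (and_congr ?_ ?_)))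
  · rw [eval_eq_ind, ind_ne_zero]
    have e1 := h29 r i
    have e2 := hG.h25 r i'
    simp only at e1
    rw [Int.dvd_iff_emod_eq_zero]
    simp [Store.set_apply, hB.h0, hst.h15, e1, e2]
  · simp [Store.set_apply, hB.h0, hP.h17 i, hG.h28 i']
  · simp only [eval_mod, eval_sub, eval_mul, eval_read, eval_div, eval_var, eval_add, eval_ofNat,
      eval_lt, Store.set_apply, hB.h0, hG.h44]
    rw [Int.dvd_iff_emod_eq_zero]
    simp [h10, h2]
    simp only [Nat.cast_lt] at e4 e12
    simp [e4, e12]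

/-- A failed search returns `n`, and the reduction modulo `n` turns this into a legal index. So the
matching is always a total function, and it is constrained only where a partner of the right rank
exists. -/
theorem matchEntry_spec (hB : Base n w R τ) {m : Fin n → Fin n → Prop}
    (h31 : HoldsMat (τ 31) fun i i' => ind (m i i')) (i : Fin n) :
    matchEntry.Rng R (τ.set 40 0 (i : ℕ)) ∧ ∃ i' : Fin n,
      matchEntry.eval (τ.set 40 0 (i : ℕ)) = (i' : ℕ) ∧ ((∃ j, Ranked m i j) → Ranked m i i') := by
  have hn := hB.le
  have hn1 := hB.one_le
  refine ⟨by simp [matchEntry, Store.set_apply, hB.h0, show n ≤ R by omega], ?_⟩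
  set f : ℕ → ℤ := fun k => (read 31 (var 60 + var 0 * var 40) *
    eq (sum 61 (var 0) (lt (var 61) (var 40) * read 31 (var 60 + var 0 * var 61)))
      (sum 61 (var 0) (lt (var 61) (var 60) * read 31 (var 61 + var 0 * var 40)))).eval
        ((τ.set 40 0 (i : ℕ)).set 60 0 k) with hf
  have hcount : ∀ P : Fin n → Prop, ∑ k : Fin n, ind (P k) = ({k | P k}.ncard : ℕ) := fun P => by
    classical
    have : ∀ k, ind (P k) = if P k then 1 else 0 := fun k => by unfold ind; congr
    simp only [this, Finset.sum_boole]
    rw [← Set.ncard_coe_finset]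
    congr 2
    simp
  have hfk : ∀ k : Fin n, f k ≠ 0 ↔ Ranked m i k := by
    intro k
    have e1 := h31 i k
    rw [hf]
    simp only
    rw [eval_mul, eval_eq_ind]
    have e2 : ∀ (a b : Fin n) (P : Prop), (if a < b then ind P else 0) = ind (a < b ∧ P) := fun a b P => by
      by_cases h : a < b <;> by_cases hP : P <;> simp [ind, h, hP]
    have e3 : (sum 61 (var 0) (lt (var 61) (var 40) * read 31 (var 60 + var 0 * var 61))).eval
        ((τ.set 40 0 (i : ℕ)).set 60 0 (k : ℕ)) = ({l | l < i ∧ m l k}.ncard : ℕ) := by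
      rw [← hcount]
      simp [Store.set_apply, hB.h0, Finset.sum_range, h31 _ _, e2]
    have e4 : (sum 61 (var 0) (lt (var 61) (var 60) * read 31 (var 61 + var 0 * var 40))).eval
        ((τ.set 40 0 (i : ℕ)).set 60 0 (k : ℕ)) = ({l | l < k ∧ m i l}.ncard : ℕ) := by
      rw [← hcount]
      simp [Store.set_apply, hB.h0, Finset.sum_range, h31 _ _, e2]
    rw [e3, e4]
    have e5 : (read 31 (var 60 + var 0 * var 40)).eval ((τ.set 40 0 (i : ℕ)).set 60 0 (k : ℕ)) =
        ind (m i k) := by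
      simp [Store.set_apply, hB.h0, e1]
    rw [e5, ind_mul, ind_ne_zero, Ranked, Nat.cast_inj]
  have hev : matchEntry.eval (τ.set 40 0 (i : ℕ)) = ((scan n f n % n : ℕ) : ℤ) := by
    rw [matchEntry, eval_mod, eval_find]
    simp only [eval_var, Store.set_of_ne τ (show 0 ≠ 40 by decide), hB.h0, Int.toNat_natCast]
    push_cast
    rfl
  refine ⟨⟨scan n f n % n, Nat.mod_lt _ hn1⟩, hev, fun ⟨j, hj⟩ => ?_⟩
  rcases scan_spec (f := f) (le_refl n) with ⟨-, h2⟩ | ⟨h2, h3, -⟩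
  · exact absurd (h2 j j.2) ((hfk j).2 hj)
  · have := (hfk ⟨_, h2⟩).1 h3
    convert this using 2
    exact Nat.mod_eq_of_lt h2

theorem rowMapEntry_spec (hB : Base n w R τ) (hG : Guess T N' δ' p g τ) {π : Fin n → Fin n}
    (h30 : HoldsVec (τ 30) fun i => ((π i : ℕ) : ℤ)) (i : Fin (n + 1)) :
    rowMapEntry.eval (τ.set 40 0 (i : ℕ)) = (rowMap p π i : ℕ) := by
  induction i using Fin.lastCases with
  | last => simp [rowMapEntry, Store.set_apply, hB.h0, hG.h44]
  | cast i =>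
    have := h30 i
    simp only at this
    rw [rowMap_castSucc, coe_succAbove]
    simp [rowMapEntry, Store.set_apply, hB.h0, hG.h44, this]

theorem shiftEntry_spec (hP : Prep S T N δ s gen code τ)
    {ro : Fin (n + 1) → Fin (n + 1)} (h32 : HoldsVec (τ 32) fun i => ((ro i : ℕ) : ℤ))
    (i : Fin (n + 1)) : shiftEntry.eval (τ.set 40 0 (i : ℕ)) = shift S T ro i := by
  have := h32 i
  simp only at this
  simp [shiftEntry, Store.set_apply, this, hP.h10 _, hP.h12 _, hP.h2 _, hP.h4 _, shift]

/-- The test whether `shift` divides exactly. -/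
def shiftTest : HExpr :=
  all 60 (var 38) (eq (read 33 (var 60) * (read 10 (var 60) * read 12 (read 32 (var 60))))
    (read 4 (read 32 (var 60)) * read 10 (var 60) - read 2 (var 60) * read 12 (read 32 (var 60))))

/-- The test whether the rows are integral combinations. -/
def rowTest : HExpr :=
  all 60 (var 0) (all 61 (var 0) (eq (sum 62 (var 0) (read 14 (var 62 + var 0 * var 60) *
    read 13 (var 61 + var 0 * read 32 (var 62))) % var 15) 0)) *
  all 61 (var 0) (eq (sum 62 (var 0) (read 17 (var 62) *
    read 13 (var 61 + var 0 * read 32 (var 62)))) (var 15 * read 13 (var 61 + var 0 * var 44)))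

/-- The test whether the shifts are integral combinations. -/
def shiftRowTest : HExpr :=
  all 60 (var 0) (eq (sum 62 (var 0) (read 14 (var 62 + var 0 * var 60) * read 33 (var 62)) % var 15) 0) *
  eq (sum 62 (var 0) (read 17 (var 62) * read 33 (var 62))) (var 15 * read 33 (var 0))

/-- The test for `Verified`. -/
def verifyTest : HExpr :=
  eq (var 26) (var 15) *
  (all 60 (var 0) (all 61 (var 60) (1 - eq (read 30 (var 60)) (read 30 (var 61)))) *
    (shiftTest * (rowTest * shiftRowTest)))

theorem verifyTest_spec (hB : Base n w R τ) (hP : Prep S T N δ s gen code τ)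
    (hG : Guess T N' δ' p g τ) {π : Fin n → Fin n}
    (h30 : HoldsVec (τ 30) fun i => ((π i : ℕ) : ℤ))
    (h32 : HoldsVec (τ 32) fun i => ((rowMap p π i : ℕ) : ℤ))
    (h33 : HoldsVec (τ 33) (shift S T (rowMap p π))) :
    verifyTest.Rng R τ ∧ verifyTest.eval τ = ind (Verified S T N δ δ' p π) := by
  have hst := hP.state
  have hn := hB.le
  have hnR : n ≤ R := by omega
  have h32' : ∀ i : Fin n, τ 32 (i : ℕ) = ((p.succAbove (π i) : ℕ) : ℤ) := fun i => by
    have := h32 i.castSucc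
    simpa using this
  have h33' : ∀ i : Fin n, τ 33 (i : ℕ) = shift S T (rowMap p π) i.castSucc := fun i => by
    have := h33 i.castSucc
    simpa using this
  have h33n : τ 33 n = shift S T (rowMap p π) (Fin.last n) := by
    have := h33 (Fin.last n)
    simpa using this
  refine ⟨?_, ?_⟩
  · simp [verifyTest, shiftTest, rowTest, shiftRowTest, Store.set_apply, hB.h0, hB.h38, hnR]
    exact ⟨fun k hk => by omega, by positivity, by omega⟩
  · have e1 : (eq (var 26) (var 15)).eval τ = ind (δ' = δ) := by
      rw [eval_eq_ind]; simp [hG.h26, hst.h15]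
    have e2 : (all 60 (var 0) (all 61 (var 60) (1 - eq (read 30 (var 60)) (read 30 (var 61))))).eval τ =
        ind π.Injective := by
      rw [eval_all_ind (m := n) (by simp [hB.h0])]
      congr 1
      refine propext ⟨fun h i j hij => ?_, fun h i => ?_⟩
      · have key : ∀ i j : Fin n, j < i → π i ≠ π j := fun i j hij hπ => by
          have h1 := h i
          rw [eval_all_ind (m := i) (by simp), ind_ne_zero] at h1
          have h2 := h1 ⟨j, hij⟩
          have e1 := h30 i
          have e2 := h30 j
          simp only at e1 e2
          simp [Store.set_apply, e1, e2, hπ] at h2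
        rcases lt_trichotomy i j with h1 | h1 | h1
        · exact absurd hij.symm (key j i h1)
        · exact h1
        · exact absurd hij (key i j h1)
      · rw [eval_all_ind (m := i) (by simp), ind_ne_zero]
        intro k
        have e1 := h30 i
        have e2 := h30 ⟨k, k.2.trans i.2⟩
        simp only at e1 e2
        have hne : (π i : ℕ) ≠ (π ⟨k, k.2.trans i.2⟩ : ℕ) := fun hh => by
          have := congrArg Fin.val (h (Fin.ext hh))
          simp only at this
          have := k.2
          omega
        simp only [eval_sub, eval_ofNat, eval_eq, eval_read, eval_var, Store.set_apply]
        simp [e1, e2, hne]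
    have e3 : shiftTest.eval τ = ind (∀ i, shift S T (rowMap p π) i * (S.g i * T.g (rowMap p π i)) =
        T.b (rowMap p π i) * S.g i - S.b i * T.g (rowMap p π i)) := by
      rw [shiftTest, eval_all_ind (m := n + 1) (by simp [hB.h38])]
      refine congrArg ind (propext (forall_congr' fun i => ?_))
      rw [eval_eq_ind, ind_ne_zero]
      have e := h32 i
      simp only at e
      simp [Store.set_apply, e, hP.h10 _, hP.h12 _, hP.h2 _, hP.h4 _, h33 _]
    have e4 : rowTest.eval τ = ind ((∀ r j, (δ : ℤ) ∣ ∑ i, N r i * T.A (p.succAbove (π i)) j) ∧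
        ∀ j, ∑ i, Matrix.vecMul (S.A (Fin.last n)) N i * T.A (p.succAbove (π i)) j = δ * T.A p j) := by
      rw [rowTest, eval_mul, eval_all_ind (m := n) (by simp [hB.h0]),
        eval_all_ind (m := n) (by simp [hB.h0]), ind_mul]
      refine congrArg ind (propext (and_congr (forall_congr' fun r => ?_) (forall_congr' fun j => ?_)))
      · rw [eval_all_ind (m := n) (by simp [Store.set_apply, hB.h0]), ind_ne_zero]
        refine forall_congr' fun j => ?_
        rw [eval_eq_ind, ind_ne_zero, Int.dvd_iff_emod_eq_zero]
        simp [Store.set_apply, hB.h0, hst.h15, hst.h14 _ _, h32', hP.h13 _ _, Finset.sum_range]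
      · rw [eval_eq_ind, ind_ne_zero]
        simp [Store.set_apply, hB.h0, hst.h15, hP.h17 _, h32', hP.h13 _ _, hG.h44, Finset.sum_range]
    have e5 : shiftRowTest.eval τ = ind ((∀ r, (δ : ℤ) ∣ ∑ i : Fin n, N r i * shift S T (rowMap p π) i.castSucc) ∧
        ∑ i : Fin n, Matrix.vecMul (S.A (Fin.last n)) N i * shift S T (rowMap p π) i.castSucc =
          δ * shift S T (rowMap p π) (Fin.last n)) := by
      rw [shiftRowTest, eval_mul, eval_all_ind (m := n) (by simp [hB.h0]), eval_eq_ind, ind_mul]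
      refine congrArg ind (propext (and_congr (forall_congr' fun r => ?_) ?_))
      · rw [eval_eq_ind, ind_ne_zero, Int.dvd_iff_emod_eq_zero]
        simp [Store.set_apply, hB.h0, hst.h15, hst.h14 _ _, h33', Finset.sum_range]
      · simp [Store.set_apply, hB.h0, hst.h15, hP.h17 _, h33', h33n, Finset.sum_range]
    rw [verifyTest, eval_mul, eval_mul, eval_mul, eval_mul, e1, e2, e3, e4, e5]
    simp only [ind_mul]
    exact congrArg ind (propext ⟨fun ⟨a, b, c, ⟨d, e⟩, f, g⟩ => ⟨a, b, c, d, f, e, g⟩,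
      fun ⟨a, b, c, d, f, e, g⟩ => ⟨a, b, c, ⟨d, e⟩, f, g⟩⟩)

/-- The test of a guess. -/
def testProg : Program :=
  .seq (fill 29 37 imageEntry) (.seq (fill 31 37 likeEntry) (.seq (fill 30 0 matchEntry)
    (.seq (fill 32 38 rowMapEntry) (.seq (fill 33 38 shiftEntry)
      (.seq (assign 35 0 verifyTest) (assign 34 0 (var 34 + var 35 * (1 - var 34))))))))

/-- The matching `π` depends on the guess and is described only by its rank property, which is what
completeness needs; soundness comes from `Verified`. The cell `34` is updated by `o + v * (1 - o)`,
the disjunction of truth values. -/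
theorem eventually_test : ∀ᶠ c in atTop, ∀ (w R n : ℕ) (τ : Store) (S T : ScaledSystem n)
    (N N' : Matrix (Fin n) (Fin n) ℤ) (δ δ' s : ℕ) (gen : ℕ → Fin n) (code : ℕ → ℕ)
    (p : Fin (n + 1)) (g : ℕ) (x : ℕ → Fin n) (o : ℤ),
    Base n w R τ → Prep S T N δ s gen code τ → Guess T N' δ' p g τ → s ≤ R → 0 < δ → δ ≤ R →
    (∀ j, (x j : ℕ) = g / n ^ j % n) →
    (∀ i j, |T.b j * S.g i - S.b i * T.g j| ≤ 2 ^ w) → τ 34 0 = o → (o = 0 ∨ o = 1) →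
    Runs (w * c + 2) (R ^ (c + 7)) testProg τ fun τ' => Same testArrays τ τ' ∧ Bdd w τ' ∧
      ∃ π : Fin n → Fin n, (∀ i, (∃ i', Ranked (LooksLike S T N N' δ s x (fun i => code i) p) i i') →
        Ranked (LooksLike S T N N' δ s x (fun i => code i) p) i (π i)) ∧
      τ' 34 0 = o + ind (Verified S T N δ δ' p π) * (1 - o) := by
  filter_upwards [eventually_fillMat 29 37 (e := imageEntry) rfl rfl,
    eventually_fillMat 31 37 (e := likeEntry) rfl rfl,
    eventually_fillVec 30 0 (e := matchEntry) rfl rfl,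
    eventually_fillVec 32 38 (e := rowMapEntry) rfl rfl,
    eventually_fillVec 33 38 (e := shiftEntry) rfl rfl,
    eventually_put 35 (e := verifyTest) rfl,
    eventually_put 34 (e := var 34 + var 35 * (1 - var 34)) rfl]
    with c t1 t2 t3 t4 t5 t6 t7 w R n τ S T N N' δ δ' s gen code p g x o hB hP hG hs hδ hδR hx
      hbd h34 ho
  have hR := hB.hundred_le
  have hw := hB.pow_le
  have hnR := hB.le
  have hR3 : R ≤ R ^ 3 := Nat.le_self_pow (by norm_num) R
  have hone : ∀ P : Prop, |ind P| ≤ 2 ^ w := fun P => (abs_ind_le P).trans (one_le_pow₀ (by norm_num))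
  have hfin : ∀ {m : ℕ} (i : Fin m), m ≤ n + 1 → |((i : ℕ) : ℤ)| ≤ 2 ^ w := fun i hm => by
    have := i.2
    exact hB.abs_le_two_pow (by positivity) (by omega)
  have hδz : (0 : ℤ) < δ := by exact_mod_cast hδ
  apply Runs.of_time
  case h =>
    apply Runs.then (t1 w R n n (fun r i : Fin n => codeSum N' δ s x (code i) r) τ hR hw hB.bdd
      hB.h37 hB.mul_self_le fun r i => by
        obtain ⟨a, b⟩ := imageEntry_spec hB hP hG hs hx r i
        refine ⟨a, b, hB.abs_le_two_pow (Int.emod_nonneg _ hδz.ne') ?_⟩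
        exact (Int.emod_lt_of_pos _ hδz).le.trans (by exact_mod_cast hδR))
    rintro σ₁ ⟨s1, m1, b1⟩
    have hB1 := hB.mono s1 b1
    have hP1 := hP.mono s1
    have hG1 := hG.mono s1
    apply Runs.then (t2 w R n n (fun i i' : Fin n => ind (LooksLike S T N N' δ s x (fun i => code i) p i i'))
      σ₁ hR hw b1 hB1.h37 hB.mul_self_le fun i i' => by
        obtain ⟨a, b⟩ := likeEntry_spec hB1 hP1 hG1 m1 i i'
        exact ⟨a, b, hone _⟩)
    rintro σ₂ ⟨s2, m2, b2⟩
    have hB2 := hB1.mono s2 b2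
    have hP2 := hP1.mono s2
    have hG2 := hG1.mono s2
    have hmat := fun i => matchEntry_spec hB2 m2 i
    choose hrng π hπ hπ2 using hmat
    apply Runs.then (t3 w R n (fun i => ((π i : ℕ) : ℤ)) σ₂ hR hw b2 hB2.h0 (by omega) fun i =>
      ⟨hrng i, hπ i, hfin _ (by omega)⟩)
    rintro σ₃ ⟨s3, m3, b3⟩
    have hB3 := hB2.mono s3 b3
    have hP3 := hP2.mono s3
    have hG3 := hG2.mono s3
    apply Runs.then (t4 w R (n + 1) (fun i => ((rowMap p π i : ℕ) : ℤ)) σ₃ hR hw b3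
      (by rw [hB3.h38]; push_cast; rfl) (by omega) fun i =>
      ⟨by simp [rowMapEntry], rowMapEntry_spec hB3 hG3 m3 i, hfin _ le_rfl⟩)
    rintro σ₄ ⟨s4, m4, b4⟩
    have hB4 := hB3.mono s4 b4
    have hP4 := hP3.mono s4
    have hG4 := hG3.mono s4
    apply Runs.then (t5 w R (n + 1) (shift S T (rowMap p π)) σ₄ hR hw b4
      (by rw [hB4.h38]; push_cast; rfl) (by omega) fun i =>
      ⟨by simp [shiftEntry], shiftEntry_spec hP4 m4 i,
        (Int.abs_ediv_le_abs _ _).trans (hbd _ _)⟩)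
    rintro σ₅ ⟨s5, m5, b5⟩
    have hB5 := hB4.mono s5 b5
    have hP5 := hP4.mono s5
    have hG5 := hG4.mono s5
    obtain ⟨v1, v2⟩ := verifyTest_spec hB5 hP5 hG5
      (by rw [s5.get 30, s4.get 30]; exact m3) (by rw [s5.get 32]; exact m4) m5
    apply Runs.then (t6 w R σ₅ hR hw b5 v1 (by rw [v2]; exact hone _) (by decide))
    rintro σ₆ ⟨s6, e6, b6⟩
    rw [v2] at e6
    have s5' : Same testArrays τ σ₅ :=
      ((((s1.trans s2 (F'' := testArrays)).trans s3 (F'' := testArrays)).trans s4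
        (F'' := testArrays)).trans s5 (F'' := testArrays))
    have s5'' : Same [29, 30, 31, 32, 33, 40] τ σ₅ :=
      ((((s1.trans s2 (F'' := [29, 30, 31, 32, 33, 40])).trans s3
        (F'' := [29, 30, 31, 32, 33, 40])).trans s4
        (F'' := [29, 30, 31, 32, 33, 40])).trans s5 (F'' := [29, 30, 31, 32, 33, 40]))
    have e34 : σ₆ 34 0 = o := by rw [s6.get 34, s5''.get 34, h34]
    have v7 : (var 34 + var 35 * (1 - var 34)).eval σ₆ =
        o + ind (Verified S T N δ δ' p π) * (1 - o) := by
      simp [e34, e6]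
    refine (t7 w R σ₆ hR hw b6 (by simp) ?_ (by decide)).imp le_rfl fun σ₇ ⟨s7, e7, b7⟩ =>
      ⟨(s5'.trans s6 (F'' := testArrays)).trans s7, b7, π, hπ2, by rw [e7, v7]⟩
    rw [v7]
    rcases ho with rfl | rfl
    · simpa using hone _
    · simpa using one_le_pow₀ (M₀ := ℤ) (a := 2) (by norm_num)
  case hT =>
    have := pow_step (a := c + 5) (b := c + 7) hR (by omega)
    have := pow_step (a := c + 1) (b := c + 7) hR (by omega)
    omega

end RAM

/-! ### The enumeration of the guesses -/

namespace RAM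

open Filter HExpr

/-- The loop over all guesses. -/
def guessProg : Program :=
  .seq (assign 34 0 0) (forTo 44 38 (.seq (adjProg 13 44 25 26 28) (forTo 45 23 testProg)))

/-- The arrays that are used in the loop over all guesses. -/
def guessArrays : List ℕ := testArrays ++ adjArrays 25 26 28 ++ [44, 45]

/-- The base `n` digits of `g`. -/
def digits {n : ℕ} (hn : 1 ≤ n) (g : ℕ) (j : ℕ) : Fin n := ⟨g / n ^ j % n, Nat.mod_lt _ hn⟩

/-- All correspondences that are compatible with the guess pass the test. -/
def GoodGuess {n : ℕ} (S T : ScaledSystem n) (N : Matrix (Fin n) (Fin n) ℤ) (δ s : ℕ)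
    (code : ℕ → ℕ) (p : Fin (n + 1)) (x : ℕ → Fin n) : Prop :=
  ∀ π : Fin n → Fin n,
    (∀ i, (∃ i', Ranked (LooksLike S T N (adjInt (dropRow T.A p)) δ s x (fun i => code i) p) i i') →
      Ranked (LooksLike S T N (adjInt (dropRow T.A p)) δ s x (fun i => code i) p) i (π i)) →
    Verified S T N δ (dropRow T.A p).det.natAbs p π

/-- The content `o` of the output cell is correct for the guesses in `P`. -/
structure Partial {n : ℕ} (S T : ScaledSystem n) (o : ℤ) (P : Prop) : Prop where
  zero_or_one : o = 0 ∨ o = 1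
  sound : o = 1 → S.RowEquiv T
  complete : P → o = 1

/-- The outer loop runs over `p` and computes the inverse for the other rows of `T` once; the inner
loop runs over the `n ^ s` images of the generators, coded in base `n`. Any accepted guess proves an
equivalence, and an equivalence makes some guess good. -/
theorem eventually_guess : ∀ᶠ c in atTop, ∀ (w R n : ℕ) (σ : Store) (S T : ScaledSystem n)
    (N : Matrix (Fin n) (Fin n) ℤ) (δ s X Y : ℕ) (gen : ℕ → Fin n) (code : ℕ → ℕ),
    Base n w R σ → Prep S T N δ s gen code σ → GenBound w R X Y N δ → δ ≤ R →
    (∀ i j, |T.b j * S.g i - S.b i * T.g j| ≤ 2 ^ w) →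
    (∀ i, 0 < S.g i) → (∀ i, 0 < T.g i) →
    dropRow S.A (Fin.last n) * N = (δ : ℤ) • 1 → |(dropRow S.A (Fin.last n)).det| = δ →
    MinorBound w T.A → (∀ p i, |rowCoords T.A p i| ≤ 2 ^ w) →
    Runs (w * c + 2) (R ^ (c + 15) * Y) guessProg σ fun σ' => Same guessArrays σ σ' ∧ Bdd w σ' ∧
      Partial S T (σ' 34 0) (S.RowEquiv T) := by
  filter_upwards [eventually_put 34 (e := 0) rfl, eventually_adjT, eventually_test,
    eventually_ge_atTop 10] with c t1 t2 t3 hc w R n σ S T N δ s X Y gen code hB hP hbd hδR hshift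
      hSg hTg hN hδ hmin hcoord
  have hR := hB.hundred_le
  have hw := hB.pow_le
  have hnR := hB.le
  have hind := hP.state.indep
  have hY := (hbd.le hind).2
  have hsR := hbd.lt hind
  have hGpos : 1 ≤ n ^ s := Nat.one_le_pow _ _ hB.one_le
  have hδ0 : 0 < δ := Nat.pos_of_ne_zero hbd.ne_zero
  have hzero : |((0 : ℕ) : ℤ)| ≤ 2 ^ w := hB.abs_le_two_pow (by norm_num) (by omega)
  apply Runs.of_time
  case h =>
    apply Runs.then (t1 w R σ hR hw hB.bdd (by simp) hzero (by decide))
    rintro σ₁ ⟨s1, e1, b1⟩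
    refine (Runs.forTo (K := n + 1) (T := R ^ (c + 12) + R ^ (c + 9) * n ^ s)
      (T' := R ^ (c + 14) * n ^ s)
      (fun k τ => Same guessArrays σ τ ∧ Bdd w τ ∧ τ 44 0 = k ∧ Partial S T (τ 34 0)
        (∃ (p : Fin (n + 1)) (g : ℕ), (p : ℕ) < k ∧ g < n ^ s ∧
          GoodGuess S T N δ s code p (digits hB.one_le g)))
      hc hB.one_le_w (hnR.trans hB.le_two_pow) ?_ ?_ ?_ ?_).imp le_rfl
      (fun σ' h => ⟨h.1, h.2.1, h.2.2.2.1, h.2.2.2.2, ?_⟩)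
    · refine ⟨(s1.mono (by decide)).set (by decide) _ _, b1.set (by simp) _ _,
        Store.set_self _ _ _ _, ?_⟩
      rw [Store.set_of_ne _ (by decide), e1]
      exact ⟨Or.inl rfl, fun h => absurd h (by simp), fun ⟨p, g, h, _⟩ => absurd h (by omega)⟩
    · rintro k τ - ⟨g1, -, g2, -⟩
      exact ⟨g2, by rw [g1.get 38, hB.h38]; push_cast; rfl⟩
    · rintro k τ hk ⟨g1, g2, g3, g4⟩
      have hBτ := hB.mono g1 g2
      have hPτ := hP.mono g1
      set p : Fin (n + 1) := ⟨k, hk⟩ with hp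
      apply Runs.of_time
      case h =>
        apply Runs.then (t2 w R n τ T.A p hBτ hPτ.h13 hmin (hcoord p) g3)
        rintro τ₁ ⟨r1, d1, m25, m26, m28⟩
        have hP1 := hPτ.mono r1
        have hB1 := hBτ.mono r1 d1
        have g1' : Same guessArrays σ τ₁ := g1.trans r1
        -- The guesses treated so far are all those with a smaller `p`, and those with the present
        -- `p` and a smaller number.
        refine (Runs.forTo (K := n ^ s) (T := R ^ (c + 7)) (T' := R ^ (c + 9) * n ^ s)
          (fun g ρ => Same (testArrays ++ [45]) τ₁ ρ ∧ Bdd w ρ ∧ ρ 45 0 = g ∧ Partial S T (ρ 34 0)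
            (∃ (q : Fin (n + 1)) (h : ℕ), ((q : ℕ) < k ∧ h < n ^ s ∨ q = p ∧ h < g) ∧
              GoodGuess S T N δ s code q (digits hB.one_le h)))
          hc hB.one_le_w (hY.trans hbd.le_pow.2) ?_ ?_ ?_ ?_).imp le_rfl
          (fun ρ ⟨q1, q2, q3, q4⟩ => ?_)
        · refine ⟨(Same.refl _ _).set (by decide) _ _, d1.set (by simp) _ _, Store.set_self _ _ _ _, ?_⟩
          rw [Store.set_of_ne _ (by decide), r1.get 34]
          refine ⟨g4.1, g4.2, fun ⟨q, h, h1, h2⟩ => g4.3 ⟨q, h, ?_, ?_, h2⟩⟩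
          · rcases h1 with h1 | h1
            · exact h1.1
            · omega
          · rcases h1 with h1 | h1
            · exact h1.2
            · omega
        · rintro g ρ - ⟨q1, -, q2, -⟩
          exact ⟨q2, by rw [q1.get 23, hP1.state.h23]⟩
        · rintro g ρ hg ⟨q1, q2, q3, q4⟩
          have hG : Guess T (adjInt (dropRow T.A p)) (dropRow T.A p).det.natAbs p g ρ := by
            constructor
            · rw [q1.get 25]; exact m25
            · rw [q1.get 26]; exact m26
            · rw [q1.get 28]; exact m28
            · rw [q1.get 44, r1.get 44]; exact g3
            · exact q3
          refine (t3 w R n ρ S T N _ δ _ s gen code p g (digits hB.one_le g) (ρ 34 0)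
            (hB1.mono q1 q2) (hP1.mono q1) hG hsR.le hδ0 hδR (fun j => rfl) hshift rfl
            q4.zero_or_one).imp le_rfl fun ρ' ⟨u1, u2, π, u3, u4⟩ => ?_
          refine ⟨by rw [u1.get 45, q3], (q1.trans u1 (F'' := testArrays ++ [45])).set (by decide) _ _,
            u2.set ?_ _ _, Store.set_self _ _ _ _, ?_⟩
          · rw [abs_of_nonneg (by positivity)]
            have h1 : g + 1 ≤ 2 ^ w := (show g + 1 ≤ n ^ s from hg).trans (hY.trans hbd.le_pow.2)
            exact_mod_cast h1
          · rw [Store.set_of_ne _ (by decide)]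
            by_cases hv : Verified S T N δ (dropRow T.A p).det.natAbs p π
            · rw [ind_of hv] at u4
              have e : ρ' 34 0 = 1 := by rw [u4]; ring
              exact ⟨Or.inr e, fun _ => hv.rowEquiv hN hδ (Int.abs_eq_natAbs _) hbd.ne_zero,
                fun _ => e⟩
            · rw [ind_of_not hv] at u4
              have e : ρ' 34 0 = ρ 34 0 := by rw [u4]; ring
              rw [e]
              refine ⟨q4.1, q4.2, fun ⟨q, h, h1, h2⟩ => ?_⟩
              by_cases hlast : q = p ∧ h = g
              · obtain ⟨rfl, rfl⟩ := hlast
                exact absurd (h2 π u3) hv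
              · refine q4.3 ⟨q, h, ?_, h2⟩
                rcases h1 with h1 | h1
                · exact Or.inl h1
                · refine Or.inr ⟨h1.1, ?_⟩
                  have : h ≠ g := fun h' => hlast ⟨h1.1, h'⟩
                  omega
        · have h1 := pow_step (a := c + 7) (b := c + 9) hR (by omega)
          have h2 : 1 ≤ R ^ (c + 7) := Nat.one_le_pow _ _ (by omega)
          nlinarith
        · refine ⟨?_, ?_, ?_, Store.set_self _ _ _ _, ?_⟩
          · rw [q1.get 44, r1.get 44, g3]
          · exact (g1'.trans q1 (F'' := guessArrays)).set (by decide) _ _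
          · exact q2.set (hB.abs_succ_le (k := k) (by omega)) _ _
          · rw [Store.set_of_ne _ (by decide)]
            refine ⟨q4.1, q4.2, fun ⟨q, h, h1, h2, h3⟩ => q4.3 ⟨q, h, ?_, h3⟩⟩
            by_cases hq : (q : ℕ) < k
            · exact Or.inl ⟨hq, h2⟩
            · exact Or.inr ⟨Fin.ext (by simp only [hp]; omega), h2⟩
      case hT => exact le_rfl
    · have h1 := pow_step (a := c + 12) (b := c + 13) hR (by omega)
      have h2 := pow_step (a := c + 9) (b := c + 12) hR (by omega)
      have h3 : 1 ≤ R ^ (c + 9) := Nat.one_le_pow _ _ (by omega)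
      have h4 : R ^ (c + 14) = R * R ^ (c + 13) := by ring
      have h5 := Nat.mul_le_mul_right (n ^ s) h2
      have h6 : R ^ (c + 12) ≤ R ^ (c + 12) * n ^ s := Nat.le_mul_of_pos_right _ hGpos
      have h7 := Nat.mul_le_mul_right (n ^ s) h1
      have h8 : (n + 1) * (R ^ (c + 12) + R ^ (c + 9) * n ^ s + 12) + 15 ≤
          R * (R ^ (c + 12) + R ^ (c + 9) * n ^ s + 12 + 15) := by
        rw [Nat.mul_add R _ 15]
        have := Nat.mul_le_mul_right (R ^ (c + 12) + R ^ (c + 9) * n ^ s + 12) hnR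
        omega
      refine h8.trans ?_
      rw [h4, mul_assoc]
      refine Nat.mul_le_mul_left R ?_
      rw [mul_assoc] at h5 h7
      have h9 : 1 ≤ R ^ (c + 12) := Nat.one_le_pow _ _ (by omega)
      omega
    · intro hRE
      have : NeZero n := ⟨by have := hB.one_le; omega⟩
      refine h.2.2.2.3 ?_
      obtain ⟨p, π₀, hp⟩ := hRE.exists_verified hSg hTg (N' := fun p => adjInt (dropRow T.A p))
        (δ' := fun p => (dropRow T.A p).det.natAbs) hN (fun p => mul_adjInt _) hδ
        (fun p => Int.abs_eq_natAbs _) hbd.ne_zero (s := s) (gen := gen) (code := fun i => code i)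
        fun i r => hP.state.dvd i i.2 r
      -- The true images of the generators are the digits of some `g < n ^ s`, so the loop meets
      -- this guess.
      obtain ⟨g, hg, hgd⟩ := exists_digits (δ := n) s (fun j => (π₀ (gen j) : ℕ)) fun j _ => (π₀ (gen j)).2
      exact ⟨p, g, p.2, hg, fun π hπ => hp _ (fun j hj => Fin.ext (hgd j hj)) π hπ⟩
  case hT =>
    have h1 := pow_step (a := c + 1) (b := c + 14) hR (by omega)
    have h2 := pow_step (a := c + 14) (b := c + 15) hR (by omega)
    have h3 := Nat.mul_le_mul_right (n ^ s) h2
    have h4 : R ^ (c + 14) ≤ R ^ (c + 14) * n ^ s := Nat.le_mul_of_pos_right _ hGpos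
    have h5 := Nat.mul_le_mul_left (R ^ (c + 15)) hY
    rw [mul_assoc] at h3
    omega

end RAM

/-! ### The main program -/

namespace RAM

open Filter HExpr

/-- The algorithm. -/
def mainProg : Program :=
  .seq (assign 37 0 (var 0 * var 0)) (.seq (assign 38 0 (var 0 + 1))
    (.seq (assign 39 0 ((var 0 + 1) * var 0)) (.seq (primProg 1 10 11) (.seq (primProg 3 12 13)
      (.seq (adjProg 11 0 14 15 17) (.seq genProg (.seq guessProg (assign 0 0 (var 34)))))))))

theorem holdsVec_vecArray {N : ℕ} (v : Fin N → ℤ) : HoldsVec (vecArray v) v := fun i => by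
  simp [vecArray]

theorem holdsMat_matArray {m n : ℕ} (A : Matrix (Fin m) (Fin n) ℤ) : HoldsMat (matArray A) A := by
  intro i j
  have h := holdsVec_vecArray (fun k : Fin (m * n) => A (finProdFinEquiv.symm k).1 (finProdFinEquiv.symm k).2)
    (finProdFinEquiv (i, j))
  simp only [Equiv.symm_apply_apply] at h
  rw [← h, matArray]
  congr 1

/-- The bounds for a run of the algorithm. -/
structure RunBound {n : ℕ} (w R X Y : ℕ) (S T : IneqSystem n) : Prop where
  le : n + 1 ≤ R
  hundred_le : 100 ≤ R
  pow_le : R ^ 4 ≤ 2 ^ w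
  bdd : Bdd w (input S T)
  minor₁ : MinorBound w S.A
  minor₂ : MinorBound w T.A
  minor₃ : MinorBound w (primRows S.A)
  minor₄ : MinorBound w (primRows T.A)
  coords₁ : ∀ p i, |rowCoords (primRows S.A) p i| ≤ 2 ^ w
  coords₂ : ∀ p i, |rowCoords (primRows T.A) p i| ≤ 2 ^ w
  det₁ : ∀ p, (dropRow S.A p).det ≠ 0 ∧ 2 * |(dropRow S.A p).det| ≤ R
  det₂ : ∀ p, (dropRow T.A p).det ≠ 0 ∧ 2 * |(dropRow T.A p).det| ≤ R
  det_le : (dropRow (primRows S.A) (Fin.last n)).det.natAbs ≤ R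
  shift_le : ∀ i j, |T.b j * rowGcd S.A i - S.b i * rowGcd T.A j| ≤ 2 ^ w
  gen : GenBound w R X Y (adjInt (dropRow (primRows S.A) (Fin.last n)))
    (dropRow (primRows S.A) (Fin.last n)).det.natAbs

theorem exists_mainProg : ∃ c, ∀ (w R n X Y : ℕ) [NeZero n] (S T : IneqSystem n),
    RunBound w R X Y S T →
    Runs (w * c + 2) (R ^ (c + 16) * (X + Y)) mainProg (input S T) fun σ' =>
      Partial S.scaled T.scaled (σ' 0 0) (S.scaled.RowEquiv T.scaled) := by
  suffices h : ∀ᶠ c in atTop, ∀ (w R n X Y : ℕ) [NeZero n] (S T : IneqSystem n),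
      RunBound w R X Y S T →
      Runs (w * c + 2) (R ^ (c + 16) * (X + Y)) mainProg (input S T) fun σ' =>
        Partial S.scaled T.scaled (σ' 0 0) (S.scaled.RowEquiv T.scaled) from h.exists
  filter_upwards [eventually_put 37 (e := var 0 * var 0) rfl,
    eventually_put 38 (e := var 0 + 1) rfl, eventually_put 39 (e := (var 0 + 1) * var 0) rfl,
    eventually_prim 1 10 11 ⟨rfl, rfl⟩ ⟨rfl, rfl⟩ ⟨rfl, rfl⟩ ⟨rfl, rfl⟩,
    eventually_prim 3 12 13 ⟨rfl, rfl⟩ ⟨rfl, rfl⟩ ⟨rfl, rfl⟩ ⟨rfl, rfl⟩,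
    eventually_adjS, eventually_gen, eventually_guess, eventually_put 0 (e := var 34) rfl]
    with c t1 t2 t3 t4 t5 t6 t7 t8 t9 w R n X Y _ S T hb
  have hn : 1 ≤ n := NeZero.one_le
  have hR := hb.hundred_le
  have hw := hb.pow_le
  have hnR := hb.le
  have i0 : input S T 0 0 = n := by simp [input, vecArray]
  have hRw : (R : ℤ) ^ 4 ≤ 2 ^ w := by exact_mod_cast hw
  have hnR' : (n : ℤ) + 1 ≤ R := by exact_mod_cast hnR
  have hn' : (0 : ℤ) ≤ n := by positivity
  have hR2 : (R : ℤ) * R ≤ R ^ 4 := by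
    have : (1 : ℤ) ≤ R := by linarith
    calc (R : ℤ) * R = R ^ 2 := by ring
      _ ≤ R ^ 4 := pow_le_pow_right₀ this (by norm_num)
  set δ := (dropRow (primRows S.A) (Fin.last n)).det.natAbs with hδ
  have hind0 : Independent (adjInt (dropRow (primRows S.A) (Fin.last n))) δ 0 fun _ => ⟨0, hn⟩ :=
    fun j hj => absurd hj (by omega)
  have hX : 1 ≤ X := by simpa using (hb.gen.le hind0).1
  have hY : 1 ≤ Y := by simpa using (hb.gen.le hind0).2
  apply Runs.of_time
  case h =>
    apply Runs.then (t1 w R _ hR hw hb.bdd (by simp) (by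
      simp only [eval_mul, eval_var, i0]
      rw [abs_of_nonneg (by positivity)]
      nlinarith) (by decide))
    rintro σ₁ ⟨s1, e1, b1⟩
    apply Runs.then (t2 w R _ hR hw b1 (by simp) (by
      simp only [eval_add, eval_var, eval_ofNat, s1.get 0, i0]
      rw [abs_of_nonneg (by positivity)]
      push_cast
      nlinarith) (by decide))
    rintro σ₂ ⟨s2, e2, b2⟩
    apply Runs.then (t3 w R _ hR hw b2 (by simp) (by
      simp only [eval_mul, eval_add, eval_var, eval_ofNat, s2.get 0, s1.get 0, i0]
      rw [abs_of_nonneg (by positivity)]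
      push_cast
      nlinarith) (by decide))
    rintro σ₃ ⟨s3, e3, b3⟩
    have s3' : Same [37, 38, 39] (input S T) σ₃ := (s1.trans s2 (F'' := [37, 38])).trans s3
    have hB3 : Base n w R σ₃ := by
      refine ⟨hn, hnR, hR, hw, b3, by rw [s3'.get 0, i0], ?_, ?_, ?_⟩
      · rw [s3.get 37, s2.get 37, e1]; simp [i0]
      · rw [s3.get 38, e2]; simp [s1.get 0, i0]
      · rw [e3]; simp [s2.get 0, s1.get 0, i0]
    apply Runs.then (t4 w R n σ₃ S.A hB3 (by rw [s3'.get 1]; exact holdsMat_matArray S.A)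
      hb.minor₁ hb.det₁)
    rintro σ₄ ⟨s4, b4, m10, m11⟩
    have hB4 := hB3.mono s4 b4
    have s4' : Same [37, 38, 39, 6, 7, 8, 9, 35, 40, 41, 10, 11] (input S T) σ₄ := s3'.trans s4
    apply Runs.then (t5 w R n σ₄ T.A hB4 (by rw [s4'.get 3]; exact holdsMat_matArray T.A)
      hb.minor₂ hb.det₂)
    rintro σ₅ ⟨s5, b5, m12, m13⟩
    have hB5 := hB4.mono s5 b5
    have s5' : Same [37, 38, 39, 6, 7, 8, 9, 35, 40, 41, 10, 11, 12, 13] (input S T) σ₅ := s4'.trans s5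
    apply Runs.then (t6 w R n σ₅ (primRows S.A) (Fin.last n) hB5 (by rw [s5.get 11]; exact m11)
      hb.minor₃ (hb.coords₁ _) (by rw [hB5.h0]; simp))
    rintro σ₆ ⟨s6, b6, m14, e15, m17⟩
    have hB6 := hB5.mono s6 b6
    have s6' : Same [37, 38, 39, 6, 7, 8, 9, 35, 40, 41, 10, 11, 12, 13, 14, 15, 17] (input S T) σ₆ :=
      s5'.trans s6
    apply Runs.then (t7 w R n σ₆ _ δ X Y hB6 hb.gen m14 e15)
    rintro σ₇ ⟨s7, b7, s, gen, code, hst⟩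
    have hB7 := hB6.mono s7 b7
    have s7' : Same ([37, 38, 39, 6, 7, 8, 9, 35, 40, 41, 10, 11, 12, 13, 14, 15, 17] ++ genArrays)
      (input S T) σ₇ := s6'.trans s7
    have hP : Prep S.scaled T.scaled (adjInt (dropRow (primRows S.A) (Fin.last n))) δ s gen code σ₇ := by
      refine ⟨?_, ?_, ?_, ?_, ?_, ?_, hst⟩
      · rw [s7.get 10, s6.get 10, s5.get 10]; exact m10
      · rw [s7'.get 2]; exact holdsVec_vecArray S.b
      · rw [s7.get 12, s6.get 12]; exact m12
      · rw [s7'.get 4]; exact holdsVec_vecArray T.b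
      · rw [s7.get 13, s6.get 13]; exact m13
      · rw [s7.get 17]; exact m17
    apply Runs.then (t8 w R n σ₇ S.scaled T.scaled _ δ s X Y gen code hB7 hP hb.gen hb.det_le
      hb.shift_le (fun i => Int.natCast_pos.2 (rowGcd_pos_of_det (fun p => (hb.det₁ p).1) i))
      (fun i => Int.natCast_pos.2 (rowGcd_pos_of_det (fun p => (hb.det₂ p).1) i))
      (mul_adjInt _) (Int.abs_eq_natAbs _) hb.minor₄ hb.coords₂)
    rintro σ₈ ⟨s8, b8, h34⟩
    refine (t9 w R σ₈ hR hw b8 (by simp) (by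
      simp only [eval_var]; exact b8 34 (by decide) (by decide) 0) (by decide)).imp le_rfl
      fun σ₉ ⟨s9, e9, b9⟩ => ?_
    rw [e9]
    exact h34
  case hT =>
    have h1 := pow_step (a := c + 15) (b := c + 16) hR (by omega)
    have h2 := pow_step (a := c + 12) (b := c + 15) hR (by omega)
    have h3 := pow_step (a := c + 1) (b := c + 15) hR (by omega)
    have h4 := pow_step (a := c + 7) (b := c + 15) hR (by omega)
    have h5 : R ^ (c + 15) ≤ R ^ (c + 15) * Y := Nat.le_mul_of_pos_right _ hY
    have h6 := Nat.mul_le_mul_right (X + Y) h1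
    have h7 := Nat.mul_le_mul_right X h4
    rw [mul_assoc, Nat.mul_add (R ^ (c + 15))] at h6
    rw [mul_assoc] at h7
    omega

end RAM
/-! ### Bounds -/

section Bounds

variable {n : ℕ}

theorem abs_le_of_bitLength {z : ℤ} {L : ℕ} (h : bitLength z ≤ L) : |z| ≤ 2 ^ L := by
  have h1 : z.natAbs < 2 ^ Nat.size z.natAbs := Nat.lt_size_self _
  have h2 : 2 ^ Nat.size z.natAbs ≤ 2 ^ L :=
    Nat.pow_le_pow_right (by norm_num) (by unfold bitLength at h; omega)
  rw [Int.abs_eq_natAbs]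
  exact_mod_cast h1.le.trans h2

theorem IneqSystem.succ_le_encodingLength (S : IneqSystem n) : n + 1 ≤ S.encodingLength := by
  have h : ∑ _i : Fin (n + 1), 1 ≤ ∑ i, bitLength (S.b i) :=
    Finset.sum_le_sum fun i _ => by unfold bitLength; omega
  simp only [Finset.sum_const, Finset.card_univ, Fintype.card_fin, smul_eq_mul, mul_one] at h
  unfold IneqSystem.encodingLength
  omega

theorem IneqSystem.abs_A_le (S : IneqSystem n) (i : Fin (n + 1)) (j : Fin n) :
    |S.A i j| ≤ 2 ^ S.encodingLength := by
  refine abs_le_of_bitLength ?_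
  have h1 := Finset.single_le_sum (f := fun j => bitLength (S.A i j)) (fun _ _ => Nat.zero_le _)
    (Finset.mem_univ j)
  have h2 := Finset.single_le_sum (f := fun i => ∑ j, bitLength (S.A i j)) (fun _ _ => Nat.zero_le _)
    (Finset.mem_univ i)
  unfold IneqSystem.encodingLength
  omega

theorem IneqSystem.abs_b_le (S : IneqSystem n) (i : Fin (n + 1)) :
    |S.b i| ≤ 2 ^ S.encodingLength := by
  refine abs_le_of_bitLength ?_
  have h1 := Finset.single_le_sum (f := fun i => bitLength (S.b i)) (fun _ _ => Nat.zero_le _)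
    (Finset.mem_univ i)
  unfold IneqSystem.encodingLength
  omega

theorem det_dropRow_eq (A : Matrix (Fin (n + 1)) (Fin n) ℤ) (p : Fin (n + 1)) :
    (dropRow A p).det = (∏ i, (rowGcd A (p.succAbove i) : ℤ)) * (dropRow (primRows A) p).det := by
  rw [← Matrix.det_diagonal, ← Matrix.det_mul]
  congr 1
  ext i j
  rw [Matrix.diagonal_mul]
  exact (rowGcd_mul_primRows A _ _).symm

/-- Dividing rows by their gcds replaces the minor by a divisor of it, so the bound `Δ` is
inherited. -/
theorem det_dropRow_primRows_le {A : Matrix (Fin (n + 1)) (Fin n) ℤ} {p : Fin (n + 1)}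
    (h : (dropRow A p).det ≠ 0) :
    (dropRow (primRows A) p).det ≠ 0 ∧
      (dropRow (primRows A) p).det.natAbs ≤ (dropRow A p).det.natAbs := by
  have h1 := det_dropRow_eq A p
  refine ⟨fun h0 => h (by rw [h1, h0, mul_zero]), ?_⟩
  exact Nat.le_of_dvd (Int.natAbs_pos.2 h) (Int.natAbs_dvd_natAbs.2 (Dvd.intro_left _ h1.symm))

/-- With `n` and the entries at most `2 ^ L`, a step multiplies by at most `2 ^ (3 * L + 1)`, and
there are at most `L` steps. The total exponent `3 L + (3 L + 1) L` is below `4 (L + 1) ^ 2`. -/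
theorem abs_faddeevLeVerrier_le_two_pow [NeZero n] {M : Matrix (Fin n) (Fin n) ℤ} {L : ℕ}
    (hn : n ≤ L) (hM : ∀ i j, |M i j| ≤ 2 ^ L) {k : ℕ} (hk : k ≤ n) :
    (∀ i j, |(faddeevLeVerrier M k).1 i j| ≤ 2 ^ (4 * (L + 1) ^ 2)) ∧
      |(faddeevLeVerrier M k).2| ≤ 2 ^ (4 * (L + 1) ^ 2) := by
  have : Nonempty (Fin n) := ⟨0⟩
  obtain ⟨h1, h2⟩ := abs_faddeevLeVerrier_le M (a := 2 ^ L) (one_le_pow₀ (by norm_num)) hM k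
  rw [Fintype.card_fin] at h1 h2
  have hn2 : (n : ℤ) ≤ 2 ^ L := by exact_mod_cast (hn.trans Nat.lt_two_pow_self.le)
  have hn0 : (0 : ℤ) ≤ n := by positivity
  have e1 : (n : ℤ) ^ 2 * 2 ^ L ≤ 2 ^ (3 * L) := by
    calc (n : ℤ) ^ 2 * 2 ^ L ≤ (2 ^ L) ^ 2 * 2 ^ L := by gcongr
      _ = 2 ^ (3 * L) := by ring
  have e2 : (2 * (n : ℤ) ^ 2 * 2 ^ L) ^ k ≤ 2 ^ ((3 * L + 1) * L) := by
    calc (2 * (n : ℤ) ^ 2 * 2 ^ L) ^ k ≤ (2 ^ (3 * L + 1)) ^ k := by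
          refine pow_le_pow_left₀ (by positivity) ?_ _
          calc 2 * (n : ℤ) ^ 2 * 2 ^ L = 2 * ((n : ℤ) ^ 2 * 2 ^ L) := by ring
            _ ≤ 2 * 2 ^ (3 * L) := by linarith
            _ = 2 ^ (3 * L + 1) := by ring
      _ = 2 ^ ((3 * L + 1) * k) := by rw [pow_mul]
      _ ≤ _ := pow_le_pow_right₀ (by norm_num) (Nat.mul_le_mul_left _ (hk.trans hn))
  refine ⟨fun i j => (h1 i j).trans (e2.trans (pow_le_pow_right₀ (by norm_num) (by nlinarith))), ?_⟩
  calc _ ≤ _ := h2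
    _ ≤ 2 ^ (3 * L) * 2 ^ ((3 * L + 1) * L) := by gcongr
    _ = 2 ^ (3 * L + (3 * L + 1) * L) := by rw [pow_add]
    _ ≤ _ := pow_le_pow_right₀ (by norm_num) (by nlinarith)

theorem RAM.minorBound [NeZero n] {A : Matrix (Fin (n + 1)) (Fin n) ℤ} {L w : ℕ} (hn : n ≤ L)
    (hA : ∀ i j, |A i j| ≤ 2 ^ L) (hw : 4 * (L + 1) ^ 2 ≤ w) : RAM.MinorBound w A := by
  intro p k hk
  have h := abs_faddeevLeVerrier_le_two_pow (M := dropRow A p) hn (fun i j => hA _ _) hk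
  have h2 : (2 : ℤ) ^ (4 * (L + 1) ^ 2) ≤ 2 ^ w := pow_le_pow_right₀ (by norm_num) hw
  exact ⟨fun i j => (h.1 i j).trans h2, h.2.trans h2⟩

theorem abs_rowCoords_le [NeZero n] {A : Matrix (Fin (n + 1)) (Fin n) ℤ} {L w : ℕ} (hn : n ≤ L)
    (hA : ∀ i j, |A i j| ≤ 2 ^ L) (hw : 4 * (L + 1) ^ 2 + 2 * L ≤ w) (p : Fin (n + 1)) (i : Fin n) :
    |rowCoords A p i| ≤ 2 ^ w := by
  have h := (abs_faddeevLeVerrier_le_two_pow (M := dropRow A p) hn (fun i j => hA _ _) le_rfl).1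
  have hn2 : (n : ℤ) ≤ 2 ^ L := by exact_mod_cast (hn.trans Nat.lt_two_pow_self.le)
  calc |rowCoords A p i| ≤ ∑ j, |A p j * adjInt (dropRow A p) j i| := by
        simp only [rowCoords, Matrix.vecMul, dotProduct]
        exact Finset.abs_sum_le_sum_abs _ _
    _ ≤ ∑ _j : Fin n, 2 ^ L * 2 ^ (4 * (L + 1) ^ 2) := by
        refine Finset.sum_le_sum fun j _ => ?_
        rw [abs_mul, abs_adjInt]
        exact mul_le_mul (hA p j) (h j i) (abs_nonneg _) (by positivity)
    _ = n * (2 ^ L * 2 ^ (4 * (L + 1) ^ 2)) := by simp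
    _ ≤ 2 ^ L * (2 ^ L * 2 ^ (4 * (L + 1) ^ 2)) := by gcongr
    _ = 2 ^ (4 * (L + 1) ^ 2 + 2 * L) := by ring
    _ ≤ 2 ^ w := pow_le_pow_right₀ (by norm_num) hw

theorem abs_det_dropRow_le_two_pow [NeZero n] {A : Matrix (Fin (n + 1)) (Fin n) ℤ} {L : ℕ} (hn : n ≤ L)
    (hA : ∀ i j, |A i j| ≤ 2 ^ L) (p : Fin (n + 1)) :
    |(dropRow A p).det| ≤ 2 ^ (4 * (L + 1) ^ 2) := by
  rw [← abs_faddeevLeVerrier_fin]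
  exact (abs_faddeevLeVerrier_le_two_pow (M := dropRow A p) hn (fun i j => hA _ _) le_rfl).2

/-- The number of generators is at most `Nat.log 2 δ`, which bounds the number of codes and of
guesses at every stage of the greedy choice. -/
theorem genBound [NeZero n] {M N : Matrix (Fin n) (Fin n) ℤ} {w R : ℕ}
    (hM : M.det ≠ 0) (hMN : M * N = (M.det.natAbs : ℤ) • 1) (hR : M.det.natAbs ≤ R)
    (h1 : M.det.natAbs ^ Nat.log 2 M.det.natAbs ≤ 2 ^ w) (h2 : n ^ Nat.log 2 M.det.natAbs ≤ 2 ^ w) :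
    RAM.GenBound w R (M.det.natAbs ^ Nat.log 2 M.det.natAbs) (n ^ Nat.log 2 M.det.natAbs) N
      M.det.natAbs := by
  have h0 : M.det.natAbs ≠ 0 := Int.natAbs_ne_zero.2 hM
  have key : ∀ {s : ℕ} {gen : ℕ → Fin n}, Independent N M.det.natAbs s gen → 2 ^ s ≤ M.det.natAbs :=
    fun h => h.two_pow_le h0 hMN (Int.abs_eq_natAbs _)
  refine ⟨h0, fun h => (Nat.lt_two_pow_self.trans_le (key h)).trans_le hR, fun h => ?_, h1, h2⟩
  have := Nat.le_log_of_pow_le (by norm_num) (key h)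
  exact ⟨Nat.pow_le_pow_right (Nat.pos_of_ne_zero h0) this,
    Nat.pow_le_pow_right (Nat.pos_of_ne_zero (NeZero.ne n)) this⟩

/-- Pair the factors `i + 1` and `m - i` of two copies of the factorial; each product is at least
`m`. -/
theorem pow_self_le_factorial_sq (m : ℕ) : m ^ m ≤ m.factorial ^ 2 := by
  have h1 : m.factorial = ∏ i ∈ Finset.range m, (i + 1) := (Finset.prod_range_add_one_eq_factorial m).symm
  have h2 : m.factorial = ∏ i ∈ Finset.range m, (m - 1 - i + 1) := by
    rw [h1, Finset.prod_range_reflect (fun i => i + 1)]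
  calc m ^ m = ∏ _i ∈ Finset.range m, m := by simp
    _ ≤ ∏ i ∈ Finset.range m, ((i + 1) * (m - 1 - i + 1)) := by
        refine Finset.prod_le_prod' fun i hi => ?_
        have hi := Finset.mem_range.1 hi
        obtain ⟨k, rfl⟩ : ∃ k, m = i + 1 + k := ⟨m - (i + 1), by omega⟩
        have : i + 1 + k - 1 - i + 1 = k + 1 := by omega
        rw [this]
        nlinarith
    _ = m.factorial ^ 2 := by rw [Finset.prod_mul_distrib, ← h1, ← h2, sq]

/-- This is where the factorial in the time bound comes from. As `2 log₂ m ≤ m + 6`, the square of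
the left side is at most `m ^ 6 * m ^ m`, and `m ^ m ≤ (m!) ^ 2`. -/
theorem pow_log_le (m : ℕ) (hm : 1 ≤ m) : m ^ Nat.log 2 m ≤ m ^ 3 * m.factorial := by
  have h1 : 2 ^ Nat.log 2 m ≤ m := Nat.pow_log_le_self 2 (by omega)
  have h2 : ∀ s : ℕ, 2 * s ≤ 2 ^ s + 6 := fun s => by
    induction s with
    | zero => simp
    | succ s ih =>
      rcases Nat.lt_or_ge s 3 with h | h
      · interval_cases s <;> norm_num
      · have : 2 ^ 1 ≤ 2 ^ s := Nat.pow_le_pow_right (by norm_num) (by omega)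
        rw [pow_succ]; omega
  have h3 := h2 (Nat.log 2 m)
  rw [← Nat.pow_le_pow_iff_left (n := 2) (by norm_num)]
  calc (m ^ Nat.log 2 m) ^ 2 = m ^ (2 * Nat.log 2 m) := by rw [← pow_mul, mul_comm]
    _ ≤ m ^ (m + 6) := Nat.pow_le_pow_right hm (by omega)
    _ = m ^ 6 * m ^ m := by rw [pow_add, mul_comm]
    _ ≤ m ^ 6 * m.factorial ^ 2 := Nat.mul_le_mul_left _ (pow_self_le_factorial_sq m)
    _ = (m ^ 3 * m.factorial) ^ 2 := by ring

theorem natCast_pow_log_le {n : ℕ} (hn : 1 ≤ n) (Δ : ℕ) :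
    ((n ^ Nat.log 2 Δ : ℕ) : ℝ) ≤ (n : ℝ) ^ Real.logb 2 (Δ : ℝ) := by
  push_cast
  rw [← Real.rpow_natCast]
  refine Real.rpow_le_rpow_of_exponent_le (by exact_mod_cast hn) ?_
  exact Real.natLog_le_logb Δ 2

end Bounds
/-! ### The algorithm -/

section Main

variable {n : ℕ}

theorem RAM.abs_vecArray_le {N : ℕ} {v : Fin N → ℤ} {a : ℤ} (ha : 0 ≤ a) (h : ∀ i, |v i| ≤ a) (k : ℤ) :
    |RAM.vecArray v k| ≤ a := by
  unfold RAM.vecArray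
  split_ifs with hk
  · exact h _
  · simpa using ha

theorem RAM.bdd_input {S T : IneqSystem n} {L w : ℕ} (hS : S.encodingLength ≤ L)
    (hT : T.encodingLength ≤ L) (hw : L ≤ w) : RAM.Bdd w (RAM.input S T) := by
  have h0 : (0 : ℤ) ≤ 2 ^ w := by positivity
  have hSw : (2 : ℤ) ^ S.encodingLength ≤ 2 ^ w := pow_le_pow_right₀ (by norm_num) (by omega)
  have hTw : (2 : ℤ) ^ T.encodingLength ≤ 2 ^ w := pow_le_pow_right₀ (by norm_num) (by omega)
  have h1 : n < 2 ^ n := Nat.lt_two_pow_self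
  have h2 : 2 ^ n ≤ 2 ^ w :=
    Nat.pow_le_pow_right (by norm_num) (by have := S.succ_le_encodingLength; omega)
  have c0 : ∀ i, |RAM.vecArray (fun _ : Fin 1 => (n : ℤ)) i| ≤ 2 ^ w :=
    RAM.abs_vecArray_le h0 fun _ => by
      rw [Nat.abs_cast]
      exact_mod_cast h1.le.trans h2
  have c1 : ∀ i, |RAM.matArray S.A i| ≤ 2 ^ w :=
    RAM.abs_vecArray_le h0 fun _ => (S.abs_A_le _ _).trans hSw
  have c2 : ∀ i, |RAM.vecArray S.b i| ≤ 2 ^ w :=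
    RAM.abs_vecArray_le h0 fun _ => (S.abs_b_le _).trans hSw
  have c3 : ∀ i, |RAM.matArray T.A i| ≤ 2 ^ w :=
    RAM.abs_vecArray_le h0 fun _ => (T.abs_A_le _ _).trans hTw
  have c4 : ∀ i, |RAM.vecArray T.b i| ≤ 2 ^ w :=
    RAM.abs_vecArray_le h0 fun _ => (T.abs_b_le _).trans hTw
  intro b _ _ i
  match b with
  | 0 => exact c0 i
  | 1 => exact c1 i
  | 2 => exact c2 i
  | 3 => exact c3 i
  | 4 => exact c4 i
  | k + 5 => simp [RAM.input]

theorem natCast_rowGcd_le [NeZero n] {A : Matrix (Fin (n + 1)) (Fin n) ℤ} {a : ℤ}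
    (h : ∀ p, (dropRow A p).det ≠ 0 ∧ |(dropRow A p).det| ≤ a) (i : Fin (n + 1)) :
    (rowGcd A i : ℤ) ≤ a := by
  have : Nontrivial (Fin (n + 1)) := Fin.nontrivial_iff_two_le.2 (by have := NeZero.one_le (n := n); omega)
  obtain ⟨p, hp⟩ := exists_ne i
  exact (rowGcd_le_abs_det A hp.symm (h p).1).trans (h p).2

/-- The number `δ ^ log₂ δ` of codes dictates the fourth power: both `δ` has at most about `4 (L +
1) ^ 2` bits and its logarithm is at most that, which gives the exponent `16 (L + 1) ^ 4`. The
summand `2 * M` of `R` covers the sum of two minors in the search for gcds. -/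
theorem RAM.runBound [NeZero n] {S T : IneqSystem n} {M L w : ℕ} (hS : S.encodingLength ≤ L)
    (hT : T.encodingLength ≤ L) (hw : 100 * (L + 1) ^ 4 ≤ w)
    (hSM : ∀ p, (dropRow S.A p).det ≠ 0 ∧ |(dropRow S.A p).det| ≤ M)
    (hTM : ∀ p, (dropRow T.A p).det ≠ 0 ∧ |(dropRow T.A p).det| ≤ M)
    (hM : M ≤ 2 ^ (4 * (L + 1) ^ 2)) :
    RAM.RunBound w (n + 100 + 2 * M)
      ((dropRow (primRows S.A) (Fin.last n)).det.natAbs ^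
        Nat.log 2 (dropRow (primRows S.A) (Fin.last n)).det.natAbs)
      (n ^ Nat.log 2 (dropRow (primRows S.A) (Fin.last n)).det.natAbs) S T := by
  have hnL : n + 1 ≤ L := S.succ_le_encodingLength.trans hS
  have hn : n ≤ L := by omega
  have hL2 : 1 ≤ (L + 1) ^ 2 := Nat.one_le_pow _ _ (by omega)
  have hL1 : L + 1 ≤ (L + 1) ^ 2 := by nlinarith
  have hL4 : (L + 1) ^ 2 ≤ (L + 1) ^ 4 := Nat.pow_le_pow_right (by omega) (by norm_num)
  have hSL : ∀ i j, |S.A i j| ≤ 2 ^ L := fun i j =>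
    (S.abs_A_le i j).trans (pow_le_pow_right₀ (by norm_num) hS)
  have hTL : ∀ i j, |T.A i j| ≤ 2 ^ L := fun i j =>
    (T.abs_A_le i j).trans (pow_le_pow_right₀ (by norm_num) hT)
  have hSb : ∀ i, |S.b i| ≤ 2 ^ L := fun i =>
    (S.abs_b_le i).trans (pow_le_pow_right₀ (by norm_num) hS)
  have hTb : ∀ i, |T.b i| ≤ 2 ^ L := fun i =>
    (T.abs_b_le i).trans (pow_le_pow_right₀ (by norm_num) hT)
  have hSP : ∀ i j, |primRows S.A i j| ≤ 2 ^ L := fun i j => (abs_primRows_le _ i j).trans (hSL i j)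
  have hTP : ∀ i j, |primRows T.A i j| ≤ 2 ^ L := fun i j => (abs_primRows_le _ i j).trans (hTL i j)
  have hMZ : (M : ℤ) ≤ 2 ^ (4 * (L + 1) ^ 2) := by exact_mod_cast hM
  obtain ⟨hd0, hd⟩ := det_dropRow_primRows_le (hSM (Fin.last n)).1
  set δ := (dropRow (primRows S.A) (Fin.last n)).det.natAbs with hδ
  have hδM : δ ≤ M := by
    have := (hSM (Fin.last n)).2
    rw [Int.abs_eq_natAbs] at this
    exact hd.trans (by exact_mod_cast this)
  have hlog : Nat.log 2 δ ≤ 4 * (L + 1) ^ 2 := by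
    have := Nat.log_mono_right (b := 2) (hδM.trans hM)
    rwa [Nat.log_pow (by norm_num)] at this
  refine ⟨by omega, by omega, ?_, RAM.bdd_input hS hT (by omega), RAM.minorBound hn hSL (by omega),
    RAM.minorBound hn hTL (by omega), RAM.minorBound hn hSP (by omega),
    RAM.minorBound hn hTP (by omega), abs_rowCoords_le hn hSP (by omega),
    abs_rowCoords_le hn hTP (by omega), fun p => ⟨(hSM p).1, ?_⟩, fun p => ⟨(hTM p).1, ?_⟩,
    by omega, fun i j => ?_, ?_⟩
  · have h1 : n + 100 ≤ 2 ^ (4 * (L + 1) ^ 2 + 6) := by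
      have h2 : L < 2 ^ L := Nat.lt_two_pow_self
      have h3 : 2 ^ L ≤ 2 ^ (4 * (L + 1) ^ 2) := Nat.pow_le_pow_right (by norm_num) (by omega)
      have h4 : 2 ^ 4 ≤ 2 ^ (4 * (L + 1) ^ 2) := Nat.pow_le_pow_right (by norm_num) (by omega)
      rw [pow_add]
      omega
    calc (n + 100 + 2 * M) ^ 4 ≤ (2 ^ (4 * (L + 1) ^ 2 + 7)) ^ 4 := by
          refine Nat.pow_le_pow_left ?_ 4
          rw [pow_succ]
          have : 2 ^ (4 * (L + 1) ^ 2 + 6) = 64 * 2 ^ (4 * (L + 1) ^ 2) := by rw [pow_add]; ring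
          omega
      _ = 2 ^ ((4 * (L + 1) ^ 2 + 7) * 4) := by rw [pow_mul]
      _ ≤ 2 ^ w := Nat.pow_le_pow_right (by norm_num) (by omega)
  · have := (hSM p).2
    push_cast
    omega
  · have := (hTM p).2
    push_cast
    omega
  · have hgS := natCast_rowGcd_le hSM i
    have hgT := natCast_rowGcd_le hTM j
    have hM0 : (0 : ℤ) ≤ 2 ^ L := by positivity
    calc |T.b j * rowGcd S.A i - S.b i * rowGcd T.A j|
        ≤ |T.b j| * rowGcd S.A i + |S.b i| * rowGcd T.A j := by
          refine (abs_sub _ _).trans_eq ?_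
          rw [abs_mul, abs_mul, Nat.abs_cast, Nat.abs_cast]
      _ ≤ 2 ^ L * 2 ^ (4 * (L + 1) ^ 2) + 2 ^ L * 2 ^ (4 * (L + 1) ^ 2) := by
          refine add_le_add (mul_le_mul (hTb j) (hgS.trans hMZ) (by positivity) hM0)
            (mul_le_mul (hSb i) (hgT.trans hMZ) (by positivity) hM0)
      _ = 2 ^ (4 * (L + 1) ^ 2 + L + 1) := by ring
      _ ≤ 2 ^ w := pow_le_pow_right₀ (by norm_num) (by omega)
  · refine genBound hd0 (mul_adjInt _) (by omega) ?_ ?_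
    · calc δ ^ Nat.log 2 δ ≤ (2 ^ (4 * (L + 1) ^ 2)) ^ Nat.log 2 δ :=
            Nat.pow_le_pow_left (hδM.trans hM) _
        _ = 2 ^ (4 * (L + 1) ^ 2 * Nat.log 2 δ) := (pow_mul _ _ _).symm
        _ ≤ 2 ^ w := Nat.pow_le_pow_right (by norm_num) (le_trans (by
            calc 4 * (L + 1) ^ 2 * Nat.log 2 δ ≤ 4 * (L + 1) ^ 2 * (4 * (L + 1) ^ 2) :=
                  Nat.mul_le_mul_left _ hlog
              _ = 16 * (L + 1) ^ 4 := by ring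
              _ ≤ 100 * (L + 1) ^ 4 := by omega) hw)
    · calc n ^ Nat.log 2 δ ≤ (2 ^ (L + 1)) ^ Nat.log 2 δ :=
            Nat.pow_le_pow_left ((hn.trans (Nat.le_succ L)).trans Nat.lt_two_pow_self.le) _
        _ = 2 ^ ((L + 1) * Nat.log 2 δ) := by rw [pow_mul]
        _ ≤ 2 ^ w := Nat.pow_le_pow_right (by norm_num) (le_trans (by
            calc (L + 1) * Nat.log 2 δ ≤ (L + 1) ^ 2 * (4 * (L + 1) ^ 2) :=
                  Nat.mul_le_mul hL1 hlog
              _ = 4 * (L + 1) ^ 4 := by ring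
              _ ≤ 100 * (L + 1) ^ 4 := by omega) hw)

/-- The sum of the numbers of codes and guesses is at most `n ^ log₂ Δ * Δ! * (Δ ^ 3 + 1)`, which
explains the three extra powers of `n + Δ`. -/
theorem natCast_le_opBound {n Δ R δ m : ℕ} (hn : 1 ≤ n) (hδ : 1 ≤ δ) (hδΔ : δ ≤ Δ)
    (hR : R ≤ 102 * (n + Δ)) :
    ((R ^ m * (δ ^ Nat.log 2 δ + n ^ Nat.log 2 δ) : ℕ) : ℝ) ≤ opBound (102 ^ m) (m + 3) n Δ := by
  have hΔ : 1 ≤ Δ := hδ.trans hδΔ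
  have hlog : Nat.log 2 δ ≤ Nat.log 2 Δ := Nat.log_mono_right hδΔ
  have hX : δ ^ Nat.log 2 δ ≤ Δ ^ 3 * Δ.factorial :=
    ((Nat.pow_le_pow_left hδΔ _).trans (Nat.pow_le_pow_right hΔ hlog)).trans (pow_log_le Δ hΔ)
  have hY : n ^ Nat.log 2 δ ≤ n ^ Nat.log 2 Δ := Nat.pow_le_pow_right hn hlog
  have hY1 : 1 ≤ n ^ Nat.log 2 Δ := Nat.one_le_pow _ _ hn
  have hf : 1 ≤ Δ.factorial := Nat.factorial_pos Δ
  have hΔn : Δ ^ 3 + 1 ≤ (n + Δ) ^ 3 := by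
    calc Δ ^ 3 + 1 ≤ (1 + Δ) ^ 3 := by ring_nf; omega
      _ ≤ (n + Δ) ^ 3 := Nat.pow_le_pow_left (by omega) _
  have hXY : δ ^ Nat.log 2 δ + n ^ Nat.log 2 δ ≤ n ^ Nat.log 2 Δ * Δ.factorial * (n + Δ) ^ 3 := by
    calc _ ≤ Δ ^ 3 * Δ.factorial + n ^ Nat.log 2 Δ := add_le_add hX hY
      _ ≤ n ^ Nat.log 2 Δ * (Δ ^ 3 * Δ.factorial) + n ^ Nat.log 2 Δ * Δ.factorial :=
          add_le_add (Nat.le_mul_of_pos_left _ hY1) (Nat.le_mul_of_pos_right _ hf)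
      _ = n ^ Nat.log 2 Δ * Δ.factorial * (Δ ^ 3 + 1) := by ring
      _ ≤ _ := Nat.mul_le_mul_left _ hΔn
  have key : R ^ m * (δ ^ Nat.log 2 δ + n ^ Nat.log 2 δ) ≤
      n ^ Nat.log 2 Δ * Δ.factorial * (102 ^ m * (n + Δ) ^ (m + 3)) := by
    calc _ ≤ (102 * (n + Δ)) ^ m * (n ^ Nat.log 2 Δ * Δ.factorial * (n + Δ) ^ 3) :=
          Nat.mul_le_mul (Nat.pow_le_pow_left hR _) hXY
      _ = _ := by rw [mul_pow, pow_add]; ring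
  unfold opBound
  calc ((R ^ m * (δ ^ Nat.log 2 δ + n ^ Nat.log 2 δ) : ℕ) : ℝ)
      ≤ ((n ^ Nat.log 2 Δ * Δ.factorial * (102 ^ m * (n + Δ) ^ (m + 3)) : ℕ) : ℝ) := by
        exact_mod_cast key
    _ = ((n ^ Nat.log 2 Δ : ℕ) : ℝ) * (Δ.factorial : ℝ) *
          (((102 ^ m : ℕ) : ℝ) * ((n : ℝ) + (Δ : ℝ)) ^ (m + 3)) := by push_cast; ring
    _ ≤ _ := by
        gcongr
        exact natCast_pow_log_le hn Δ

theorem opBound_le_pow (C d : ℕ) {Δ : ℕ} (hΔ : 1 ≤ Δ) {n : ℕ} (hn : 1 ≤ n) :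
    opBound C d n Δ ≤ ((Δ.factorial * (C * (1 + Δ) ^ d) : ℕ) : ℝ) * (n : ℝ) ^ (Δ + d) := by
  have hn1 : (1 : ℝ) ≤ n := by exact_mod_cast hn
  have hΔ0 : (0 : ℝ) < Δ := by exact_mod_cast hΔ
  have hlog : Real.logb 2 (Δ : ℝ) ≤ Δ := by
    rw [Real.logb_le_iff_le_rpow (by norm_num) hΔ0, Real.rpow_natCast]
    exact_mod_cast Nat.lt_two_pow_self.le
  have h1 : (n : ℝ) ^ Real.logb 2 (Δ : ℝ) ≤ (n : ℝ) ^ Δ := by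
    rw [← Real.rpow_natCast]
    exact Real.rpow_le_rpow_of_exponent_le hn1 hlog
  have h2 : (n : ℝ) + Δ ≤ n * (1 + Δ) := by nlinarith
  unfold opBound
  calc _ ≤ (n : ℝ) ^ Δ * (Δ.factorial : ℝ) * ((C : ℝ) * (n * (1 + Δ)) ^ d) := by gcongr
    _ = _ := by push_cast; rw [mul_pow, pow_add]; ring

end Main

theorem theorem2 :
    ∃ (prog : RAM.Program) (C d K e : ℕ),
      -- the program decides the relation within the claimed number of operations,
      -- on integers whose bit length is polynomial in the encoding length of the input
      (∀ (n Δ : ℕ), 1 ≤ n → 1 ≤ Δ → ∀ (S T : IneqSystem n),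
        IsSimplex S.toSet → IsSimplex T.toSet → IsDeltaModular Δ S.A → IsDeltaModular Δ T.A →
        ∃ (t : ℕ) (σ : RAM.Store),
          RAM.Exec (K * (S.encodingLength + T.encodingLength) ^ e) prog (RAM.input S T) t σ ∧
          (t : ℝ) ≤ opBound C d n Δ ∧
          (UnimodularEquiv S.toSet T.toSet → RAM.output σ = 1) ∧
          (¬ UnimodularEquiv S.toSet T.toSet → RAM.output σ = 0)) ∧
      -- the bound is polynomial in the dimension for every fixed `Δ`
      (∀ Δ : ℕ, 1 ≤ Δ → ∃ C' d' : ℕ, ∀ n : ℕ, 1 ≤ n →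
        opBound C d n Δ ≤ (C' : ℝ) * (n : ℝ) ^ d') := by
  obtain ⟨c, hc⟩ := RAM.exists_mainProg
  refine ⟨RAM.mainProg, 102 ^ (c + 16), c + 16 + 3, 1600 * c + 2, 4,
    fun n Δ hn _ S T hS hT hSΔ hTΔ => ?_,
    fun Δ hΔ => ⟨_, _, fun n hn => opBound_le_pow _ _ hΔ hn⟩⟩
  have : NeZero n := ⟨by omega⟩
  set L := S.encodingLength + T.encodingLength with hL
  have hL1 : 1 ≤ L := by have := S.succ_le_encodingLength; omega
  have hnL : n ≤ L := by have := S.succ_le_encodingLength; omega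
  have hSL : S.encodingLength ≤ L := by omega
  have hTL : T.encodingLength ≤ L := by omega
  -- The given `Δ` may be far larger than the minors of the input. The minimum keeps the time
  -- polynomial in `Δ` and, at the same time, the bit lengths polynomial in the encoding length.
  let M : ℕ := min Δ (2 ^ (4 * (L + 1) ^ 2))
  have hSM : ∀ p, (dropRow S.A p).det ≠ 0 ∧ |(dropRow S.A p).det| ≤ M := fun p => by
    refine ⟨det_dropRow_ne_zero hS p, ?_⟩
    push_cast [M]
    exact le_min (abs_det_dropRow_le hS hSΔ p) (abs_det_dropRow_le_two_pow hnL (fun i j =>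
      (S.abs_A_le i j).trans (pow_le_pow_right₀ (by norm_num) hSL)) p)
  have hTM : ∀ p, (dropRow T.A p).det ≠ 0 ∧ |(dropRow T.A p).det| ≤ M := fun p => by
    refine ⟨det_dropRow_ne_zero hT p, ?_⟩
    push_cast [M]
    exact le_min (abs_det_dropRow_le hT hTΔ p) (abs_det_dropRow_le_two_pow hnL (fun i j =>
      (T.abs_A_le i j).trans (pow_le_pow_right₀ (by norm_num) hTL)) p)
  have hMΔ : M ≤ Δ := min_le_left _ _
  obtain ⟨hd0, hd⟩ := det_dropRow_primRows_le (hSM (Fin.last n)).1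
  have hdΔ : (dropRow (primRows S.A) (Fin.last n)).det.natAbs ≤ Δ := by
    have := (hSM (Fin.last n)).2
    rw [Int.abs_eq_natAbs] at this
    exact hd.trans ((by exact_mod_cast this : _ ≤ M).trans hMΔ)
  obtain ⟨t, σ, ht, he, hP⟩ := hc _ _ n _ _ S T
    (RAM.runBound hSL hTL le_rfl hSM hTM (min_le_right _ _))
  refine ⟨t, σ, he.mono ?_, ?_, fun h => hP.complete (h.rowEquiv hS hT), fun h =>
    hP.zero_or_one.resolve_right fun h1 => h ?_⟩
  -- The exponent `100 * (L + 1) ^ 4` of the stored integers is at most `1600 * L ^ 4`.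
  · have h1 : (L + 1) ^ 4 ≤ (2 * L) ^ 4 := Nat.pow_le_pow_left (by omega) 4
    have h2 : 1 ≤ L ^ 4 := Nat.one_le_pow _ _ hL1
    calc 100 * (L + 1) ^ 4 * c + 2 ≤ 100 * (2 * L) ^ 4 * c + 2 * L ^ 4 :=
          add_le_add (Nat.mul_le_mul_right _ (Nat.mul_le_mul_left _ h1)) (by omega)
      _ = (1600 * c + 2) * L ^ 4 := by ring
  · exact (Nat.cast_le.2 ht).trans
      (natCast_le_opBound hn (Int.natAbs_pos.2 hd0) hdΔ (by omega))
  · exact (hP.sound h1).unimodularEquiv (rowGcd_pos_of_det fun p => (hSM p).1)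
      (rowGcd_pos_of_det fun p => (hTM p).1)
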